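/- Work over an algebraically closed field $k$ of characteristic zero. Let $S$ be a toric log del Pezzo surface of Picard number one (a complete toric surface whose anticanonical divisor $-K_S$ is $\mathbb{Q}$-Cartier and ample, with Picard number $1$), and let $f : S' \to S$ be its minimal resolution, which is again toric. Call $S$ \emph{basic} if $D^2 \ge -2$ for every torus-invariant curve $D$ on $S'$ that meets some $(-1)$-curve $C$ on $S'$. For integers $a, b$ and finite sequences of integers $F_1, F_2$, let $[[a, F_1, b, F_2]]$ denote the smooth complete toric surface whose torus-invariant curves form a cycle with self-intersection numbers, in cyclic order, $a, F_1, b, F_2$, and which has a $\mathbb{P}^1$-fibration over $\mathbb{P}^1$ for which the curves with numbers $a$ and $b$ are sections and the chains with numbers $F_1$ and $F_2$ are the two torus-invariant fibres. If $S$ is basic, then $S'$ is one of the following surfaces: \begin{enumerate} \item $\mathbb{P}^2$; \item $S(std^0_n) = [[-n,\,(0),\,n,\,(0)]]$, the Hirzebruch surface $\mathbb{F}_n$, for some integer $n \ge 2$; \item $S(std^1_n) = [[-n,\,(0),\,n-1,\,(-2,-1,-2)]]$ for some integer $n \ge 2$; \item $S(std^2_n) = [[-n,\,(-2,-1,-2),\,n-2,\,(-2,-1,-2)]]$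 for some integer $n \ge 2$; \item $S(3A_2) = [[-2,\,(-2,-1,-2),\,-2,\,(-1,-2,-2,-1)]]$. \end{enumerate} -/

import Mathlib

open AlgebraicGeometry CategoryTheory

universe u

noncomputable section

namespace SurfaceGeometry

/-! ### Divisors and curves on integral Noetherian schemes -/

/-- Prime divisors of `X`, represented by their generic points (the points of codimension one);
on a surface these are the irreducible curves. The curve passes through `p` when `c ⤳ p`. -/
abbrev PrimeDivisor (X : Scheme.{u}) : Type u := {c : X // Order.coheight c = 1}

/-- Principal (Weil) divisors. -/
def principalDivisors (X : Scheme.{u}) [IsIntegral X] [IsLocallyNoetherian X] :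
    AddSubgroup (PrimeDivisor X →₀ ℤ) where
  carrier := {D | ∃ f : X.functionField, f ≠ 0 ∧ ∀ c : PrimeDivisor X, Scheme.ord f c.1 = D c}
  zero_mem' := by
    refine ⟨1, one_ne_zero, fun c => ?_⟩
    have h := Scheme.ord_mul (X := X) (x := c.1) (f := 1) (g := 1) one_ne_zero one_ne_zero
    rw [mul_one] at h
    simp only [Finsupp.coe_zero, Pi.zero_apply]
    omega
  add_mem' := by
    rintro D E ⟨f, hf, hD⟩ ⟨g, hg, hE⟩
    exact ⟨f * g, mul_ne_zero hf hg, fun c => by simp [Scheme.ord_mul hf hg, hD, hE]⟩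
  neg_mem' := by
    rintro D ⟨f, hf, hD⟩
    refine ⟨f⁻¹, inv_ne_zero hf, fun c => ?_⟩
    have h := Scheme.ord_mul (x := c.1) hf (inv_ne_zero hf)
    have h1 := Scheme.ord_mul (X := X) (x := c.1) (f := 1) (g := 1) one_ne_zero one_ne_zero
    rw [mul_inv_cancel₀ hf] at h
    rw [mul_one] at h1
    have := hD c
    simp only [Finsupp.coe_neg, Pi.neg_apply]
    omega

/-- Divisors that are principal in the local ring at every point. On a normal Noetherian scheme
these are exactly the Cartier divisors. -/
def cartierDivisors (X : Scheme.{u}) [IsIntegral X] [IsLocallyNoetherian X] :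
    AddSubgroup (PrimeDivisor X →₀ ℤ) where
  carrier := {D | ∀ x : X, ∃ f : X.functionField, f ≠ 0 ∧
    ∀ c : PrimeDivisor X, c.1 ⤳ x → Scheme.ord f c.1 = D c}
  zero_mem' := fun x => by
    obtain ⟨f, hf, h⟩ := (principalDivisors X).zero_mem
    exact ⟨f, hf, fun c _ => h c⟩
  add_mem' := by
    intro D E hD hE x
    obtain ⟨f, hf, hfD⟩ := hD x
    obtain ⟨g, hg, hgE⟩ := hE x
    exact ⟨f * g, mul_ne_zero hf hg, fun c hc => by
      simp [Scheme.ord_mul hf hg, hfD c hc, hgE c hc]⟩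
  neg_mem' := by
    intro D hD x
    obtain ⟨f, hf, hfD⟩ := hD x
    refine ⟨f⁻¹, inv_ne_zero hf, fun c hc => ?_⟩
    have h := Scheme.ord_mul (x := c.1) hf (inv_ne_zero hf)
    have h1 := Scheme.ord_mul (X := X) (x := c.1) (f := 1) (g := 1) one_ne_zero one_ne_zero
    rw [mul_inv_cancel₀ hf] at h
    rw [mul_one] at h1
    have := hfD c hc
    simp only [Finsupp.coe_neg, Pi.neg_apply]
    omega

/-- The Picard group of a normal Noetherian integral scheme: Cartier divisors modulo linear
equivalence. -/
abbrev PicardGroup (X : Scheme.{u}) [IsIntegral X] [IsLocallyNoetherian X] : Type u :=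
  cartierDivisors X ⧸ (principalDivisors X).addSubgroupOf (cartierDivisors X)

/-- The Picard number, as the rank of the Picard group. (On a complete toric surface numerically
trivial line bundles are trivial, so this is the rank of the Néron–Severi group.) -/
def picardNumber (X : Scheme.{u}) [IsIntegral X] [IsLocallyNoetherian X] : ℕ :=
  Module.finrank ℤ (PicardGroup X)

/-- A Cartier divisor `E` is ample if every point `x` has a neighbourhood of the form `X_s`, for a
global section `s` of some `𝒪(nE)` with `n > 0`, that is affine. A section of `𝒪(nE)` is a rational
function `f` with `div f + nE ≥ 0`, and `X_s` is the complement of the support of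
`div f + nE`. -/
def IsAmple {X : Scheme.{u}} [IsIntegral X] [IsLocallyNoetherian X]
    (E : PrimeDivisor X →₀ ℤ) : Prop :=
  ∀ x : X, ∃ n : ℕ, 0 < n ∧ ∃ f : X.functionField, f ≠ 0 ∧
    (∀ c : PrimeDivisor X, 0 ≤ Scheme.ord f c.1 + n * E c) ∧
    ∃ U : X.Opens, IsAffineOpen U ∧ x ∈ U ∧
      ∀ y : X, y ∈ U ↔ ∀ c : PrimeDivisor X, c.1 ⤳ y → Scheme.ord f c.1 + n * E c = 0

/-- For a curve `c` through `p`: the ideal of the curve in the local ring of `X` at `p`. -/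
def curveIdeal {X : Scheme.{u}} {c p : X} (h : c ⤳ p) : Ideal (X.presheaf.stalk p) :=
  (IsLocalRing.maximalIdeal (X.presheaf.stalk c)).comap (X.presheaf.stalkSpecializes h).hom

instance {X : Scheme.{u}} {c p : X} (h : c ⤳ p) : (curveIdeal h).IsPrime :=
  Ideal.comap_isPrime _ _

/-- The length of `𝒪_{C,p} / (a)`, where `C` is the curve `c`. -/
def curveLength {X : Scheme.{u}} {c p : X} (h : c ⤳ p) (a : X.presheaf.stalk p) : ℕ :=
  (Module.length (X.presheaf.stalk p)
    (X.presheaf.stalk p ⧸ (curveIdeal h ⊔ Ideal.span {a}))).toNat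

/-- `g` restricts to a nonzero rational function on the curve `c`, and the order at `p` of this
restriction is `n`: writing `g = a / b` with `a, b ∈ 𝒪_{X,p}` not vanishing identically on the
curve, `n = length 𝒪_{C,p}/(a) - length 𝒪_{C,p}/(b)`. -/
def HasOrderOnCurve {X : Scheme.{u}} [IsIntegral X] {c p : X} (h : c ⤳ p)
    (g : X.functionField) (n : ℤ) : Prop :=
  ∃ a b : X.presheaf.stalk p, a ∉ curveIdeal h ∧ b ∉ curveIdeal h ∧
    g = algebraMap (X.presheaf.stalk p) X.functionField a /
      algebraMap (X.presheaf.stalk p) X.functionField b ∧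
    n = (curveLength h a : ℤ) - (curveLength h b : ℤ)

/-- `C² = n` for a complete curve `C` on a smooth surface over an algebraically closed field.
Choose a rational function `f` with `ord_C f = 1`; then `C` is linearly equivalent to
`C - div f`, which does not contain `C`, and `C² = C · (C - div f)` is the sum over the closed
points `p` of `C` of the order at `p` of the restriction to `C` of `g / f`, where `g` is a local
equation of `C` at `p`. -/
def HasSelfIntersection {X : Scheme.{u}} [IsIntegral X] [IsLocallyNoetherian X]
    (c : PrimeDivisor X) (n : ℤ) : Prop :=
  ∃ f : X.functionField, Scheme.ord f c.1 = 1 ∧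
    ∃ μ : X →₀ ℤ, (∀ p, μ p ≠ 0 → c.1 ⤳ p ∧ IsClosed ({p} : Set X)) ∧
      (∀ (p : X) (h : c.1 ⤳ p), IsClosed ({p} : Set X) →
        ∃ g : X.presheaf.stalk p, curveIdeal h = Ideal.span {g} ∧
          HasOrderOnCurve h (algebraMap (X.presheaf.stalk p) X.functionField g / f) (μ p)) ∧
      n = μ.sum fun _ m => m

/-- Two curves meet if they have a common point. -/
def Meets {X : Scheme.{u}} (c d : PrimeDivisor X) : Prop := ∃ p : X, c.1 ⤳ p ∧ d.1 ⤳ p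

/-! ### Notions over a base field -/

/-- The constants in the local ring at a point of a `k`-scheme. -/
def constants {k : Type u} [Field k] {X : Scheme.{u}} (s : X ⟶ Spec (CommRingCat.of k)) (x : X) :
    k →+* X.presheaf.stalk x :=
  (X.presheaf.germ ⊤ x trivial).hom.comp
    (s.appTop.hom.comp (Scheme.ΓSpecIso (CommRingCat.of k)).inv.hom)

/-- The local rings of a `k`-scheme as `k`-algebras. -/
abbrev stalkAlgebra {k : Type u} [Field k] {X : Scheme.{u}} (s : X ⟶ Spec (CommRingCat.of k))
    (x : X) : Algebra k (X.presheaf.stalk x) :=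
  (constants s x).toAlgebra

open scoped KaehlerDifferential in
/-- `D` is a canonical divisor of a normal surface in characteristic zero: the divisor of a nonzero
rational `2`-form `dφ ∧ dψ`. Near the generic point of a curve the surface is smooth, the module of
differentials of the local ring has a basis `da, db`, and the order of `dφ ∧ dψ` along the curve is
that of `h` in `dφ ∧ dψ = h · da ∧ db`. -/
def IsCanonicalDivisor {k : Type u} [Field k] {X : Scheme.{u}} [IsIntegral X]
    [IsLocallyNoetherian X] (s : X ⟶ Spec (CommRingCat.of k)) (D : PrimeDivisor X →₀ ℤ) : Prop :=
  letI : ∀ x : X, Algebra k (X.presheaf.stalk x) := stalkAlgebra s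
  ∃ φ ψ : X.functionField, ∀ c : PrimeDivisor X,
    ∃ a b : X.presheaf.stalk c.1,
      LinearIndependent (X.presheaf.stalk c.1)
        ![KaehlerDifferential.D k (X.presheaf.stalk c.1) a,
          KaehlerDifferential.D k (X.presheaf.stalk c.1) b] ∧
      Submodule.span (X.presheaf.stalk c.1)
        {KaehlerDifferential.D k (X.presheaf.stalk c.1) a,
          KaehlerDifferential.D k (X.presheaf.stalk c.1) b} = ⊤ ∧
      ∃ p q r t : X.functionField,
        KaehlerDifferential.D k X.functionField φ =
          p • KaehlerDifferential.D k X.functionField (algebraMap _ X.functionField a) +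
          q • KaehlerDifferential.D k X.functionField (algebraMap _ X.functionField b) ∧
        KaehlerDifferential.D k X.functionField ψ =
          r • KaehlerDifferential.D k X.functionField (algebraMap _ X.functionField a) +
          t • KaehlerDifferential.D k X.functionField (algebraMap _ X.functionField b) ∧
        p * t - q * r ≠ 0 ∧ Scheme.ord (p * t - q * r) c.1 = D c

/-- The curve `c` on a complete surface is isomorphic to `ℙ¹`: it is a regular curve whose function
field is generated by one element over the (algebraically closed) base field. -/
def IsSmoothRationalCurve {k : Type u} [Field k] {X : Scheme.{u}}
    (s : X ⟶ Spec (CommRingCat.of k)) (c : PrimeDivisor X) : Prop :=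
  (∀ (p : X) (h : c.1 ⤳ p), IsClosed ({p} : Set X) →
    IsDiscreteValuationRing (X.presheaf.stalk p ⧸ curveIdeal h)) ∧
  ∃ t : X.residueField c.1,
    Subfield.closure (Set.range ((X.residue c.1).hom.comp (constants s c.1)) ∪ {t}) = ⊤

/-- `(-1)`-curves: smooth rational curves with self-intersection number `-1`. -/
def IsNegOneCurve {k : Type u} [Field k] {X : Scheme.{u}} [IsIntegral X] [IsLocallyNoetherian X]
    (s : X ⟶ Spec (CommRingCat.of k)) (c : PrimeDivisor X) : Prop :=
  IsSmoothRationalCurve s c ∧ HasSelfIntersection c (-1)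

/-- The rational function `φ` defines a `ℙ¹`-fibration `X → ℙ¹`: at each point `φ` or `φ⁻¹` is
regular, so that `φ` is a morphism to `ℙ¹`, and its generic fibre is a projective line over `k(φ)`,
that is, `k(X) = k(φ, t)` for some `t`. -/
def IsP1Fibration {k : Type u} [Field k] {X : Scheme.{u}} [IsIntegral X]
    (s : X ⟶ Spec (CommRingCat.of k)) (φ : X.functionField) : Prop :=
  (∀ x : X, ∃ a : X.presheaf.stalk x,
    algebraMap _ X.functionField a = φ ∨ algebraMap _ X.functionField a = φ⁻¹) ∧
  ∃ t : X.functionField,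
    Subfield.closure (Set.range (constants s (genericPoint X)) ∪ {φ, t}) = ⊤

/-- The curve `c` is a section of the fibration `φ : X → ℙ¹`, that is, `φ` maps `c` isomorphically
to `ℙ¹`: the restriction of `φ` to `c` generates the function field of `c` over `k`. -/
def IsSection {k : Type u} [Field k] {X : Scheme.{u}} [IsIntegral X]
    (s : X ⟶ Spec (CommRingCat.of k)) (φ : X.functionField) (c : PrimeDivisor X) : Prop :=
  ∃ a : X.presheaf.stalk c.1, algebraMap _ X.functionField a = φ ∧
    Subfield.closure (Set.range ((X.residue c.1).hom.comp (constants s c.1)) ∪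
      {(X.residue c.1).hom a}) = ⊤

/-- The grading of `k[x₀, x₁, x₂]` by degree. -/
instance planeGrading (k : Type u) [Field k] :
    GradedAlgebra (MvPolynomial.homogeneousSubmodule (Fin 3) k) :=
  MvPolynomial.gradedAlgebra

/-- The projective plane over `k`. -/
abbrev projectivePlane (k : Type u) [Field k] : Scheme.{u} :=
  Proj (MvPolynomial.homogeneousSubmodule (Fin 3) k)

/-- The structure morphism of the projective plane. -/
def projectivePlaneStr (k : Type u) [Field k] : projectivePlane k ⟶ Spec (CommRingCat.of k) :=
  Proj.toSpecZero (MvPolynomial.homogeneousSubmodule (Fin 3) k) ≫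
    Spec.map (CommRingCat.ofHom
      (algebraMap k (MvPolynomial.homogeneousSubmodule (Fin 3) k 0)))

/-! ### Toric surfaces -/

/-- The determinant of two lattice vectors. -/
def det (v w : ℤ × ℤ) : ℤ := v.1 * w.2 - v.2 * w.1

/-- The pairing of a character with a one-parameter subgroup. -/
def pairing (m v : ℤ × ℤ) : ℤ := m.1 * v.1 + m.2 * v.2

/-- A complete fan in `ℤ²`, given by its `n` primitive ray generators in counterclockwise order,
as an `n`-periodic sequence. The two-dimensional cones are those spanned by two consecutive
generators, and no other generator lies in such a cone. -/
structure CompleteFan where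
  n : ℕ
  n_pos : 0 < n
  ray : ℤ → ℤ × ℤ
  periodic : ∀ i, ray (i + n) = ray i
  primitive : ∀ i, IsCoprime (ray i).1 (ray i).2
  det_pos : ∀ i, 0 < det (ray i) (ray (i + 1))
  disjoint : ∀ i j, 0 ≤ det (ray i) (ray j) → 0 ≤ det (ray j) (ray (i + 1)) →
    (n : ℤ) ∣ j - i ∨ (n : ℤ) ∣ j - (i + 1)

/-- The monoid `σ^∨ ∩ M` of the cone `σ` spanned by `v` and `w`. -/
def dualMonoid (v w : ℤ × ℤ) : AddSubmonoid (ℤ × ℤ) where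
  carrier := {m | 0 ≤ pairing m v ∧ 0 ≤ pairing m w}
  zero_mem' := by simp [pairing]
  add_mem' := by
    rintro a b ⟨h1, h2⟩ ⟨h3, h4⟩
    refine ⟨?_, ?_⟩ <;> simp only [pairing, Prod.fst_add, Prod.snd_add] at * <;> linarith

/-- The torus `Spec k[ℤ²]`. -/
abbrev torusScheme (k : Type u) [Field k] : Scheme.{u} :=
  Spec (CommRingCat.of (AddMonoidAlgebra k (ℤ × ℤ)))

/-- The affine toric surface `Spec k[σ^∨ ∩ M]` of the cone `σ` spanned by `v` and `w`. -/
abbrev affineToric (k : Type u) [Field k] (v w : ℤ × ℤ) : Scheme.{u} :=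
  Spec (CommRingCat.of (AddMonoidAlgebra k (dualMonoid v w)))

/-- The inclusion of the torus in an affine toric surface. -/
def torusInclusion (k : Type u) [Field k] (v w : ℤ × ℤ) : torusScheme k ⟶ affineToric k v w :=
  Spec.map (CommRingCat.ofHom (AddMonoidAlgebra.mapDomainRingHom k (dualMonoid v w).subtype))

/-- A complete toric surface over `k`: the toric variety of a complete fan in `ℤ²`. It is the
complete variety glued from the affine toric surfaces of the two-dimensional cones of the fan,
which all contain the same torus. (As `X` is separated and integral, the charts determine the
gluing: the intersection of two charts is the affine toric variety of the common face.) -/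
structure ToricSurface (k : Type u) [Field k] where
  X : Scheme.{u}
  str : X ⟶ Spec (CommRingCat.of k)
  integral : IsIntegral X
  proper : IsProper str
  fan : CompleteFan
  torus : torusScheme k ⟶ X
  chart : ∀ i : ℤ, affineToric k (fan.ray i) (fan.ray (i + 1)) ⟶ X
  chart_isOpenImmersion : ∀ i, IsOpenImmersion (chart i)
  torusInclusion_chart : ∀ i, torusInclusion k (fan.ray i) (fan.ray (i + 1)) ≫ chart i = torus
  chart_str : ∀ i, chart i ≫ str = Spec.map (CommRingCat.ofHom
    (algebraMap k (AddMonoidAlgebra k (dualMonoid (fan.ray i) (fan.ray (i + 1))))))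
  covers : ∀ x : X, ∃ i, x ∈ Set.range (chart i)

instance {k : Type u} [Field k] (S : ToricSurface k) : IsIntegral S.X := S.integral

instance {k : Type u} [Field k] (S : ToricSurface k) : IsProper S.str := S.proper

instance {k : Type u} [Field k] (S : ToricSurface k) : IsLocallyNoetherian S.X :=
  LocallyOfFiniteType.isLocallyNoetherian S.str

/-- The curve `c` is torus-invariant, that is, it is disjoint from the open torus orbit. -/
def ToricSurface.IsInvariant {k : Type u} [Field k] (S : ToricSurface k)
    (c : PrimeDivisor S.X) : Prop :=
  c.1 ∉ Set.range S.torus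

/-- Log del Pezzo: the anticanonical divisor is `ℚ`-Cartier and ample. (A toric surface is normal,
and it is log terminal, having only cyclic quotient singularities.) -/
def ToricSurface.IsLogDelPezzo {k : Type u} [Field k] (S : ToricSurface k) : Prop :=
  ∃ D : PrimeDivisor S.X →₀ ℤ, IsCanonicalDivisor S.str D ∧
    ∃ m : ℕ, 0 < m ∧ -(m • D) ∈ cartierDivisors S.X ∧ IsAmple (-(m • D))

/-- `f : S' → S` is the minimal resolution of the toric surface `S`: `S'` is a smooth toric
surface, `f` is a proper `k`-morphism that restricts to the identity of the torus (in particular it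
is birational), and `f` contracts no `(-1)`-curve. -/
structure IsMinimalResolution {k : Type u} [Field k] {S' S : ToricSurface k}
    (f : S'.X ⟶ S.X) : Prop where
  smooth : Smooth S'.str
  proper : IsProper f
  over_base : f ≫ S.str = S'.str
  torus : S'.torus ≫ f = S.torus
  minimal : ∀ c : PrimeDivisor S'.X, IsClosed ({f c.1} : Set S.X) → ¬ IsNegOneCurve S'.str c

/-- The condition on the minimal resolution `S'` of `S` for `S` to be basic: `D² ≥ -2` for every
torus-invariant curve `D` on `S'` that meets a `(-1)`-curve on `S'`. -/
def ToricSurface.IsBasic {k : Type u} [Field k] (S' : ToricSurface k) : Prop :=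
  ∀ C : PrimeDivisor S'.X, IsNegOneCurve S'.str C →
    ∀ D : PrimeDivisor S'.X, S'.IsInvariant D → Meets C D →
      ∀ n : ℤ, HasSelfIntersection D n → -2 ≤ n

/-- `S'` is the smooth toric surface `[[a, F₁, b, F₂]]`. Its torus-invariant curves form a cycle
whose self-intersection numbers are, in cyclic order, `a, F₁, b, F₂`, and there is a `ℙ¹`-fibration
`φ : S' → ℙ¹` for which the curves with numbers `a` and `b` are sections and the two chains with
numbers `F₁` and `F₂` are the (supports of the) fibres over `0` and `∞`. -/
def ToricSurface.IsFibred {k : Type u} [Field k] (S' : ToricSurface k)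
    (a : ℤ) (F₁ : List ℤ) (b : ℤ) (F₂ : List ℤ) : Prop :=
  ∃ C : Fin (a :: (F₁ ++ b :: F₂)).length → PrimeDivisor S'.X,
    Function.Injective C ∧ Set.range C = {c | S'.IsInvariant c} ∧
    (∀ i, HasSelfIntersection (C i) ((a :: (F₁ ++ b :: F₂)).get i)) ∧
    (∀ i j, i ≠ j → (Meets (C i) (C j) ↔
      (i.1 + 1) % (a :: (F₁ ++ b :: F₂)).length = j.1 ∨
      (j.1 + 1) % (a :: (F₁ ++ b :: F₂)).length = i.1)) ∧
    ∃ φ : S'.X.functionField, IsP1Fibration S'.str φ ∧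
      (∀ i, i.1 = 0 ∨ i.1 = F₁.length + 1 → IsSection S'.str φ (C i)) ∧
      (∀ c, 0 < Scheme.ord φ c.1 ↔ ∃ i, 0 < i.1 ∧ i.1 < F₁.length + 1 ∧ c = C i) ∧
      (∀ c, Scheme.ord φ c.1 < 0 ↔ ∃ i, F₁.length + 1 < i.1 ∧ c = C i)

/-- `S' = S(ℙ²)`: the projective plane. -/
def ToricSurface.IsP2 {k : Type u} [Field k] (S' : ToricSurface k) : Prop :=
  ∃ e : S'.X ≅ projectivePlane k, e.hom ≫ projectivePlaneStr k = S'.str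

/-- `S' = S(std⁰_n)`, the Hirzebruch surface `𝔽_n`; both fibres are smooth. -/
def ToricSurface.IsStd0 {k : Type u} [Field k] (S' : ToricSurface k) (n : ℤ) : Prop :=
  S'.IsFibred (-n) [0] n [0]

/-- `S' = S(std¹_n)`. -/
def ToricSurface.IsStd1 {k : Type u} [Field k] (S' : ToricSurface k) (n : ℤ) : Prop :=
  S'.IsFibred (-n) [0] (n - 1) [-2, -1, -2]

/-- `S' = S(std²_n)`. -/
def ToricSurface.IsStd2 {k : Type u} [Field k] (S' : ToricSurface k) (n : ℤ) : Prop :=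
  S'.IsFibred (-n) [-2, -1, -2] (n - 2) [-2, -1, -2]

/-- `S' = S(3A₂)`. -/
def ToricSurface.Is3A2 {k : Type u} [Field k] (S' : ToricSurface k) : Prop :=
  S'.IsFibred (-2) [-2, -1, -2] (-2) [-1, -2, -2, -1]

end SurfaceGeometry

end

open SurfaceGeometry

open SurfaceGeometry

namespace SurfaceGeometry

/-! ### Determinants and complete fans -/

/-! The theorem is translated into a statement about cyclic sequences of lattice vectors. Let v_i be
the ray generators of S' in counterclockwise order. Smoothness forces det(v_i, v_{i+1}) = 1
(`det_eq_one_of_formallySmooth`), so v_{i-1} + v_{i+1} = a_i v_i, and the curve of v_i has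
self-intersection -a_i (`hasSelfIntersection_divisor`). Picard number one leaves only three rays for
S (`n_eq_three_of_picardNumber`). As f is the identity on the torus, it maps orbits to orbits. Since
f is closed, the rays of S are among those of S'; by minimality every v_i with a_i = 1 is a ray of S
(`basicFan`).

The engine of the combinatorics is convexity. For fixed u the sequence g_i = det(u, v_i) satisfies
g_{i-1} + g_{i+1} = a_i g_i, so where g is nonnegative and the a_i are at least 2 it keeps growing
once it has stopped falling (`le_succ_of_rec`). A ray of S' strictly inside a cone of S has a_i ≥ 2.
If a_i = 1 and a neighbour of v_i were a ray of S, convexity would put the three rays of S into a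
closed half-plane, which is impossible (`not_special_sub`). So the neighbours have a ≥ 2, and
basicness makes this an equality.

Suppose some a_i = 1. Then v_{i-2} and v_{i+2} are opposite: they are sections of a fibration with a
fibre (-2, -1, -2). On the far side the determinants with v_{i+2} are the multiplicities of the
second fibre; they begin 0, 1 and end 1, 0. Convexity produces a coefficient at most 1 there, and
basicness leaves three patterns: a single 0-curve, again (-2, -1, -2), or a chain of multiplicity
one with -1 at both ends and -2 in between. In the last pattern the sections are neighbours of
(-1)-curves, so they have self-intersection -2, and closing the cycle fixes the length of the chain.
The bound n ≥ 2 holds because S has only three rays: if both sections had a ≤ 1, they would give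
four rays of S together with the (-1)-curve and a curve of the second fibre. If no a_i is 1 but some
a_i is 0, the same argument gives a Hirzebruch surface; if neither value occurs, there are just
three rays.

To return to geometry, three unimodular rays give the standard charts of the projective plane
(`isP2_of_n_eq_three`). In the other cases the character that vanishes on the two opposite section
rays is the fibration (`isFibred_of_hasCycle`). -/

lemma det_add_right (u v w : ℤ × ℤ) : det u (v + w) = det u v + det u w := by
  simp only [det, Prod.fst_add, Prod.snd_add]; ring

lemma det_sub_right (u v w : ℤ × ℤ) : det u (v - w) = det u v - det u w := by
  simp only [det, Prod.fst_sub, Prod.snd_sub]; ring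

lemma det_swap (u v : ℤ × ℤ) : det u v = -det v u := by
  simp only [det]; ring

lemma det_self (u : ℤ × ℤ) : det u u = 0 := by
  simp only [det]; ring

lemma det_neg_left (u v : ℤ × ℤ) : det (-u) v = -det u v := by
  simp only [det, Prod.fst_neg, Prod.snd_neg]; ring

lemma det_neg_right (u v : ℤ × ℤ) : det u (-v) = -det u v := by
  simp only [det, Prod.fst_neg, Prod.snd_neg]; ring

lemma det_smul_right (c : ℤ) (u v : ℤ × ℤ) : det u (c • v) = c * det u v := by
  simp only [det, Prod.smul_fst, Prod.smul_snd, smul_eq_mul]; ring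

/-- The Plücker relation. -/
lemma det_plucker (a b c d : ℤ × ℤ) :
    det a b * det c d = det a c * det b d - det a d * det b c := by
  simp only [det]; ring

/-- A vector in the plane is determined by its determinants with two independent vectors. -/
lemma eq_of_det_eq {a b u v : ℤ × ℤ} (h : det a b ≠ 0) (h1 : det a u = det a v)
    (h2 : det b u = det b v) : u = v := by
  have e1 : det a b * (u.1 - v.1) = 0 := by
    have : det a b * (u.1 - v.1) = b.1 * (det a u - det a v) + a.1 * (det b v - det b u) := by
      simp only [det]; ring
    rw [this, h1, h2]; ring
  have e2 : det a b * (u.2 - v.2) = 0 := by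
    have : det a b * (u.2 - v.2) = b.2 * (det a u - det a v) + a.2 * (det b v - det b u) := by
      simp only [det]; ring
    rw [this, h1, h2]; ring
  have f1 := (mul_eq_zero.mp e1).resolve_left h
  have f2 := (mul_eq_zero.mp e2).resolve_left h
  ext <;> omega

/-- Two primitive vectors with vanishing determinant agree up to sign. -/
lemma eq_or_eq_neg_of_det_eq_zero {u v : ℤ × ℤ} (hu : IsCoprime u.1 u.2)
    (hv : IsCoprime v.1 v.2) (h : det u v = 0) : v = u ∨ v = -u := by
  obtain ⟨a, b, hab⟩ := hu
  obtain ⟨c, d, hcd⟩ := hv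
  have h' : u.1 * v.2 = u.2 * v.1 := by simp only [det] at h; linarith
  set t := a * v.1 + b * v.2 with ht
  set s := c * u.1 + d * u.2 with hs
  have h1 : v.1 = t * u.1 := by linear_combination (-v.1) * hab - b * h'
  have h2 : v.2 = t * u.2 := by linear_combination (-v.2) * hab + a * h'
  have hst : t * s = 1 := by rw [← hcd, h1, h2, hs]; ring
  rcases Int.eq_one_or_neg_one_of_mul_eq_one hst with h3 | h3
  · left; ext <;> simp [h1, h2, h3]
  · right; ext <;> simp [h1, h2, h3]

/-! ### Cyclic order of the rays of a complete fan -/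

namespace CompleteFan

variable (F : CompleteFan)

lemma ray_add_mul (i t : ℤ) : F.ray (i + F.n * t) = F.ray i := by
  induction t using Int.induction_on with
  | zero => simp
  | succ t ih => rw [← ih, ← F.periodic (i + F.n * t)]; congr 1; ring
  | pred t ih => rw [← ih, ← F.periodic (i + F.n * (-t - 1))]; congr 1; ring

variable {F}

lemma ray_congr {i j : ℤ} (h : (F.n : ℤ) ∣ j - i) : F.ray j = F.ray i := by
  obtain ⟨t, ht⟩ := h
  rw [show j = i + F.n * t by omega, ray_add_mul]

lemma ray_succ_congr {i j : ℤ} (h : (F.n : ℤ) ∣ j - i) : F.ray (j + 1) = F.ray (i + 1) :=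
  ray_congr (by simpa using h)

/-- `disjoint` also allows j congruent to i + 1; there the second determinant would be zero. -/
lemma dvd_of_det {i j : ℤ} (h1 : 0 ≤ det (F.ray i) (F.ray j))
    (h2 : 0 < det (F.ray j) (F.ray (i + 1))) : (F.n : ℤ) ∣ j - i := by
  refine (F.disjoint i j h1 h2.le).resolve_right fun h => ?_
  rw [ray_congr h, det_self] at h2
  exact lt_irrefl _ h2

lemma dvd_of_ray_eq {i j : ℤ} (h : F.ray i = F.ray j) : (F.n : ℤ) ∣ j - i :=
  dvd_of_det (by rw [h, det_self]) (by rw [← h]; exact F.det_pos i)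

/-- With one ray, v_1 = v_0 has determinant zero with v_0; with two rays, det(v_0, v_1) and det(v_1,
v_0) cannot both be positive. -/
lemma three_le : 3 ≤ F.n := by
  have h0 := F.n_pos
  have h1 := F.det_pos 0
  have h2 := F.det_pos 1
  by_contra hn
  interval_cases h : F.n
  · have : F.ray (0 + 1) = F.ray 0 := ray_congr (by simp [h])
    rw [this, det_self] at h1
    exact lt_irrefl _ h1
  · have : F.ray (1 + 1) = F.ray 0 := ray_congr (by simp [h])
    rw [this, det_swap] at h2
    rw [zero_add] at h1
    omega

lemma ray_ne_zero (i : ℤ) : F.ray i ≠ 0 := by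
  intro h
  have := F.det_pos i
  simp [h, det] at this

/-- The cones of a complete fan cover the plane. -/
lemma exists_cone (F : CompleteFan) {u : ℤ × ℤ} (hu : u ≠ 0) :
    ∃ i, 0 ≤ det (F.ray i) u ∧ 0 < det u (F.ray (i + 1)) := by
  by_contra! hcon
  -- If u lies in no cone, then once u is weakly to the left of v_i it is so for v_{i+1}. By
  -- periodicity the sign of g is then the same for all i.
  set g : ℤ → ℤ := fun i => det (F.ray i) u with hg
  have hstep : ∀ i, 0 ≤ g i → 0 ≤ g (i + 1) := fun i hi => by
    have := hcon i hi
    rw [det_swap] at this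
    simp only [hg]; omega
  have hper : ∀ i t, g (i + F.n * t) = g i := fun i t => by simp only [hg, F.ray_add_mul]
  have hfw : ∀ i (m : ℕ), 0 ≤ g i → 0 ≤ g (i + m) := fun i m hi => by
    induction m with
    | zero => simpa using hi
    | succ m ih => have := hstep _ ih; rw [add_assoc] at this; exact_mod_cast this
  have hall : ∀ i j, 0 ≤ g i → 0 ≤ g j := fun i j hi => by
    have h1 := F.n_pos
    -- Full turns are added so that j is reached from i by a nonnegative number of forward steps.
    have h2 : 0 ≤ j - i + F.n * |j - i| := by
      nlinarith [abs_nonneg (j - i), neg_abs_le (j - i)]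
    have := hfw i (j - i + F.n * |j - i|).toNat hi
    rw [Int.toNat_of_nonneg h2, show i + (j - i + F.n * |j - i|) = j + F.n * |j - i| by ring,
      hper] at this
    exact this
  have hprod : ∀ i, 0 < g i * g (i + 1) := by
    by_cases h : ∃ i, 0 ≤ g i
    · obtain ⟨i0, h0⟩ := h
      have hnn : ∀ i, 0 ≤ g i := fun i => hall i0 i h0
      have hpos : ∀ i, 0 < g i := by
        intro i
        refine lt_of_le_of_ne (hnn i) fun h0 => ?_
        -- If g vanishes at i, this relation equates a positive multiple of g (i - 1) with a
        -- negative multiple of g (i + 1). Both values are nonnegative, so g (i - 1) = 0 as well,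
        -- and u = 0.
        have e1 := det_plucker (F.ray i) (F.ray (i + 1)) (F.ray (i - 1)) u
        have e2 := F.det_pos i
        have e3 := F.det_pos (i - 1)
        have e4 := hnn (i + 1)
        have e5 := hnn (i - 1)
        rw [sub_add_cancel] at e3
        have hsw := det_swap (F.ray i) (F.ray (i - 1))
        simp only [hg] at h0 e4 e5
        rw [← h0, hsw] at e1
        have e6 : 0 ≤ det (F.ray i) (F.ray (i + 1)) * det (F.ray (i - 1)) u :=
          mul_nonneg e2.le e5
        have e7 : det (F.ray (i - 1)) u = 0 := by
          by_contra hne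
          have : 0 < det (F.ray i) (F.ray (i + 1)) * det (F.ray (i - 1)) u :=
            mul_pos e2 (lt_of_le_of_ne e5 (Ne.symm hne))
          nlinarith [mul_nonneg e3.le e4]
        have := eq_of_det_eq (a := F.ray (i - 1)) (b := F.ray i) (u := u) (v := 0)
          (by omega) (by rw [e7]; simp [det]) (by rw [← h0]; simp [det])
        exact hu this
      exact fun i => mul_pos (hpos i) (hpos (i + 1))
    · push Not at h
      exact fun i => mul_pos_of_neg_of_neg (h i) (h (i + 1))
  -- r i is the cotangent of the angle from v_i to u. It grows strictly with i, which contradicts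
  -- periodicity.
  set r : ℤ → ℚ := fun i => ((F.ray i).1 * u.1 + (F.ray i).2 * u.2 : ℤ) / (g i : ℚ) with hr
  have hmono : StrictMono r := by
    refine strictMono_int_of_lt_succ fun i => ?_
    have h1 := hprod i
    have hne1 : (g i : ℚ) ≠ 0 := by
      intro h; rw [Int.cast_eq_zero] at h; rw [h] at h1; simp at h1
    have hne2 : (g (i + 1) : ℚ) ≠ 0 := by
      intro h; rw [Int.cast_eq_zero] at h; rw [h] at h1; simp at h1
    have hu2 : 0 < u.1 * u.1 + u.2 * u.2 := by
      by_contra hle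
      have a1 : u.1 = 0 := by nlinarith [mul_self_nonneg u.1, mul_self_nonneg u.2]
      have a2 : u.2 = 0 := by nlinarith [mul_self_nonneg u.1, mul_self_nonneg u.2]
      exact hu (Prod.ext a1 a2)
    have key : r (i + 1) - r i =
        ((det (F.ray i) (F.ray (i + 1)) * (u.1 * u.1 + u.2 * u.2) : ℤ) : ℚ) /
          ((g i * g (i + 1) : ℤ) : ℚ) := by
      simp only [hr]
      push_cast
      rw [div_sub_div _ _ hne2 hne1, mul_comm (g i : ℚ) (g (i + 1) : ℚ)]
      congr 1
      simp only [hg, det]; push_cast; ring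
    have : 0 < r (i + 1) - r i := by
      rw [key]
      exact div_pos (by exact_mod_cast mul_pos (F.det_pos i) hu2) (by exact_mod_cast h1)
    linarith
  have h1 : r (0 + F.n * 1) = r 0 := by simp only [hr, hg, F.ray_add_mul]
  have h2 := hmono.injective h1
  have := F.n_pos
  omega

/-- A ray of a complete fan lies only in the two adjacent cones. -/
lemma dvd_or_dvd_of_mem {i j : ℤ} (h1 : 0 ≤ det (F.ray i) (F.ray j))
    (h2 : 0 ≤ det (F.ray j) (F.ray (i + 1))) : (F.n : ℤ) ∣ j - i ∨ (F.n : ℤ) ∣ j - (i + 1) :=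
  F.disjoint i j h1 h2

lemma ray_eq_neg_of_det {i j : ℤ} (h : det (F.ray i) (F.ray j) = 0) (hij : ¬ (F.n : ℤ) ∣ j - i) :
    F.ray j = -F.ray i :=
  (eq_or_eq_neg_of_det_eq_zero (F.primitive i) (F.primitive j) h).resolve_left
    fun h => hij (dvd_of_ray_eq h.symm)

lemma not_dvd_of_lt {i j : ℤ} (h1 : i < j) (h2 : j < i + F.n) : ¬ (F.n : ℤ) ∣ j - i :=
  fun h => by have := Int.le_of_dvd (by omega) h; omega

/-- The rays between `v_p` and a ray in its closed left half-plane lie in the open left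
half-plane. -/
lemma det_pos_of_between {p j q : ℤ} (hpj : p < j) (hjq : j < q) (hq : q < p + F.n)
    (h : 0 ≤ det (F.ray p) (F.ray q)) : 0 < det (F.ray p) (F.ray j) := by
  by_contra! hj
  -- Rays that have left the open left half-plane of v_p cannot come back before a full turn: the
  -- cone across which they return would contain v_p, and `disjoint` would make v_p one of its
  -- edges.
  have key : ∀ m : ℕ, j + 1 + m < p + F.n → det (F.ray p) (F.ray (j + 1 + m)) < 0 := by
    intro m
    induction m with
    | zero =>
      intro hlt
      by_contra! hge
      rw [Nat.cast_zero, add_zero] at hge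
      rcases hj.lt_or_eq with h1 | h1
      · rcases F.disjoint j p (by rw [det_swap]; omega) hge with h2 | h2
        · exact not_dvd_of_lt (F := F) hpj (by omega) (by rw [← dvd_neg]; simpa using h2)
        · exact not_dvd_of_lt (F := F) (i := p) (j := j + 1) (by omega) (by omega)
            (by rw [← dvd_neg]; simpa using h2)
      · have h2 := ray_eq_neg_of_det h1 (not_dvd_of_lt hpj (by omega))
        have h3 := F.det_pos j
        rw [h2, det_neg_left] at h3
        omega
    | succ m ih =>
      intro hlt
      push_cast at hlt ⊢
      have h1 := ih (by omega)
      by_contra! hge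
      rw [← add_assoc] at hge
      rcases F.disjoint (j + 1 + m) p (by rw [det_swap]; omega) hge with h2 | h2
      · exact not_dvd_of_lt (F := F) (i := p) (j := j + 1 + m) (by omega) (by omega)
          (by rw [← dvd_neg]; simpa using h2)
      · exact not_dvd_of_lt (F := F) (i := p) (j := j + 1 + m + 1) (by omega) (by omega)
          (by rw [← dvd_neg]; simpa using h2)
  have := key (q - (j + 1)).toNat (by rw [Int.toNat_of_nonneg (by omega)]; omega)
  rw [Int.toNat_of_nonneg (by omega), show j + 1 + (q - (j + 1)) = q by ring] at this
  omega

variable (F) in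
/-- The integer `a` with `v_{i-1} + v_{i+1} = a v_i` in a smooth fan; the self-intersection number
of the curve of `v_i` is `-a`. -/
def coeff (i : ℤ) : ℤ := det (F.ray (i - 1)) (F.ray (i + 1))

lemma coeff_congr {i j : ℤ} (h : (F.n : ℤ) ∣ j - i) : F.coeff j = F.coeff i := by
  rw [coeff, coeff, ray_succ_congr h, ray_congr (i := i - 1) (j := j - 1) (by simpa using h)]

lemma ray_rec (hs : ∀ i, det (F.ray i) (F.ray (i + 1)) = 1) (i : ℤ) :
    F.ray (i + 1) = F.coeff i • F.ray i - F.ray (i - 1) := by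
  have h1 := hs (i - 1)
  rw [sub_add_cancel] at h1
  refine eq_of_det_eq (a := F.ray (i - 1)) (b := F.ray i) (by rw [h1]; norm_num) ?_ ?_
  · rw [det_sub_right, det_smul_right, det_self, h1, coeff]; ring
  · rw [det_sub_right, det_smul_right, det_self, hs,
      det_swap (F.ray i), h1]; ring

/-- This three-term recurrence is the source of all the convexity estimates. -/
lemma det_rec (hs : ∀ i, det (F.ray i) (F.ray (i + 1)) = 1) (u : ℤ × ℤ) (i : ℤ) :
    det u (F.ray (i + 1)) = F.coeff i * det u (F.ray i) - det u (F.ray (i - 1)) := by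
  rw [ray_rec hs, det_sub_right, det_smul_right]

end CompleteFan

/-- A nonnegative sequence with `g (j-1) + g (j+1) = b j * g j`, `b j ≥ 2`, that does not decrease
at first never decreases. -/
lemma le_succ_of_rec {g b : ℕ → ℤ} {N : ℕ} (h0 : g 0 ≤ g 1) (h1 : 0 ≤ g 1)
    (hrec : ∀ j, 1 ≤ j → j < N → g (j - 1) + g (j + 1) = b j * g j)
    (hb : ∀ j, 1 ≤ j → j < N → 2 ≤ b j) :
    ∀ j, j < N → g j ≤ g (j + 1) ∧ g 1 ≤ g (j + 1) := by
  intro j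
  induction j with
  | zero => intro _; exact ⟨h0, le_rfl⟩
  | succ j ih =>
    intro hj
    obtain ⟨e1, e2⟩ := ih (by omega)
    have e3 := hrec (j + 1) (by omega) hj
    have e4 := hb (j + 1) (by omega) hj
    rw [Nat.add_sub_cancel] at e3
    -- The new increment is (b - 2) g (j + 1) plus the old increment.
    have : g (j + 1) ≤ g (j + 1 + 1) := by nlinarith
    exact ⟨this, by omega⟩

/-! ### The classification of basic fans -/

/-- The coefficients of the fan are, up to orientation and rotation, the negatives of the entries
of the list. -/
def CompleteFan.HasCycle (F : CompleteFan) (L : List ℤ) : Prop :=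
  F.n = L.length ∧ ∃ p ε : ℤ, (ε = 1 ∨ ε = -1) ∧
    ∀ (j : ℕ) (hj : j < L.length), F.coeff (p + ε * j) = -L[j]

/-- The smooth fan `F` refines the fan `G` with three rays, the rays with coefficient `1` are rays
of `G`, and their neighbours have coefficient at most `2`. -/
structure BasicFan (F G : CompleteFan) : Prop where
  unimodular : ∀ i, det (F.ray i) (F.ray (i + 1)) = 1
  three : G.n = 3
  isRay : ∀ j, ∃ i, F.ray i = G.ray j
  minimal : ∀ i, F.coeff i = 1 → ∃ j, F.ray i = G.ray j
  basic : ∀ i, F.coeff i = 1 → F.coeff (i + 1) ≤ 2 ∧ F.coeff (i - 1) ≤ 2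

namespace BasicFan

open CompleteFan

variable {F G : CompleteFan} (h : BasicFan F G)
include h

/-- The rays not in `G` have coefficient at least `2`. -/
lemma two_le_coeff {i : ℤ} (hi : ¬ ∃ j, F.ray i = G.ray j) : 2 ≤ F.coeff i := by
  have hne : F.coeff i ≠ 1 := fun h1 => hi (h.minimal i h1)
  obtain ⟨j, h1, h2⟩ := G.exists_cone (F.ray_ne_zero i)
  obtain ⟨l, hl⟩ := h.isRay (j + 1)
  obtain ⟨l', hl'⟩ := h.isRay j
  have hpos : 0 < det (G.ray j) (F.ray i) := by
    refine lt_of_le_of_ne h1 fun h0 => ?_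
    have h3 := G.det_pos j
    rcases eq_or_eq_neg_of_det_eq_zero (G.primitive j) (F.primitive i) h0.symm with h4 | h4
    · exact hi ⟨j, h4⟩
    · rw [h4, det_neg_left] at h2; omega
  -- v_i is strictly inside a cone of G whose edges are rays of F, so its neighbours stay in the
  -- closed cone. Hence the left side is positive, and therefore so is the coefficient.
  have hrel : det (G.ray j) (F.ray (i - 1)) + det (G.ray j) (F.ray (i + 1)) =
      F.coeff i * det (G.ray j) (F.ray i) := by
    rw [det_rec h.unimodular]; ring
  have hnext : 0 < det (G.ray j) (F.ray (i + 1)) := by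
    have h5 : 0 ≤ det (F.ray (i + 1)) (G.ray (j + 1)) := by
      by_contra! hlt
      rw [det_swap] at hlt
      rw [← hl] at h2 hlt
      rcases F.disjoint i l h2.le (by omega) with h6 | h6
      · exact hi ⟨j + 1, by rw [← hl]; exact (ray_congr h6).symm⟩
      · rw [ray_congr h6, det_self] at hlt; simp at hlt
    have h6 := det_plucker (G.ray j) (F.ray (i + 1)) (F.ray i) (G.ray (j + 1))
    rw [det_swap (F.ray (i + 1)) (F.ray i), h.unimodular] at h6
    have h7 := G.det_pos j
    have : 0 < det (G.ray j) (F.ray (i + 1)) * det (F.ray i) (G.ray (j + 1)) := by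
      rw [h6]; nlinarith [mul_nonneg h1 h5]
    exact pos_of_mul_pos_left this h2.le
  have hprev : 0 ≤ det (G.ray j) (F.ray (i - 1)) := by
    by_contra! hlt
    rw [det_swap] at hlt
    rw [← hl'] at hlt hpos
    have hi1 : i - 1 + 1 = i := by ring
    rcases F.disjoint (i - 1) l' (by omega) (by rw [hi1]; exact hpos.le) with h6 | h6
    · rw [ray_congr h6, det_self] at hlt; simp at hlt
    · exact hi ⟨j, by rw [← hl']; exact (ray_congr (by rwa [hi1] at h6)).symm⟩
  have : 0 < F.coeff i := by
    by_contra! hle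
    nlinarith
  omega

/-- Three rays of `G` are positively dependent. -/
lemma exists_pos_rel {j j' l : ℤ} (h1 : G.ray j ≠ G.ray j') (h2 : G.ray j ≠ G.ray l)
    (h3 : G.ray j' ≠ G.ray l) : ∃ a b c : ℤ, 0 < a ∧ 0 < b ∧ 0 < c ∧ ∀ s : ℤ × ℤ,
      a * det s (G.ray j) + b * det s (G.ray j') + c * det s (G.ray l) = 0 := by
  have hn := h.three
  have key : ∀ j : ℤ, 0 < det (G.ray (j + 1)) (G.ray (j + 2)) ∧
      0 < det (G.ray (j + 2)) (G.ray j) ∧ 0 < det (G.ray j) (G.ray (j + 1)) := by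
    intro j
    have e1 := G.det_pos (j + 1)
    have e2 := G.det_pos (j + 2)
    have e3 : G.ray (j + 2 + 1) = G.ray j := ray_congr (by rw [hn]; norm_num [add_assoc])
    rw [e3] at e2
    rw [add_assoc] at e1
    exact ⟨e1, e2, G.det_pos j⟩
  obtain ⟨e1, e2, e3⟩ := key j
  have d1 : ¬ (3 : ℤ) ∣ j' - j := fun hd => h1 (ray_congr (by rw [hn]; exact_mod_cast hd)).symm
  have d2 : ¬ (3 : ℤ) ∣ l - j := fun hd => h2 (ray_congr (by rw [hn]; exact_mod_cast hd)).symm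
  have d3 : ¬ (3 : ℤ) ∣ l - j' := fun hd => h3 (ray_congr (by rw [hn]; exact_mod_cast hd)).symm
  have hc : ((3 : ℤ) ∣ j' - (j + 1) ∧ (3 : ℤ) ∣ l - (j + 2)) ∨
      ((3 : ℤ) ∣ j' - (j + 2) ∧ (3 : ℤ) ∣ l - (j + 1)) := by omega
  have cong : ∀ {x y : ℤ}, (3 : ℤ) ∣ y - x → G.ray y = G.ray x := fun hd =>
    ray_congr (by rw [hn]; exact_mod_cast hd)
  -- The weights are the determinants of the opposite pairs; the relation is an identity for three
  -- vectors of the plane.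
  rcases hc with ⟨c1, c2⟩ | ⟨c1, c2⟩
  · rw [cong c1, cong c2]
    exact ⟨_, _, _, e1, e2, e3, fun s => by simp only [det]; ring⟩
  · rw [cong c1, cong c2]
    exact ⟨_, _, _, e1, e3, e2, fun s => by simp only [det]; ring⟩

/-- Among four rays of `G` two coincide. -/
lemma exists_eq_of_four {i₁ i₂ i₃ i₄ : ℤ} (h1 : ∃ j, F.ray i₁ = G.ray j)
    (h2 : ∃ j, F.ray i₂ = G.ray j) (h3 : ∃ j, F.ray i₃ = G.ray j) (h4 : ∃ j, F.ray i₄ = G.ray j) :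
    (F.n : ℤ) ∣ i₂ - i₁ ∨ (F.n : ℤ) ∣ i₃ - i₁ ∨ (F.n : ℤ) ∣ i₄ - i₁ ∨ (F.n : ℤ) ∣ i₃ - i₂ ∨
      (F.n : ℤ) ∣ i₄ - i₂ ∨ (F.n : ℤ) ∣ i₄ - i₃ := by
  obtain ⟨j1, e1⟩ := h1
  obtain ⟨j2, e2⟩ := h2
  obtain ⟨j3, e3⟩ := h3
  obtain ⟨j4, e4⟩ := h4
  have cong : ∀ {x y : ℤ}, (3 : ℤ) ∣ y - x → G.ray x = G.ray y := fun hd =>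
    (ray_congr (by rw [h.three]; exact_mod_cast hd)).symm
  have hc : (3 : ℤ) ∣ j2 - j1 ∨ (3 : ℤ) ∣ j3 - j1 ∨ (3 : ℤ) ∣ j4 - j1 ∨ (3 : ℤ) ∣ j3 - j2 ∨
      (3 : ℤ) ∣ j4 - j2 ∨ (3 : ℤ) ∣ j4 - j3 := by omega
  have tr : ∀ {a b x y : ℤ}, F.ray a = G.ray x → F.ray b = G.ray y → (3 : ℤ) ∣ y - x →
      (F.n : ℤ) ∣ b - a := fun ha hb hd => dvd_of_ray_eq (by rw [ha, hb, cong hd])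
  rcases hc with hc | hc | hc | hc | hc | hc
  · exact Or.inl (tr e1 e2 hc)
  · exact Or.inr (Or.inl (tr e1 e3 hc))
  · exact Or.inr (Or.inr (Or.inl (tr e1 e4 hc)))
  · exact Or.inr (Or.inr (Or.inr (Or.inl (tr e2 e3 hc))))
  · exact Or.inr (Or.inr (Or.inr (Or.inr (Or.inl (tr e2 e4 hc)))))
  · exact Or.inr (Or.inr (Or.inr (Or.inr (Or.inr (tr e3 e4 hc)))))

/-- Walking away from a ray of coefficient `1` (in the direction `ε`) one cannot come from a ray of
`G`. -/
lemma not_special_sub {i ε : ℤ} (hε : ε = 1 ∨ ε = -1) (hi : F.coeff i = 1) :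
    ¬ ∃ j, F.ray (i - ε) = G.ray j := by
  rintro ⟨j', hj'⟩
  obtain ⟨j, hj⟩ := h.minimal i hi
  have hn := F.three_le
  -- The neighbour i - ε itself is reached again after n - 1 steps in direction ε, so a first ray of
  -- G is met at some t ≤ n - 1.
  have hsp : ∃ t : ℕ, 1 ≤ t ∧ ∃ l, F.ray (i + ε * t) = G.ray l := by
    refine ⟨F.n - 1, by omega, j', ?_⟩
    rw [← hj']
    refine ray_congr ⟨ε, ?_⟩
    push_cast [Nat.cast_sub (show 1 ≤ F.n by omega)]; ring
  obtain ⟨t, ⟨ht1, l, hl⟩, hmin', htn⟩ : ∃ t : ℕ, (1 ≤ t ∧ ∃ l, F.ray (i + ε * t) = G.ray l) ∧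
      (∀ m < t, ¬ (1 ≤ m ∧ ∃ l, F.ray (i + ε * m) = G.ray l)) ∧ t ≤ F.n - 1 := by
    classical
    refine ⟨Nat.find hsp, Nat.find_spec hsp, fun m hm => Nat.find_min hsp hm,
      Nat.find_min' hsp ⟨by omega, j', ?_⟩⟩
    rw [← hj']
    refine ray_congr ⟨ε, ?_⟩
    push_cast [Nat.cast_sub (show 1 ≤ F.n by omega)]; ring
  have hmin : ∀ m : ℕ, 1 ≤ m → m < t → ¬ ∃ l, F.ray (i + ε * m) = G.ray l := fun m hm1 hmt hm =>
    hmin' m hmt ⟨hm1, hm⟩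
  have hrec : ∀ s i, det s (F.ray (i - ε)) + det s (F.ray (i + ε)) =
      F.coeff i * det s (F.ray i) := by
    intro s i
    rcases hε with rfl | rfl
    · rw [det_rec h.unimodular]; ring
    · rw [show i - -1 = i + 1 by ring, show i + -1 = i - 1 by ring, det_rec h.unimodular]; ring
  -- The sign is chosen so that det(s, v_i) = 1 in both directions.
  set s := ε • F.ray (i - ε) with hs
  have e0 : det s (F.ray (i - ε)) = 0 := by
    rcases hε with rfl | rfl
    · rw [hs, one_smul, det_self]
    · rw [hs, neg_one_smul, det_neg_left, det_self, neg_zero]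
  have e1 : det s (F.ray i) = 1 := by
    rcases hε with rfl | rfl
    · have := h.unimodular (i - 1)
      rw [sub_add_cancel] at this
      rw [hs, one_smul, this]
    · rw [hs, neg_one_smul, det_neg_left, sub_neg_eq_add, det_swap, h.unimodular, neg_neg]
  have e2 : det s (F.ray (i + ε)) = 1 := by
    have := hrec s i
    rw [e0, e1, hi] at this; omega
  -- det(s, ·) takes the value 1 at v_i and at v_{i+ε}, and the coefficients before the next ray of
  -- G are at least 2, so it is still at least 1 at that ray.
  have hmono := le_succ_of_rec (g := fun m : ℕ => det s (F.ray (i + ε * m)))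
    (b := fun m : ℕ => F.coeff (i + ε * m)) (N := t) (by simp [e1, e2]) (by simp [e2])
    (fun m hm _ => by
      have := hrec s (i + ε * m)
      rw [← this]
      push_cast [Nat.cast_sub hm]
      rw [show i + ε * ((m : ℤ) - 1) = i + ε * m - ε by ring,
        show i + ε * ((m : ℤ) + 1) = i + ε * m + ε by ring])
    (fun m hm hmt => h.two_le_coeff (hmin m hm hmt)) (t - 1) (by omega)
  rw [Nat.sub_add_cancel ht1] at hmono
  have hge : 1 ≤ det s (F.ray (i + ε * t)) := by simpa [e2] using hmono.2
  have n1 : G.ray j ≠ G.ray j' := fun he => by rw [← hj, ← hj'] at he; rw [he, e0] at e1; omega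
  have n2 : G.ray j' ≠ G.ray l := fun he => by
    rw [← hl, ← hj'] at he; rw [← he, e0] at hge; omega
  have n3 : G.ray j ≠ G.ray l := fun he => by
    rw [← hl, ← hj] at he
    have hd := dvd_of_ray_eq he
    have hd' : (F.n : ℤ) ∣ t := by
      rcases hε with rfl | rfl
      · simpa using hd
      · simpa using hd
    have := Int.le_of_dvd (by omega) hd'
    omega
  -- The three rays of G have determinants 0, 1 and at least 1 with s, so no positive combination of
  -- them is zero.
  obtain ⟨a, b, c, ha, hb, hc, hrel⟩ := h.exists_pos_rel n1 n3 n2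
  have := hrel s
  rw [← hj, ← hj', ← hl, e0, e1] at this
  nlinarith

/-- Not being rays of G gives the lower bound 2 for the neighbours; basicness gives the upper bound.
-/
lemma coeff_neighbours {i : ℤ} (hi : F.coeff i = 1) :
    ((¬ ∃ j, F.ray (i + 1) = G.ray j) ∧ ¬ ∃ j, F.ray (i - 1) = G.ray j) ∧
      F.coeff (i + 1) = 2 ∧ F.coeff (i - 1) = 2 := by
  have h1 : ¬ ∃ j, F.ray (i - 1) = G.ray j := h.not_special_sub (Or.inl rfl) hi
  have h2 : ¬ ∃ j, F.ray (i + 1) = G.ray j := by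
    have := h.not_special_sub (ε := -1) (Or.inr rfl) hi
    rwa [sub_neg_eq_add] at this
  have h3 := h.two_le_coeff h1
  have h4 := h.two_le_coeff h2
  have h5 := h.basic i hi
  exact ⟨⟨h2, h1⟩, by omega, by omega⟩

lemma special_of_coeff_le {i : ℤ} (hi : F.coeff i ≤ 1) : ∃ j, F.ray i = G.ray j := by
  by_contra hn
  have := h.two_le_coeff hn
  omega

/-- Between two opposite rays there is a ray with coefficient at most `1`. -/
lemma exists_coeff_le_one {p : ℤ} {N : ℕ} (hN : det (F.ray p) (F.ray (p + N)) ≤ 0) (hN1 : 1 ≤ N) :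
    ∃ k : ℕ, 1 ≤ k ∧ k < N ∧ F.coeff (p + k) ≤ 1 := by
  by_contra! hc
  -- With all intermediate coefficients at least 2, det(v_p, ·) would start with 0, 1 and never fall
  -- again.
  have hmono := le_succ_of_rec (g := fun m : ℕ => det (F.ray p) (F.ray (p + m)))
    (b := fun m : ℕ => F.coeff (p + m)) (N := N) (by simp [det_self, h.unimodular])
    (by simp [h.unimodular])
    (fun m hm _ => by
      have := det_rec h.unimodular (F.ray p) (p + m)
      push_cast [Nat.cast_sub hm]
      rw [← add_assoc, this, add_sub_assoc p (m : ℤ) 1]; ring)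
    (fun m hm hmt => hc m hm hmt) (N - 1) (by omega)
  rw [Nat.sub_add_cancel hN1] at hmono
  have := hmono.2
  simp only [Nat.cast_one, h.unimodular] at this
  omega

end BasicFan

/-! ### Case distinction on coefficients zero and one -/

namespace BasicFan

open CompleteFan

variable {F G : CompleteFan} (h : BasicFan F G)
include h

/-- The neighbours of v_i are opposite. In the other half-plane there is again a coefficient at most
1, hence at most 0. Its recurrence has nonnegative terms on one side and a nonpositive one on the
other, so both neighbours of that ray lie on the boundary line and there are four rays. -/
lemma classification_of_coeff_eq_zero {i : ℤ} (hi : F.coeff i = 0)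
    (hne : ∀ i, F.coeff i ≠ 1) : ∃ n : ℤ, 2 ≤ n ∧ F.HasCycle [-n, 0, n, 0] := by
  have hn := F.three_le
  have hopp : F.ray (i + 1) = -F.ray (i - 1) := by
    rw [ray_rec h.unimodular, hi]; simp
  have hper : F.ray (i + 1 + (F.n - 2 : ℕ)) = F.ray (i - 1) :=
    ray_congr ⟨1, by push_cast [Nat.cast_sub (show 2 ≤ F.n by omega)]; ring⟩
  have h0 : det (F.ray (i + 1)) (F.ray (i + 1 + (F.n - 2 : ℕ))) = 0 := by
    rw [hper, hopp, det_neg_left, det_self, neg_zero]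
  obtain ⟨k, hk1, hk2, hk⟩ := h.exists_coeff_le_one (p := i + 1) (N := F.n - 2) h0.le (by omega)
  have hk0 : F.coeff (i + 1 + k) ≤ 0 := by
    have := hne (i + 1 + k); omega
  have hpos : ∀ j : ℤ, i + 1 < j → j < i + 1 + (F.n - 2 : ℕ) → 0 < det (F.ray (i + 1)) (F.ray j) :=
    fun j h1 h2 => det_pos_of_between h1 h2 (by omega) h0.ge
  have hnn : ∀ j : ℤ, i + 1 ≤ j → j ≤ i + 1 + (F.n - 2 : ℕ) →
      0 ≤ det (F.ray (i + 1)) (F.ray j) ∧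
        (det (F.ray (i + 1)) (F.ray j) = 0 → j = i + 1 ∨ j = i + 1 + (F.n - 2 : ℕ)) := by
    intro j h1 h2
    rcases h1.eq_or_lt with rfl | h1
    · simp [det_self]
    rcases h2.eq_or_lt with rfl | h2
    · simp [h0]
    · have := hpos j h1 h2
      exact ⟨this.le, fun h => by omega⟩
  have hr := det_rec h.unimodular (F.ray (i + 1)) (i + 1 + k)
  have e1 := hpos (i + 1 + k) (by omega) (by omega)
  have e2 := hnn (i + 1 + k + 1) (by omega) (by omega)
  have e3 := hnn (i + 1 + k - 1) (by omega) (by omega)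
  have e4 : det (F.ray (i + 1)) (F.ray (i + 1 + k + 1)) = 0 := by nlinarith [e2.1, e3.1]
  have e5 : det (F.ray (i + 1)) (F.ray (i + 1 + k - 1)) = 0 := by nlinarith [e2.1, e3.1]
  have e6 := e2.2 e4
  have e7 := e3.2 e5
  have hk1' : k = 1 := by omega
  have hn4 : F.n = 4 := by omega
  subst hk1'
  have hkz : F.coeff (i + 2) = 0 := by
    rw [e4, e5] at hr
    rw [show i + 1 + ((1 : ℕ) : ℤ) = i + 2 by push_cast; ring] at hr e1
    have : F.coeff (i + 2) * det (F.ray (i + 1)) (F.ray (i + 2)) = 0 := by linarith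
    exact (mul_eq_zero.mp this).resolve_right (by omega)
  -- The cycle closes after four steps; this is the recurrence at i + 3 paired with v_i.
  have hsum : F.coeff (i + 1) + F.coeff (i + 3) = 0 := by
    have a1 := ray_rec h.unimodular (i + 1)
    have a2 := ray_rec h.unimodular (i + 3)
    rw [show F.ray (i + 3 + 1) = F.ray i from ray_congr ⟨1, by rw [hn4]; ring⟩,
      show F.ray (i + 3) = F.ray (i - 1) from ray_congr ⟨1, by rw [hn4]; ring⟩,
      show i + 3 - 1 = i + 1 + 1 by ring, a1, add_sub_cancel_right, hopp] at a2
    have a3 := h.unimodular (i - 1)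
    rw [sub_add_cancel, det_swap] at a3
    have a4 := congrArg (det (F.ray i)) a2
    simp only [det_sub_right, det_smul_right, det_neg_right, det_self] at a4
    have a5 : det (F.ray i) (F.ray (i - 1)) = -1 := by omega
    rw [a5] at a4
    linarith
  -- Otherwise all four coefficients are at most 1 and all four rays belong to G. Whichever of the
  -- two opposite coefficients is at least 2 serves as n.
  have hns : 2 ≤ F.coeff (i + 1) ∨ 2 ≤ F.coeff (i + 3) := by
    by_contra! hc
    have := h.exists_eq_of_four (h.special_of_coeff_le (i := i) (by omega))
      (h.special_of_coeff_le (i := i + 1) (by omega))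
      (h.special_of_coeff_le (i := i + 2) (by omega))
      (h.special_of_coeff_le (i := i + 3) (by omega))
    rw [hn4] at this
    omega
  have c1 : F.coeff (i + 4) = 0 := by
    rw [← hi]; exact coeff_congr ⟨1, by rw [hn4]; ring⟩
  have c2 : F.coeff (i + 5) = F.coeff (i + 1) := coeff_congr ⟨1, by rw [hn4]; ring⟩
  have c3 : F.coeff (i + 6) = 0 := by
    rw [← hkz]; exact coeff_congr ⟨1, by rw [hn4]; ring⟩
  rcases hns with h2 | h2
  · refine ⟨F.coeff (i + 1), h2, by simp [hn4], i + 1, 1, Or.inl rfl, fun j hj => ?_⟩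
    simp only [List.length_cons, List.length_nil] at hj
    interval_cases j <;> simp [add_assoc] <;> omega
  · refine ⟨F.coeff (i + 3), h2, by simp [hn4], i + 3, 1, Or.inl rfl, fun j hj => ?_⟩
    simp only [List.length_cons, List.length_nil] at hj
    interval_cases j <;> simp [add_assoc] <;> omega

/-- After a full turn the determinant with v_0 is zero again, so some coefficient is at most 1. -/
lemma exists_coeff_nonpos (hne : ∀ i, F.coeff i ≠ 1) : ∃ i, F.coeff i ≤ 0 := by
  have hn := F.three_le
  obtain ⟨k, _, _, hk⟩ := h.exists_coeff_le_one (p := 0) (N := F.n) (by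
    rw [ray_congr (i := 0) (j := 0 + F.n) (by simp), det_self]) (by omega)
  have := hne (0 + k)
  exact ⟨0 + k, by omega⟩

/-- Without rays of coefficient `1` and `0` there are only three rays. -/
lemma n_eq_three (hne : ∀ i, F.coeff i ≠ 1) (hne0 : ∀ i, F.coeff i ≠ 0) : F.n = 3 := by
  by_contra hn3
  have hn := F.three_le
  obtain ⟨i, hi⟩ := h.exists_coeff_nonpos hne
  have hi' : F.coeff i < 0 := lt_of_le_of_ne hi (hne0 i)
  have hper : F.ray (i + 1 + (F.n - 2 : ℕ)) = F.ray (i - 1) :=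
    ray_congr ⟨1, by push_cast [Nat.cast_sub (show 2 ≤ F.n by omega)]; ring⟩
  have hprev := h.unimodular (i - 1)
  rw [sub_add_cancel] at hprev
  -- A negative coefficient at i puts v_{i-1} strictly to the left of v_{i+1}, and with it all rays
  -- in between.
  have hpos : ∀ j : ℤ, i + 1 < j → j ≤ i + 1 + (F.n - 2 : ℕ) →
      0 < det (F.ray (i + 1)) (F.ray j) := by
    have h0 : 0 < det (F.ray (i + 1)) (F.ray (i + 1 + (F.n - 2 : ℕ))) := by
      rw [hper, det_swap]
      simp only [CompleteFan.coeff] at hi'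
      omega
    intro j h1 h2
    rcases h2.eq_or_lt with rfl | h2
    · exact h0
    · exact det_pos_of_between h1 h2 (by omega) h0.le
  have hb : ∀ m : ℕ, 1 ≤ m → m < F.n - 2 → 2 ≤ F.coeff (i + 1 + m) := by
    intro m hm1 hm2
    have hr := det_rec h.unimodular (F.ray (i + 1)) (i + 1 + m)
    have e1 := hpos (i + 1 + m) (by omega) (by omega)
    have e2 := hpos (i + 1 + m + 1) (by omega) (by omega)
    have e3 : 0 ≤ det (F.ray (i + 1)) (F.ray (i + 1 + m - 1)) := by
      rcases hm1.eq_or_lt with rfl | h1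
      · simp [det_self]
      · exact (hpos _ (by omega) (by omega)).le
    have e4 := hne (i + 1 + m)
    have : 0 < F.coeff (i + 1 + m) := by
      by_contra! hle
      nlinarith
    omega
  -- This sequence runs from 1 to -1 along coefficients that are at least 2. Its second term x 1 is
  -- the coefficient at i + 1; each of the three possible signs of x 1 leads to a contradiction.
  set x : ℕ → ℤ := fun m => det (F.ray i) (F.ray (i + 1 + m)) with hx
  have x0 : x 0 = 1 := by simp [hx, h.unimodular]
  have xN : x (F.n - 2) = -1 := by
    simp only [hx]; rw [hper, det_swap, hprev]
  have hrec : ∀ m : ℕ, 1 ≤ m → m < F.n - 2 → x (m - 1) + x (m + 1) = F.coeff (i + 1 + m) * x m := by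
    intro m hm _
    have := det_rec h.unimodular (F.ray i) (i + 1 + m)
    simp only [hx]
    push_cast [Nat.cast_sub hm]
    rw [← add_assoc, this, add_sub_assoc (i + 1) (m : ℤ) 1]; ring
  have hN : F.n - 2 - 1 + 1 = F.n - 2 := by omega
  rcases lt_trichotomy (x 1) 0 with h1 | h1 | h1
  · have := (le_succ_of_rec (g := fun m => -x m) (b := fun m => F.coeff (i + 1 + m)) (N := F.n - 2)
      (by simp only [x0]; omega) (by omega)
      (fun m hm hm2 => by linarith [hrec m hm hm2]) hb 1 (by omega))
    have h2 := hrec 1 le_rfl (by omega)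
    rw [Nat.sub_self, x0] at h2
    have h3 := hb 1 le_rfl (by omega)
    -- x 2 is b times x 1 minus 1, with b at least 2 and x 1 at most -1. By convexity of -x the
    -- final value cannot be -1.
    have h4 : x 2 ≤ -3 := by simp only [Nat.reduceAdd] at h2; nlinarith
    have h4' : x 2 ≤ x 1 := by simp only [Nat.reduceAdd] at h2; nlinarith
    have h5 := (le_succ_of_rec (g := fun m => -x (m + 1)) (b := fun m => F.coeff (i + 1 + (m + 1 : ℕ)))
      (N := F.n - 3) (by simp only [zero_add, Nat.reduceAdd]; omega)
      (by simp only [Nat.reduceAdd]; omega)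
      (fun m hm hm2 => by
        have := hrec (m + 1) (by omega) (by omega)
        rw [Nat.add_sub_cancel] at this
        rw [Nat.sub_add_cancel hm]; linarith)
      (fun m hm hm2 => hb (m + 1) (by omega) (by omega)) (F.n - 4) (by omega)).2
    rw [show F.n - 4 + 1 + 1 = F.n - 2 by omega, xN] at h5
    simp only [Nat.reduceAdd] at h5
    omega
  · have h3 : F.ray (i + 2) = -F.ray i := by
      refine ray_eq_neg_of_det ?_ (not_dvd_of_lt (by omega) (by omega))
      simpa [hx, add_assoc] using h1
    refine hne0 (i + 1) ?_
    rw [CompleteFan.coeff, add_sub_cancel_right, add_assoc, show (1 : ℤ) + 1 = 2 by norm_num, h3,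
      det_neg_right, det_self, neg_zero]
  · have := (le_succ_of_rec (g := x) (b := fun m => F.coeff (i + 1 + m)) (N := F.n - 2)
      (by omega) (by omega) hrec hb (F.n - 2 - 1) (by omega)).2
    rw [hN, xN] at this
    omega

/-- The curve of v_i and its neighbours form one fibre (-2, -1, -2). The rest of the proof
determines the second fibre from its multiplicities and then the self-intersections of the two
sections. -/
lemma classification_of_coeff_eq_one {i : ℤ} (hi : F.coeff i = 1) :
    (∃ n : ℤ, 2 ≤ n ∧ F.HasCycle [-n, 0, n - 1, -2, -1, -2]) ∨
    (∃ n : ℤ, 2 ≤ n ∧ F.HasCycle [-n, -2, -1, -2, n - 2, -2, -1, -2]) ∨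
    F.HasCycle [-2, -2, -1, -2, -2, -1, -2, -2, -1] := by
  have hn := F.three_le
  have hrr := ray_rec h.unimodular
  obtain ⟨⟨hs1, hs2⟩, hc1, hc2⟩ := h.coeff_neighbours hi
  have cc := fun k : ℤ => coeff_congr (F := F) (i := i + k) (j := i + k + F.n) (by simp)
  have rc := fun k : ℤ => ray_congr (F := F) (i := i + k) (j := i + k + F.n) (by simp)
  -- coordinates with respect to the rays `x = v_{i+1}` and `s = v_{i+2}`
  set x := F.ray (i + 1) with hx
  set s := F.ray (i + 2) with hs
  have hxs : det x s = 1 := by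
    have := h.unimodular (i + 1); rwa [add_assoc] at this
  have r0 : F.ray i = 2 • x - s := by
    have := hrr (i + 1)
    rw [hc1, add_sub_cancel_right, add_assoc, show (1 : ℤ) + 1 = 2 by norm_num, ← hs, ← hx] at this
    rw [this]; module
  have r1 : F.ray (i - 1) = x - s := by
    have := hrr i
    rw [hi, one_smul, ← hx] at this
    rw [show F.ray (i - 1) = F.ray i - x by rw [this]; module, r0]; module
  -- The coefficients 2, 1, 2 make the rays at i - 2 and i + 2 opposite: these are the sections.
  have r2 : F.ray (i - 2) = -s := by
    have := hrr (i - 1)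
    rw [sub_add_cancel, hc2, show i - 1 - 1 = i - 2 by ring, r0, r1] at this
    rw [show F.ray (i - 2) = (2 : ℤ) • (x - s) - (2 • x - s) by rw [this]; module]; module
  have r3 : F.ray (i - 3) = -(F.coeff (i - 2)) • s - x + s := by
    have := hrr (i - 2)
    rw [show i - 2 + 1 = i - 1 by ring, show i - 2 - 1 = i - 3 by ring, r1, r2] at this
    rw [show F.ray (i - 3) = F.coeff (i - 2) • (-s) - (x - s) by rw [this]; module]; module
  have r4 : F.ray (i + 3) = F.coeff (i + 2) • s - x := by
    have := hrr (i + 2)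
    rwa [show i + 2 + 1 = i + 3 by ring, show i + 2 - 1 = i + 1 by ring] at this
  have coords : ∀ a b c d : ℤ, a • x + b • s = c • x + d • s → a = c ∧ b = d := by
    intro a b c d he
    have e1 := congrArg (det x) he
    have e2 := congrArg (det s) he
    simp only [det_add_right, det_smul_right, det_self, hxs, det_swap s x] at e1 e2
    constructor <;> linarith
  have hn5 : 5 ≤ F.n := by
    by_contra hlt
    have h34 : F.n = 3 ∨ F.n = 4 := by omega
    rcases h34 with h3 | h4
    · have := rc (-1)
      rw [h3, show i + -1 + ((3 : ℕ) : ℤ) = i + 2 by push_cast; ring, ← hs, ← sub_eq_add_neg, r1]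
        at this
      have := coords 0 1 1 (-1) (by
        rw [zero_smul, zero_add, one_smul]; exact this.trans (by module))
      omega
    · have := rc (-2)
      rw [h4, show i + -2 + ((4 : ℕ) : ℤ) = i + 2 by push_cast; ring, ← hs, ← sub_eq_add_neg, r2]
        at this
      have := coords 0 1 0 (-1) (by
        rw [zero_smul, zero_add, one_smul]; exact this.trans (by module))
      omega
  have hn5' : F.n ≠ 5 := by
    intro h5
    have := rc (-2)
    rw [h5, show i + -2 + ((5 : ℕ) : ℤ) = i + 3 by push_cast; ring, r4, ← sub_eq_add_neg, r2]
      at this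
    have := coords (-1) (F.coeff (i + 2)) 0 (-1) (by
      rw [show (-1 : ℤ) • x + F.coeff (i + 2) • s = F.coeff (i + 2) • s - x by module, this]; module)
    omega
  -- N steps lead from v_{i+2} through the second fibre to the opposite ray, since i + 2 + N is
  -- congruent to i - 2.
  obtain ⟨N, hN⟩ : ∃ N, F.n = N + 4 := ⟨F.n - 4, by omega⟩
  have hNc : (F.n : ℤ) = N + 4 := by exact_mod_cast hN
  have per : ∀ k : ℤ, F.ray (i + 2 + N + k) = F.ray (i - 2 + k) := fun k =>
    ray_congr ⟨1, by rw [hNc]; ring⟩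
  have cper : ∀ k : ℤ, F.coeff (i + 2 + N + k) = F.coeff (i - 2 + k) := fun k =>
    coeff_congr ⟨1, by rw [hNc]; ring⟩
  -- For 0 < j < N these are the multiplicities of the curves in the second fibre.
  set m : ℤ → ℤ := fun j => det s (F.ray (i + 2 + j)) with hm
  have mrec : ∀ j, m (j - 1) + m (j + 1) = F.coeff (i + 2 + j) * m j := by
    intro j
    simp only [hm]
    rw [← add_assoc, det_rec h.unimodular, add_sub_assoc]; ring
  have m0 : m 0 = 0 := by simp only [hm, add_zero, ← hs, det_self]
  have mN : m N = 0 := by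
    have := per 0
    rw [add_zero, add_zero] at this
    simp only [hm]; rw [this, r2, det_neg_right, det_self, neg_zero]
  have m1 : m 1 = 1 := by simp only [hm, hs, h.unimodular]
  have mN1 : m (N - 1) = 1 := by
    have := per (-1)
    rw [add_assoc] at this
    simp only [hm, ← sub_eq_add_neg] at this ⊢
    rw [this, show i - 2 - 1 = i - 3 by ring, r3, det_add_right, det_sub_right, det_smul_right,
      det_self, det_swap, hxs]; ring
  have mpos : ∀ j : ℤ, 0 < j → j < N → 0 < m j := fun j h1 h2 =>
    det_pos_of_between (p := i + 2) (q := i + 2 + N) (by omega) (by omega) (by omega) mN.ge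
  have mnn : ∀ j : ℤ, 0 ≤ j → j ≤ N → 0 ≤ m j ∧ (m j = 0 → j = 0 ∨ j = N) := by
    intro j h1 h2
    rcases h1.eq_or_lt with rfl | h1
    · simp [m0]
    rcases h2.eq_or_lt with rfl | h2
    · simp [mN]
    · have := mpos j h1 h2
      exact ⟨this.le, fun h => by omega⟩
  have hN2 : 2 ≤ N := by omega
  obtain ⟨k, hk1, hk2, hk⟩ := h.exists_coeff_le_one (p := i + 2) (N := N) mN.le (by omega)
  -- which indices can carry a coefficient at most one
  have dich : ∀ k : ℤ, 1 ≤ k → k < N → F.coeff (i + 2 + k) ≤ 1 →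
      (N = 2 ∧ F.coeff (i + 2 + k) = 0) ∨ (F.coeff (i + 2 + k) = 1 ∧
        ((k = 2 ∧ N = 4) ∨ (k = 1 ∧ 3 ≤ N) ∨ (k = N - 1 ∧ 3 ≤ N))) := by
    intro k hk1 hk2 hk
    have e1 := mpos k (by omega) hk2
    have e2 := mnn (k - 1) (by omega) (by omega)
    have e3 := mnn (k + 1) (by omega) (by omega)
    have e4 := mrec k
    rcases (show F.coeff (i + 2 + k) ≤ 0 ∨ F.coeff (i + 2 + k) = 1 by omega) with h0 | h1
    · left
      have e5 : m (k - 1) = 0 := by nlinarith [e2.1, e3.1]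
      have e6 : m (k + 1) = 0 := by nlinarith [e2.1, e3.1]
      have e7 := e2.2 e5
      have e8 := e3.2 e6
      rw [e5, e6] at e4
      refine ⟨by omega, (mul_eq_zero.mp e4.symm).resolve_right (by omega)⟩
    · right
      refine ⟨h1, ?_⟩
      obtain ⟨_, d1, d2⟩ := h.coeff_neighbours h1
      have e5 := mrec (k - 1)
      have e6 := mrec (k + 1)
      rw [sub_add_cancel, ← add_sub_assoc, d2] at e5
      rw [add_sub_cancel_right, ← add_assoc (i + 2), d1] at e6
      rw [h1] at e4
      -- If both neighbours are strictly inside, the recurrences at k - 1, k and k + 1 add up to m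
      -- (k - 2) + m (k + 2) = 0.
      by_cases hb : 2 ≤ k ∧ k ≤ N - 2
      · left
        have e7 := mnn (k - 1 - 1) (by omega) (by omega)
        have e8 := mnn (k + 1 + 1) (by omega) (by omega)
        have e9 := e7.2 (by linarith [e7.1, e8.1])
        have e10 := e8.2 (by linarith [e7.1, e8.1])
        omega
      · right
        have : 3 ≤ N := by
          by_contra hlt
          have h2 : N = 2 := by omega
          have h3 : k = 1 := by omega
          subst h3
          rw [h2] at mN
          norm_num at e4 mN
          rw [m0, mN, m1] at e4
          omega
        omega
  have hspk : ∀ k : ℤ, F.coeff (i + 2 + k) ≤ 1 → ∃ j, F.ray (i + 2 + k) = G.ray j := fun k hk =>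
    h.special_of_coeff_le hk
  -- both sections cannot be rays of `G`
  have hsec : 2 ≤ F.coeff (i + 2) ∨ 2 ≤ F.coeff (i - 2) := by
    by_contra! hc
    have := h.exists_eq_of_four (h.special_of_coeff_le (i := i) (by omega))
      (h.special_of_coeff_le (i := i + 2) (by omega))
      (h.special_of_coeff_le (i := i + 2 + k) hk)
      (h.special_of_coeff_le (i := i + 2 + N) (by
        have := cper 0; rw [add_zero, add_zero] at this; omega))
    have nd : ∀ a b : ℤ, a < b → b < a + F.n → ¬ (F.n : ℤ) ∣ b - a := fun a b h1 h2 =>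
      not_dvd_of_lt h1 h2
    rcases this with h' | h' | h' | h' | h' | h'
    all_goals exact nd _ _ (by omega) (by omega) h'
  -- The second fibre is a single curve.
  by_cases hN2' : N = 2
  · left
    subst hN2'
    have hk0 : F.coeff (i + 3) = 0 := by
      rcases dich k (by omega) (by omega) hk with h1 | h1
      · rw [show (k : ℤ) = 1 by omega, add_assoc] at h1
        exact h1.2
      · omega
    have hsum : F.coeff (i + 2) + F.coeff (i - 2) = 1 := by
      have e1 := per (-1)
      rw [show i + 2 + ((2 : ℕ) : ℤ) + -1 = i + 3 by push_cast; ring,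
        show i - 2 + -1 = i - 3 by ring, r3, r4] at e1
      have := coords (-1) (F.coeff (i + 2)) (-1) (-F.coeff (i - 2) + 1) (by
        rw [show (-1 : ℤ) • x + F.coeff (i + 2) • s = F.coeff (i + 2) • s - x by module, e1]; module)
      omega
    have hn6 : F.n = 6 := hN
    rcases hsec with h2 | h2
    · refine ⟨F.coeff (i + 2), h2, by simp [hn6], i + 2, 1, Or.inl rfl, fun j hj => ?_⟩
      simp only [List.length_cons, List.length_nil] at hj
      have c2 := cc (-2)
      have c1 := cc (-1)
      have c0 := cc 0
      have c3 := cc 1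
      rw [hn6] at c0 c1 c2 c3
      rw [← sub_eq_add_neg] at c1 c2
      norm_num [add_assoc, sub_eq_add_neg] at c0 c1 c2 c3 hc1 hc2 hk0 hsum hi
      interval_cases j <;> norm_num [add_assoc, sub_eq_add_neg] <;> omega
    -- The large coefficient is at i - 2, congruent to i + 4; reading the cycle backwards puts the
    -- irreducible fibre right after it.
    · refine ⟨F.coeff (i - 2), h2, by simp [hn6], i + 4, -1, Or.inr rfl, fun j hj => ?_⟩
      simp only [List.length_cons, List.length_nil] at hj
      have c2 := cc (-2)
      have c1 := cc (-1)
      rw [hn6] at c1 c2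
      rw [← sub_eq_add_neg] at c1 c2
      norm_num [add_assoc, sub_eq_add_neg] at c1 c2 hc1 hc2 hk0 hsum hi
      interval_cases j <;> norm_num [add_assoc, sub_eq_add_neg] <;> omega
  right
  -- Both fibres are of type (-2, -1, -2).
  by_cases hN4 : N = 4 ∧ F.coeff (i + 4) = 1
  · left
    obtain ⟨rfl, hk4⟩ := hN4
    have hk4' := h.coeff_neighbours hk4
    obtain ⟨_, k5, k3⟩ := hk4'
    rw [show i + 4 - 1 = i + 3 by ring] at k3
    rw [show i + 4 + 1 = i + 5 by ring] at k5
    have hsum : F.coeff (i + 2) + F.coeff (i - 2) = 2 := by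
      have e1 := hrr (i + 3)
      have e2 := hrr (i - 3)
      have e3 := per (-2)
      have e4 := cper (-1)
      rw [show i + 2 + ((4 : ℕ) : ℤ) + -1 = i + 5 by push_cast; ring,
        show i - 2 + -1 = i - 3 by ring, k5] at e4
      rw [show i + 3 + 1 = i + 4 by ring, show i + 3 - 1 = i + 2 by ring, k3, r4, ← hs] at e1
      rw [show i - 3 + 1 = i - 2 by ring, show i - 3 - 1 = i - 4 by ring, ← e4, r3, r2] at e2
      rw [show i + 2 + ((4 : ℕ) : ℤ) + -2 = i + 4 by push_cast; ring,
        show i - 2 + -2 = i - 4 by ring, e1] at e3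
      rw [← e3] at e2
      have := coords 0 (-1) 0 (-2 * F.coeff (i - 2) + 3 - 2 * F.coeff (i + 2)) (by
        rw [show (0 : ℤ) • x + (-1 : ℤ) • s = -s by module, e2]; module)
      omega
    have hn8 : F.n = 8 := hN
    rcases hsec with h2 | h2
    · refine ⟨F.coeff (i + 2), h2, by simp [hn8], i + 2, 1, Or.inl rfl, fun j hj => ?_⟩
      simp only [List.length_cons, List.length_nil] at hj
      have c2 := cc (-2)
      have c1 := cc (-1)
      have c0 := cc 0
      have c3 := cc 1
      rw [hn8] at c0 c1 c2 c3
      rw [← sub_eq_add_neg] at c1 c2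
      norm_num [add_assoc, sub_eq_add_neg] at c0 c1 c2 c3 hc1 hc2 k3 k5 hk4 hsum hi
      interval_cases j <;> norm_num [add_assoc, sub_eq_add_neg] <;> omega
    · refine ⟨F.coeff (i - 2), h2, by simp [hn8], i - 2, 1, Or.inl rfl, fun j hj => ?_⟩
      simp only [List.length_cons, List.length_nil] at hj
      norm_num [add_assoc, sub_eq_add_neg] at hc1 hc2 k3 k5 hk4 hsum hi
      interval_cases j <;> norm_num [add_assoc, sub_eq_add_neg] <;> omega
  right
  have hN3 : 3 ≤ N := by omega
  -- What remains of `dich` are the two end curves of the second fibre.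
  have ends : ∀ k : ℤ, 1 ≤ k → k < N → F.coeff (i + 2 + k) ≤ 1 →
      F.coeff (i + 2 + k) = 1 ∧ (k = 1 ∨ k = N - 1) := by
    intro k h1 h2 h3
    rcases dich k h1 h2 h3 with h4 | ⟨h4, h5 | h5 | h5⟩
    · omega
    · refine absurd ⟨h5.2, ?_⟩ hN4
      rw [h5.1, add_assoc] at h4; exact h4
    · exact ⟨h4, by omega⟩
    · exact ⟨h4, by omega⟩
  -- the sequence `m` is nondecreasing where the coefficients are at least two
  have mono : ∀ M : ℕ, 2 ≤ M → M ≤ N → m 1 ≤ m 2 →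
      (∀ j : ℤ, 2 ≤ j → j < M → 2 ≤ F.coeff (i + 2 + j)) →
      ∀ j : ℕ, j < M - 1 → m (j + 1) ≤ m (j + 2) ∧ m 2 ≤ m (j + 2) := by
    intro M hM2 hMN h12 hb j hj
    have := le_succ_of_rec (g := fun j : ℕ => m (j + 1)) (b := fun j : ℕ => F.coeff (i + 2 + (j + 1)))
      (N := M - 1) (by simpa [m1] using h12)
      (by
        have := m1
        simp only [Nat.cast_one]; norm_num; omega)
      (fun j hj1 _ => by
        have := mrec (j + 1)
        rw [← this]
        push_cast [Nat.cast_sub hj1]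
        rw [add_sub_cancel_right, sub_add_cancel])
      (fun j hj1 hj2 => hb (j + 1) (by omega) (by omega)) j hj
    simp only [Nat.cast_add, Nat.cast_one, add_assoc] at this
    norm_num at this
    exact this
  -- Otherwise m 2 ≥ 2, and convexity contradicts m (N - 1) = 1.
  have first : F.coeff (i + 3) = 1 := by
    by_contra hne
    have hb1 : 2 ≤ F.coeff (i + 2 + 1) := by
      by_contra! hlt
      have := (ends 1 le_rfl (by omega) (by omega)).1
      rw [add_assoc] at this; exact hne this
    have h2 : 2 ≤ m 2 := by
      have := mrec 1
      norm_num at this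
      rw [m0, m1] at this
      omega
    have := (mono (N - 1) (by omega) (by omega) (by omega) (fun j hj1 hj2 => by
      by_contra! hlt
      have := (ends j (by omega) (by omega) (by omega)).2
      omega) (N - 3) (by omega)).2
    rw [show ((N - 3 : ℕ) : ℤ) + 2 = N - 1 by push_cast [Nat.cast_sub hN3]; ring, mN1] at this
    omega
  have m2 : m 2 = 1 := by
    have := mrec 1
    norm_num [add_assoc] at this
    rw [m0, m1, first] at this
    omega
  have hge : ∀ j : ℤ, 2 ≤ j → j < N - 1 → 2 ≤ F.coeff (i + 2 + j) := fun j hj1 hj2 => by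
    by_contra! hlt
    have := (ends j (by omega) (by omega) (by omega)).2
    omega
  -- Otherwise m does not fall on its way to index N, where it is zero. The index i - 3 is congruent
  -- to i + 2 + (N - 1).
  have last : F.coeff (i - 3) = 1 := by
    have hcp := cper (-1)
    rw [show i - 2 + -1 = i - 3 by ring, add_assoc (i + 2), ← sub_eq_add_neg] at hcp
    by_contra hne
    have := (mono N (by omega) le_rfl (by omega) (fun j hj1 hj2 => by
      by_contra! hlt
      have h1 := ends j (by omega) (by omega) (by omega)
      have h2 : j = N - 1 := by omega
      rw [h2, hcp] at h1
      exact hne h1.1) (N - 2) (by omega)).2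
    rw [show ((N - 2 : ℕ) : ℤ) + 2 = N by push_cast [Nat.cast_sub hN2]; ring, mN] at this
    omega
  -- m grows weakly from 1 to 1, so it is constant; its recurrence then makes the coefficients away
  -- from the ends equal to 2.
  have mone : ∀ j : ℤ, 1 ≤ j → j ≤ N - 1 → m j = 1 := by
    intro j hj1 hj2
    have hm := mono (N - 1) (by omega) (by omega) (by omega) (fun j hj1 hj2 => hge j hj1 (by omega))
    have up : ∀ t : ℕ, t ≤ N - 2 → m (N - 1 - t) ≤ 1 := by
      intro t
      induction t with
      | zero => intro _; simp [mN1]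
      | succ t ih =>
        intro ht
        have h1 := (hm (N - 2 - (t + 1)) (by omega)).1
        rw [show ((N - 2 - (t + 1) : ℕ) : ℤ) + 1 = N - 1 - (t + 1 : ℕ) by
            push_cast [Nat.cast_sub ht, Nat.cast_sub hN2]; ring,
          show ((N - 2 - (t + 1) : ℕ) : ℤ) + 2 = N - 1 - t by
            push_cast [Nat.cast_sub ht, Nat.cast_sub hN2]; ring] at h1
        exact h1.trans (ih (by omega))
    have h1 := up (N - 1 - j).toNat (by omega)
    rw [Int.toNat_of_nonneg (by omega), show (N : ℤ) - 1 - (N - 1 - j) = j by ring] at h1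
    have := mpos j (by omega) (by omega)
    omega
  have btwo : ∀ j : ℤ, 2 ≤ j → j ≤ N - 2 → F.coeff (i + 2 + j) = 2 := by
    intro j hj1 hj2
    have := mrec j
    rw [mone j (by omega) (by omega), mone (j - 1) (by omega) (by omega),
      mone (j + 1) (by omega) (by omega)] at this
    omega
  -- Each section is next to a ray of coefficient 1, so both sections have coefficient 2.
  obtain ⟨⟨ns3, ns2⟩, f4, f2⟩ := h.coeff_neighbours first
  obtain ⟨_, l2, _⟩ := h.coeff_neighbours last
  rw [show i + 3 - 1 = i + 2 by ring] at f2
  rw [show i - 3 + 1 = i - 2 by ring] at l2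
  have walk : ∀ t : ℕ, t ≤ N - 2 → F.ray (i + 3 + t) = F.ray (i + 3) - (t : ℤ) • s := by
    intro t
    induction t using Nat.strong_induction_on with
    | _ t ih =>
      intro ht
      match t with
      | 0 => simp
      | 1 =>
        have := hrr (i + 3)
        rw [first, one_smul, show i + 3 - 1 = i + 2 by ring, ← hs] at this
        simpa using this
      | t + 2 =>
        have h1 := ih (t + 1) (by omega) (by omega)
        have h0 := ih t (by omega) (by omega)
        have := hrr (i + 3 + (t + 1 : ℕ))
        rw [h1, show i + 3 + ((t + 1 : ℕ) : ℤ) - 1 = i + 3 + t by push_cast; ring, h0,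
          show i + 3 + ((t + 1 : ℕ) : ℤ) = i + 2 + (t + 2) by push_cast; ring,
          btwo (t + 2) (by omega) (by omega)] at this
        rw [show i + 3 + ((t + 2 : ℕ) : ℤ) = i + 2 + (t + 2) + 1 by push_cast; ring, this]
        push_cast; module
  -- The walk starts at v_{i+3} = 2s - x, subtracts s in each of N - 2 steps and must end at v_{i-3}
  -- = -s - x.
  have hN5 : N = 5 := by
    have e1 := walk (N - 2) le_rfl
    have e2 := per (-1)
    rw [show i + 3 + ((N - 2 : ℕ) : ℤ) = i + 2 + N + -1 by
      push_cast [Nat.cast_sub hN2]; ring, e2, show i - 2 + -1 = i - 3 by ring, r3, r4, f2, l2] at e1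
    have := coords (-1) (-1) (-1) (2 - (N - 2 : ℕ)) (by
      rw [show (-1 : ℤ) • x + (-1 : ℤ) • s = -(2 : ℤ) • s - x + s by module, e1]; module)
    omega
  subst hN5
  have hn9 : F.n = 9 := hN
  have b4 := btwo 2 (by omega) (by omega)
  have b5 := btwo 3 (by omega) (by omega)
  have c6 := cper (-1)
  norm_num [add_assoc, sub_eq_add_neg] at b4 b5 c6 first last hc1 hc2 f2 l2
  refine ⟨by simp [hn9], i - 2, 1, Or.inl rfl, fun j hj => ?_⟩
  simp only [List.length_cons, List.length_nil] at hj
  interval_cases j <;> norm_num [add_assoc, sub_eq_add_neg] <;> omega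

theorem classification :
    F.n = 3 ∨ (∃ n : ℤ, 2 ≤ n ∧ F.HasCycle [-n, 0, n, 0]) ∨
    (∃ n : ℤ, 2 ≤ n ∧ F.HasCycle [-n, 0, n - 1, -2, -1, -2]) ∨
    (∃ n : ℤ, 2 ≤ n ∧ F.HasCycle [-n, -2, -1, -2, n - 2, -2, -1, -2]) ∨
    F.HasCycle [-2, -2, -1, -2, -2, -1, -2, -2, -1] := by
  by_cases h1 : ∃ i, F.coeff i = 1
  · obtain ⟨i, hi⟩ := h1
    exact Or.inr (Or.inr (h.classification_of_coeff_eq_one hi))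
  · push Not at h1
    by_cases h0 : ∃ i, F.coeff i = 0
    · obtain ⟨i, hi⟩ := h0
      exact Or.inr (Or.inl (h.classification_of_coeff_eq_zero hi h1))
    · push Not at h0
      exact Or.inl (h.n_eq_three h1 h0)

end BasicFan

/-! ### Affine charts of schemes -/

/-- The point of the spectrum of `A` given by a prime ideal. -/
def specPoint {A : Type u} [CommRing A] (I : Ideal A) [hI : I.IsPrime] :
    Spec (CommRingCat.of A) := (⟨I, hI⟩ : PrimeSpectrum A)

/-- The prime ideal of a point of the spectrum of `A`. -/
def pointIdeal {A : Type u} [CommRing A] (P : Spec (CommRingCat.of A)) : Ideal A :=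
  PrimeSpectrum.asIdeal (R := A) P

instance {A : Type u} [CommRing A] (P : Spec (CommRingCat.of A)) : (pointIdeal P).IsPrime :=
  PrimeSpectrum.isPrime (R := A) P

@[simp] lemma pointIdeal_specPoint {A : Type u} [CommRing A] (I : Ideal A) [hI : I.IsPrime] :
    pointIdeal (specPoint I) = I := rfl

lemma pointIdeal_injective {A : Type u} [CommRing A] :
    Function.Injective (pointIdeal (A := A)) :=
  fun _ _ h => PrimeSpectrum.ext h

lemma specializes_iff_pointIdeal_le {A : Type u} [CommRing A] (P Q : Spec (CommRingCat.of A)) :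
    P ⤳ Q ↔ pointIdeal P ≤ pointIdeal Q :=
  (PrimeSpectrum.le_iff_specializes (R := A) P Q).symm

section Chart

variable {X : Scheme.{u}} {A B : Type u} [CommRing A] [CommRing B]
  (ι : Spec (CommRingCat.of A) ⟶ X) [IsOpenImmersion ι]

lemma mem_image_top {x : X} (hx : x ∈ Set.range ι) : x ∈ ι ''ᵁ ⊤ := by
  obtain ⟨P, rfl⟩ := hx
  exact ⟨P, trivial, rfl⟩

/-- The germ at `x` of a function on the affine chart `ι`. -/
noncomputable def chartGerm (x : X) (hx : x ∈ Set.range ι) : A →+* X.presheaf.stalk x :=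
  (X.presheaf.germ (ι ''ᵁ ⊤) x (mem_image_top ι hx)).hom.comp
    ((ι.appIso ⊤).inv.hom.comp (Scheme.ΓSpecIso (CommRingCat.of A)).inv.hom)

/-- The stalk map of an open immersion is an isomorphism, so this identity moves questions about
germs on X into the structure sheaf of Spec A. -/
lemma stalkMap_chartGerm (P : Spec (CommRingCat.of A)) (a : A) :
    (ι.stalkMap P).hom (chartGerm ι (ι P) (Set.mem_range_self P) a) =
      (StructureSheaf.toStalk A P).hom a := by
  have h : (Scheme.ΓSpecIso (CommRingCat.of A)).inv ≫ (ι.appIso ⊤).inv ≫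
      X.presheaf.germ (ι ''ᵁ ⊤) (ι P) (mem_image_top ι (Set.mem_range_self P)) ≫ ι.stalkMap P =
      StructureSheaf.toStalk A P := by
    rw [Scheme.Hom.germ_stalkMap, Scheme.Hom.appIso_inv_app_assoc]
    exact congrArg ((Scheme.ΓSpecIso (CommRingCat.of A)).inv ≫ ·)
      (TopCat.Presheaf.germ_res (Spec (CommRingCat.of A)).presheaf
        (eqToHom (ι.preimage_image_eq ⊤)) P (mem_image_top ι (Set.mem_range_self P)))
  exact ConcreteCategory.congr_hom h a

lemma stalkSpecializes_chartGerm {x y : X} (h : x ⤳ y) (hx : x ∈ Set.range ι)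
    (hy : y ∈ Set.range ι) (a : A) :
    (X.presheaf.stalkSpecializes h).hom (chartGerm ι y hy a) = chartGerm ι x hx a := by
  have := X.presheaf.germ_stalkSpecializes (U := ι ''ᵁ ⊤) (mem_image_top ι hy) h
  exact ConcreteCategory.congr_hom this _

lemma isLocalization_chartGerm (P : Spec (CommRingCat.of A)) :
    letI := (chartGerm ι (ι P) (Set.mem_range_self P)).toAlgebra
    IsLocalization.AtPrime (X.presheaf.stalk (ι P)) (pointIdeal P) := by
  let _ := (chartGerm ι (ι P) (Set.mem_range_self P)).toAlgebra
  let _ : Algebra A ((Spec (CommRingCat.of A)).presheaf.stalk P) :=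
    (StructureSheaf.toStalk A P).hom.toAlgebra
  have h1 : IsLocalization.AtPrime ((Spec (CommRingCat.of A)).presheaf.stalk P) (pointIdeal P) :=
    StructureSheaf.IsLocalization.to_stalk A P
  let e : (Spec (CommRingCat.of A)).presheaf.stalk P ≃+* X.presheaf.stalk (ι P) :=
    (asIso (ι.stalkMap P)).commRingCatIsoToRingEquiv.symm
  have he : ∀ a, e (algebraMap A _ a) = algebraMap A (X.presheaf.stalk (ι P)) a := by
    intro a
    rw [RingEquiv.symm_apply_eq]
    exact (stalkMap_chartGerm ι P a).symm
  let e' : (Spec (CommRingCat.of A)).presheaf.stalk P ≃ₐ[A] X.presheaf.stalk (ι P) :=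
    AlgEquiv.ofRingEquiv (f := e) he
  exact IsLocalization.isLocalization_of_algEquiv _ e'

/-- Functions on a chart are units at `ι P` if and only if they are not in `P`. -/
lemma isUnit_chartGerm (P : Spec (CommRingCat.of A)) (a : A) :
    IsUnit (chartGerm ι (ι P) (Set.mem_range_self P) a) ↔ a ∉ pointIdeal P := by
  let _ := (chartGerm ι (ι P) (Set.mem_range_self P)).toAlgebra
  have := isLocalization_chartGerm ι P
  exact IsLocalization.AtPrime.isUnit_to_map_iff (X.presheaf.stalk (ι P)) (pointIdeal P) a

lemma chartGerm_surj (P : Spec (CommRingCat.of A)) (z : X.presheaf.stalk (ι P)) :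
    ∃ a s, s ∉ pointIdeal P ∧
      z * chartGerm ι (ι P) (Set.mem_range_self P) s = chartGerm ι (ι P) (Set.mem_range_self P) a := by
  let _ := (chartGerm ι (ι P) (Set.mem_range_self P)).toAlgebra
  have := isLocalization_chartGerm ι P
  obtain ⟨⟨a, s⟩, h⟩ := IsLocalization.surj (pointIdeal P).primeCompl z
  exact ⟨a, s, s.2, h⟩

lemma chartGerm_mem_maximalIdeal (P : Spec (CommRingCat.of A)) (a : A) :
    chartGerm ι (ι P) (Set.mem_range_self P) a ∈ IsLocalRing.maximalIdeal (X.presheaf.stalk (ι P)) ↔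
      a ∈ pointIdeal P := by
  rw [IsLocalRing.mem_maximalIdeal, mem_nonunits_iff, isUnit_chartGerm, not_not]

lemma chartGerm_injective [IsDomain A] (P : Spec (CommRingCat.of A)) :
    Function.Injective (chartGerm ι (ι P) (Set.mem_range_self P)) := by
  let _ := (chartGerm ι (ι P) (Set.mem_range_self P)).toAlgebra
  have := isLocalization_chartGerm ι P
  exact IsLocalization.injective (X.presheaf.stalk (ι P))
    (pointIdeal P).primeCompl_le_nonZeroDivisors

/-- The germs of functions along a morphism that is given by a ring homomorphism on charts. -/
lemma stalkMap_chartGerm_of_comp (φ : A →+* B) (f : Spec (CommRingCat.of B) ⟶ X)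
    (hf : Spec.map (CommRingCat.ofHom φ) ≫ ι = f) (P : Spec (CommRingCat.of B))
    (hP : f P ∈ Set.range ι) (a : A) :
    (f.stalkMap P).hom (chartGerm ι (f P) hP a) = (StructureSheaf.toStalk B P).hom (φ a) := by
  subst hf
  rw [Scheme.Hom.stalkMap_comp]
  have h1 := stalkMap_chartGerm ι (Spec.map (CommRingCat.ofHom φ) P) a
  have h2 : (Scheme.Hom.stalkMap (Spec.map (CommRingCat.ofHom φ)) P).hom
      ((StructureSheaf.toStalk A (Spec.map (CommRingCat.ofHom φ) P)).hom a) = 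
      (StructureSheaf.toStalk B P).hom (φ a) := 
    ConcreteCategory.congr_hom (stalkMap_toStalk (CommRingCat.ofHom φ) P) a
  rw [← h2, ← h1]
  rfl

/-- Compatibility of the germs of functions on nested charts. -/
lemma chartGerm_comp (τ : Spec (CommRingCat.of B) ⟶ X) [IsOpenImmersion τ] (φ : A →+* B)
    (hφ : Spec.map (CommRingCat.ofHom φ) ≫ ι = τ) (x : X) (hx : x ∈ Set.range ι)
    (hx' : x ∈ Set.range τ) (a : A) : chartGerm ι x hx a = chartGerm τ x hx' (φ a) := by
  obtain ⟨P, rfl⟩ := hx'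
  have hinj : Function.Injective (τ.stalkMap P).hom :=
    (asIso (τ.stalkMap P)).commRingCatIsoToRingEquiv.injective
  apply hinj
  rw [stalkMap_chartGerm_of_comp ι φ τ hφ P hx, stalkMap_chartGerm]

variable [IsIntegral X]

lemma genericPoint_mem_range [Nontrivial A] : genericPoint X ∈ Set.range ι := by
  refine ((genericPoint_spec X).mem_open_set_iff ι.isOpenEmbedding.isOpen_range).mpr ?_
  obtain ⟨M, hM⟩ := Ideal.exists_maximal A
  have := hM.isPrime
  exact ⟨ι (specPoint M), trivial, ⟨_, rfl⟩⟩

/-- Functions on a chart as rational functions. -/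
noncomputable def chartToField [Nontrivial A] : A →+* X.functionField :=
  chartGerm ι (genericPoint X) (genericPoint_mem_range ι)

lemma algebraMap_chartGerm [Nontrivial A] (x : X) (hx : x ∈ Set.range ι) (a : A) :
    algebraMap (X.presheaf.stalk x) X.functionField (chartGerm ι x hx a) = chartToField ι a :=
  stalkSpecializes_chartGerm ι _ _ hx a

lemma chartToField_comp [Nontrivial A] [Nontrivial B] (τ : Spec (CommRingCat.of B) ⟶ X)
    [IsOpenImmersion τ] (φ : A →+* B) (hφ : Spec.map (CommRingCat.ofHom φ) ≫ ι = τ) (a : A) :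
    chartToField ι a = chartToField τ (φ a) :=
  chartGerm_comp ι τ φ hφ _ _ _ a

lemma chartToField_injective [IsDomain A] : Function.Injective (chartToField ι) := by
  have : ∀ a, chartToField ι a = algebraMap (X.presheaf.stalk (ι (specPoint ⊥))) _
    (chartGerm ι _ (Set.mem_range_self _) a) := fun a => (algebraMap_chartGerm ι _ _ a).symm
  intro a b hab
  rw [this, this] at hab
  exact chartGerm_injective ι _ (IsFractionRing.injective _ _ hab)

/-- The function field is the field of fractions of the local ring at the image of the zero ideal,
and that ring is a localization of A; the denominators are cleared twice. -/
lemma chartToField_surj [IsDomain A] (z : X.functionField) :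
    ∃ a s : A, s ≠ 0 ∧ z = chartToField ι a / chartToField ι s := by
  obtain ⟨⟨a, s⟩, h⟩ := IsLocalization.surj
    (nonZeroDivisors (X.presheaf.stalk (ι (specPoint (⊥ : Ideal A))))) z
  obtain ⟨a', t, ht, h1⟩ := chartGerm_surj ι _ a
  obtain ⟨s', r, hr, h2⟩ := chartGerm_surj ι _ (s : X.presheaf.stalk (ι (specPoint (⊥ : Ideal A))))
  have e1 := congrArg (algebraMap _ X.functionField) h1
  have e2 := congrArg (algebraMap _ X.functionField) h2
  rw [map_mul, algebraMap_chartGerm, algebraMap_chartGerm] at e1 e2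
  have hinj := chartToField_injective ι
  have hs : algebraMap _ X.functionField (s : X.presheaf.stalk (ι (specPoint (⊥ : Ideal A)))) ≠ 0 :=
    IsFractionRing.to_map_ne_zero_of_mem_nonZeroDivisors s.2
  have ht0 : t ≠ 0 := fun h => ht (by rw [h]; exact Ideal.zero_mem _)
  have hr0 : r ≠ 0 := fun h => hr (by rw [h]; exact Ideal.zero_mem _)
  have ht1 : chartToField ι t ≠ 0 := (map_ne_zero_iff _ hinj).mpr ht0
  have hr1 : chartToField ι r ≠ 0 := (map_ne_zero_iff _ hinj).mpr hr0
  have hs' : chartToField ι s' ≠ 0 := by rw [← e2]; exact mul_ne_zero hs hr1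
  refine ⟨a' * r, s' * t, ?_, ?_⟩
  · refine mul_ne_zero (fun h => hs' (by rw [h, map_zero])) ht0
  · rw [map_mul, map_mul, ← e1, ← e2, eq_div_iff (by positivity)]
    rw [← h]; ring

end Chart

/-! ### Orders of vanishing -/

section Order

variable {X : Scheme.{u}} [IsIntegral X] [IsLocallyNoetherian X]

/-- This unwinds the multiplicative valuation on the function field into a length; the length is
finite because the local ring has dimension at most one. -/
lemma ord_algebraMap {x : X} (hx : Order.coheight x = 1) {a : X.presheaf.stalk x} (ha : a ≠ 0) :
    Scheme.ord (algebraMap (X.presheaf.stalk x) X.functionField a) x =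
      (Ring.ord (X.presheaf.stalk x) a).toNat := by
  have hK : Ring.KrullDimLE 1 (X.presheaf.stalk x) := krullDimLE_of_coheight_le hx.le
  have ha' : algebraMap (X.presheaf.stalk x) X.functionField a ≠ 0 :=
    (map_ne_zero_iff _ (IsFractionRing.injective _ _)).mpr ha
  rw [Scheme.ord_eq_iff hx ha']
  have h1 : Scheme.ordHom x hx (algebraMap (X.presheaf.stalk x) X.functionField a) =
      Ring.ordMonoidWithZeroHom (X.presheaf.stalk x) a :=
    Ring.ordFrac_eq_ord (X.presheaf.stalk x) ha
  rw [h1]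
  refine Ring.ordMonoidWithZeroHom_eq_coe _ (mem_nonZeroDivisors_of_ne_zero ha) ?_
  exact (ENat.natCast_toNat (Ring.ord_ne_top (mem_nonZeroDivisors_of_ne_zero ha))).symm

lemma ord_algebraMap_nonneg {x : X} (hx : Order.coheight x = 1) {a : X.presheaf.stalk x} :
    0 ≤ Scheme.ord (algebraMap (X.presheaf.stalk x) X.functionField a) x := by
  by_cases ha : a = 0
  · simp [ha]
  · rw [ord_algebraMap hx ha]; positivity

lemma ord_algebraMap_of_isUnit {x : X} (hx : Order.coheight x = 1) {a : X.presheaf.stalk x}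
    (ha : IsUnit a) : Scheme.ord (algebraMap (X.presheaf.stalk x) X.functionField a) x = 0 := by
  rw [ord_algebraMap hx ha.ne_zero, Ring.ord_of_isUnit ha]; rfl

lemma ord_one (x : X) : Scheme.ord (1 : X.functionField) x = 0 := by
  have h1 := Scheme.ord_mul (X := X) (x := x) (f := 1) (g := 1) one_ne_zero one_ne_zero
  rw [mul_one] at h1
  omega

lemma ord_inv (x : X) {f : X.functionField} (hf : f ≠ 0) :
    Scheme.ord f⁻¹ x = -Scheme.ord f x := by
  have h1 := Scheme.ord_mul (x := x) hf (inv_ne_zero hf)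
  rw [mul_inv_cancel₀ hf, ord_one] at h1
  omega

variable {A : Type u} [CommRing A] [IsDomain A]
  (ι : Spec (CommRingCat.of A) ⟶ X) [IsOpenImmersion ι]
  (P : Spec (CommRingCat.of A)) {e : A} (he0 : e ≠ 0) (he : e ∈ pointIdeal P)
  (hP : ∀ a ∈ pointIdeal P, ∃ s ∉ pointIdeal P, ∃ b, s * a = b * e)

-- The hypothesis `hP` says that e generates the prime P up to factors outside P, and these become
-- units in the stalk.
include he hP in
omit [AlgebraicGeometry.IsIntegral X] [IsLocallyNoetherian X] [IsDomain A] in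
lemma maximalIdeal_eq_span_chartGerm :
    IsLocalRing.maximalIdeal (X.presheaf.stalk (ι P)) =
      Ideal.span {chartGerm ι (ι P) (Set.mem_range_self P) e} := by
  apply le_antisymm
  · intro z hz
    obtain ⟨a, s, hs, h1⟩ := chartGerm_surj ι P z
    have ha : a ∈ pointIdeal P := by
      rw [← chartGerm_mem_maximalIdeal ι, ← h1]
      exact Ideal.mul_mem_right _ _ hz
    obtain ⟨t, ht, b, h2⟩ := hP a ha
    have hs' := (isUnit_chartGerm ι P s).mpr hs
    have ht' := (isUnit_chartGerm ι P t).mpr ht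
    have h3 : z * (chartGerm ι (ι P) (Set.mem_range_self P) s *
        chartGerm ι (ι P) (Set.mem_range_self P) t) ∈
        Ideal.span {chartGerm ι (ι P) (Set.mem_range_self P) e} := by
      rw [← mul_assoc, h1, ← map_mul, mul_comm a, h2, map_mul]
      exact Ideal.mul_mem_left _ _ (Ideal.mem_span_singleton_self _)
    rwa [Ideal.mul_unit_mem_iff_mem _ (hs'.mul ht')] at h3
  · rw [Ideal.span_singleton_le_iff_mem, chartGerm_mem_maximalIdeal]
    exact he

include he0 he hP

/-- A Noetherian local domain whose maximal ideal is principal and nonzero is a discrete valuation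
ring. -/
lemma isDiscreteValuationRing_stalk :
    IsDiscreteValuationRing (X.presheaf.stalk (ι P)) := by
  have hmax := maximalIdeal_eq_span_chartGerm ι P he hP
  have hne : IsLocalRing.maximalIdeal (X.presheaf.stalk (ι P)) ≠ ⊥ := by
    rw [hmax, Ne, Ideal.span_singleton_eq_bot]
    exact (map_ne_zero_iff _ (chartGerm_injective ι P)).mpr he0
  have hf : ¬ IsField (X.presheaf.stalk (ι P)) := fun h =>
    hne (IsLocalRing.isField_iff_maximalIdeal_eq.mp h)
  have hpr : (IsLocalRing.maximalIdeal (X.presheaf.stalk (ι P))).IsPrincipal := ⟨⟨_, hmax⟩⟩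
  have : IsPrincipalIdealRing (X.presheaf.stalk (ι P)) :=
    ((tfae_of_isNoetherianRing_of_isLocalRing_of_isDomain
      (X.presheaf.stalk (ι P))).out 0 4).mpr hpr
  exact { not_a_field' := hne }

lemma coheight_eq_one_of_principal : Order.coheight (ι P) = 1 := by
  have := isDiscreteValuationRing_stalk ι P he0 he hP
  have h1 := ringKrullDim_stalk_eq_coheight (ι P)
  rw [IsPrincipalIdealRing.ringKrullDim_eq_one _
    (IsDiscreteValuationRing.not_isField (X.presheaf.stalk (ι P)))] at h1
  exact_mod_cast h1.symm

lemma ord_chartToField_eq_one : Scheme.ord (chartToField ι e) (ι P) = 1 := by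
  have := isDiscreteValuationRing_stalk ι P he0 he hP
  have hx := coheight_eq_one_of_principal ι P he0 he hP
  have hirr : Irreducible (chartGerm ι (ι P) (Set.mem_range_self P) e) :=
    (IsDiscreteValuationRing.irreducible_iff_uniformizer _).mpr
      (maximalIdeal_eq_span_chartGerm ι P he hP)
  rw [← algebraMap_chartGerm ι (ι P) (Set.mem_range_self P), ord_algebraMap hx hirr.ne_zero,
    Ring.ord_of_irreducible hirr]
  rfl

end Order

/-! ### Monoid algebras of cones -/

lemma pairing_add (m m' v : ℤ × ℤ) : pairing (m + m') v = pairing m v + pairing m' v := by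
  simp only [pairing, Prod.fst_add, Prod.snd_add]; ring

lemma pairing_sub (m m' v : ℤ × ℤ) : pairing (m - m') v = pairing m v - pairing m' v := by
  simp only [pairing, Prod.fst_sub, Prod.snd_sub]; ring

lemma pairing_neg (m v : ℤ × ℤ) : pairing (-m) v = -pairing m v := by
  simp only [pairing, Prod.fst_neg, Prod.snd_neg]; ring

lemma pairing_smul (c : ℤ) (m v : ℤ × ℤ) : pairing (c • m) v = c * pairing m v := by
  simp only [pairing, Prod.smul_fst, Prod.smul_snd, smul_eq_mul]; ring

lemma pairing_nsmul (c : ℕ) (m v : ℤ × ℤ) : pairing (c • m) v = c * pairing m v := by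
  rw [← natCast_zsmul, pairing_smul]

lemma pairing_zero (v : ℤ × ℤ) : pairing 0 v = 0 := by simp [pairing]

/-- The character `det(v, ·)`. -/
def perp (v : ℤ × ℤ) : ℤ × ℤ := (-v.2, v.1)

lemma pairing_perp (v w : ℤ × ℤ) : pairing (perp v) w = det v w := by
  simp only [pairing, perp, det]; ring

lemma perp_mem {v w : ℤ × ℤ} (h : 0 ≤ det v w) : perp v ∈ dualMonoid v w :=
  ⟨by rw [pairing_perp, det_self], by rwa [pairing_perp]⟩

lemma neg_perp_mem {v w : ℤ × ℤ} (h : 0 ≤ det v w) : -perp w ∈ dualMonoid v w :=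
  ⟨by rw [pairing_neg, pairing_perp, det_swap, neg_neg]; exact h,
    by rw [pairing_neg, pairing_perp, det_self, neg_zero]⟩

/-- A character is determined by its values on two independent vectors. -/
lemma eq_of_pairing_eq {v w m m' : ℤ × ℤ} (h : det v w ≠ 0) (h1 : pairing m v = pairing m' v)
    (h2 : pairing m w = pairing m' w) : m = m' := by
  have key : ∀ x u : ℤ × ℤ, pairing x u = det u (x.2, -x.1) * (-1) := fun x u => by
    simp only [pairing, det]; ring
  have := eq_of_det_eq (a := v) (b := w) (u := (m.2, -m.1)) (v := (m'.2, -m'.1)) h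
    (by have := key m v; have := key m' v; linarith)
    (by have := key m w; have := key m' w; linarith)
  simp only [Prod.mk.injEq, neg_inj] at this
  exact Prod.ext this.2 this.1

/-- `u` lies in the cone spanned by `v` and `w`. -/
def InCone (u v w : ℤ × ℤ) : Prop := dualMonoid v w ≤ dualMonoid u u

lemma InCone.pairing_nonneg {u v w m : ℤ × ℤ} (h : InCone u v w) (hm : m ∈ dualMonoid v w) :
    0 ≤ pairing m u := (h hm).1

lemma inCone_left (v w : ℤ × ℤ) : InCone v v w := fun _ hm => ⟨hm.1, hm.1⟩

lemma inCone_right (v w : ℤ × ℤ) : InCone w v w := fun _ hm => ⟨hm.2, hm.2⟩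

/-- Cramer's rule for u in terms of v and w, paired with m. -/
lemma pairing_mul_det (m u v w : ℤ × ℤ) :
    pairing m u * det v w = pairing m v * det u w + pairing m w * det v u := by
  simp only [pairing, det]; ring

lemma inCone_of_det {u v w : ℤ × ℤ} (h : 0 < det v w) (h1 : 0 ≤ det v u) (h2 : 0 ≤ det u w) :
    InCone u v w := by
  intro m hm
  have : 0 ≤ pairing m u * det v w := by
    rw [pairing_mul_det]
    exact add_nonneg (mul_nonneg hm.1 h2) (mul_nonneg hm.2 h1)
  have := nonneg_of_mul_nonneg_left this h
  exact ⟨this, this⟩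

section ConeAlgebra

variable (k : Type u) [Field k]

/-- The coordinate ring of the torus. -/
abbrev LaurentRing : Type u := AddMonoidAlgebra k (ℤ × ℤ)

/-- The coordinate ring of the affine toric surface of a cone. -/
abbrev ConeRing (v w : ℤ × ℤ) : Type u := AddMonoidAlgebra k (dualMonoid v w)

instance : IsDomain (LaurentRing k) := NoZeroDivisors.to_isDomain _

/-- The inclusion of the coordinate ring of an affine toric surface in that of the torus. -/
noncomputable abbrev toLaurent (v w : ℤ × ℤ) : ConeRing k v w →+* LaurentRing k :=
  AddMonoidAlgebra.mapDomainRingHom k (dualMonoid v w).subtype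

lemma toLaurent_injective (v w : ℤ × ℤ) : Function.Injective (toLaurent k v w) :=
  AddMonoidAlgebra.mapDomain_injective Subtype.val_injective

instance (v w : ℤ × ℤ) : IsDomain (ConeRing k v w) := (toLaurent_injective k v w).isDomain

variable {k}

/-- The inclusion of coordinate rings for nested cones. -/
noncomputable abbrev coneInclusion {v w v' w' : ℤ × ℤ} (h : dualMonoid v w ≤ dualMonoid v' w') :
    ConeRing k v w →+* ConeRing k v' w' :=
  AddMonoidAlgebra.mapDomainRingHom k (AddSubmonoid.inclusion h)

lemma toLaurent_comp_coneInclusion {v w v' w' : ℤ × ℤ}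
    (h : dualMonoid v w ≤ dualMonoid v' w') :
    (toLaurent k v' w').comp (coneInclusion h) = toLaurent k v w := by
  rw [← AddMonoidAlgebra.mapDomainRingHom_comp]
  rfl

/-- The monomial of a character. -/
noncomputable def monomial {v w : ℤ × ℤ} (m : ℤ × ℤ) (hm : m ∈ dualMonoid v w) : ConeRing k v w :=
  AddMonoidAlgebra.single ⟨m, hm⟩ 1

lemma monomial_mul {v w m m' : ℤ × ℤ} (hm : m ∈ dualMonoid v w) (hm' : m' ∈ dualMonoid v w) :
    monomial (k := k) m hm * monomial m' hm' = monomial (m + m') (add_mem hm hm') := by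
  simp only [monomial, AddMonoidAlgebra.single_mul_single, mul_one]
  rfl

lemma monomial_pow {v w m : ℤ × ℤ} (hm : m ∈ dualMonoid v w) (n : ℕ) :
    monomial (k := k) m hm ^ n = monomial (n • m) (nsmul_mem hm n) := by
  simp only [monomial, AddMonoidAlgebra.single_pow, one_pow]
  rfl

lemma monomial_ne_zero {v w m : ℤ × ℤ} (hm : m ∈ dualMonoid v w) :
    monomial (k := k) m hm ≠ 0 := by
  rw [monomial, Ne, AddMonoidAlgebra.single_eq_zero]; exact one_ne_zero

lemma toLaurent_monomial {v w m : ℤ × ℤ} (hm : m ∈ dualMonoid v w) :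
    toLaurent k v w (monomial m hm) = AddMonoidAlgebra.single m 1 := by
  simp [monomial, toLaurent]

/-- Every element is a sum of multiples of monomials. -/
lemma coneRing_eq_sum {v w : ℤ × ℤ} (a : ConeRing k v w) :
    a = ∑ m ∈ a.coeff.support, algebraMap k _ (a.coeff m) * monomial m.1 m.2 := by
  apply AddMonoidAlgebra.coeff_injective
  rw [AddMonoidAlgebra.coeff_sum]
  conv_lhs => rw [← Finsupp.sum_single a.coeff]
  refine Finset.sum_congr rfl fun m _ => ?_
  simp [monomial, AddMonoidAlgebra.single_mul_single]

/-- The restriction of functions to the orbit closure of a vector `u` of the cone. -/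
noncomputable def faceHom {u v w : ℤ × ℤ} (h : InCone u v w) : ConeRing k v w →ₐ[k] LaurentRing k :=
  AddMonoidAlgebra.lift k (LaurentRing k) (dualMonoid v w)
    { toFun := fun m => if pairing m.toAdd.1 u = 0 then
        AddMonoidAlgebra.single m.toAdd.1 1 else 0
      map_one' := by simp [pairing_zero, AddMonoidAlgebra.one_def]
      map_mul' := fun m m' => by
        have h1 := h.pairing_nonneg m.toAdd.2
        have h2 := h.pairing_nonneg m'.toAdd.2
        simp only [toAdd_mul, AddSubmonoid.coe_add, pairing_add]
        split_ifs with e1 e2 e3 e3 <;> first | omega | simp [AddMonoidAlgebra.single_mul_single] }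

lemma faceHom_single {u v w : ℤ × ℤ} (h : InCone u v w) (m : dualMonoid v w) (c : k) :
    faceHom (k := k) h (AddMonoidAlgebra.single m c) =
      if pairing m.1 u = 0 then AddMonoidAlgebra.single m.1 c else 0 := by
  simp only [faceHom, AddMonoidAlgebra.lift_single, MonoidHom.coe_mk, OneHom.coe_mk, toAdd_ofAdd]
  split_ifs <;> simp

lemma faceHom_monomial {u v w m : ℤ × ℤ} (h : InCone u v w) (hm : m ∈ dualMonoid v w) :
    faceHom (k := k) h (monomial m hm) =
      if pairing m u = 0 then AddMonoidAlgebra.single m 1 else 0 := by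
  rw [monomial, faceHom_single]

/-- The prime ideal of the orbit closure of a vector `u` of the cone. -/
noncomputable def faceIdeal {u v w : ℤ × ℤ} (h : InCone u v w) : Ideal (ConeRing k v w) :=
  RingHom.ker (faceHom (k := k) h)

instance {u v w : ℤ × ℤ} (h : InCone u v w) : (faceIdeal (k := k) h).IsPrime :=
  RingHom.ker_isPrime _

lemma monomial_mem_faceIdeal {u v w m : ℤ × ℤ} (h : InCone u v w) (hm : m ∈ dualMonoid v w) :
    monomial m hm ∈ faceIdeal (k := k) h ↔ 0 < pairing m u := by
  have h1 := h.pairing_nonneg hm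
  rw [faceIdeal, RingHom.mem_ker]
  have h2 := faceHom_monomial (k := k) h hm
  rw [show (faceHom (k := k) h) (monomial m hm) = _ from h2]
  split_ifs with h0
  · simp [AddMonoidAlgebra.single_eq_zero, h0]
  · simp; omega

lemma coeff_faceHom {u v w : ℤ × ℤ} (h : InCone u v w) (a : ConeRing k v w)
    (m : dualMonoid v w) (hm : pairing m.1 u = 0) :
    (faceHom h a).coeff m.1 = a.coeff m := by
  classical
  conv_lhs => rw [coneRing_eq_sum a]
  rw [map_sum, AddMonoidAlgebra.coeff_sum, Finsupp.finsetSum_apply]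
  have : ∀ x : dualMonoid v w, (faceHom h (algebraMap k _ (a.coeff x) * monomial x.1 x.2)).coeff m.1
      = if x = m then a.coeff x else 0 := by
    intro x
    rw [map_mul, AlgHom.commutes, faceHom_monomial, ← Algebra.smul_def,
      AddMonoidAlgebra.coeff_smul_apply]
    split_ifs with h1 h2 h2
    · subst h2
      simp
    · have h3 : x.1 ≠ m.1 := fun h => h2 (Subtype.ext h)
      simp [h3]
    · subst h2; exact absurd hm h1
    · simp
  simp only [this]
  by_cases hms : m ∈ a.coeff.support
  · simp [hms]
  · simp [Finsupp.notMem_support_iff.mp hms]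

/-- `faceHom` preserves the coefficients of the characters that vanish on u and kills all others, so
nothing can cancel. -/
lemma mem_faceIdeal {u v w : ℤ × ℤ} (h : InCone u v w) (a : ConeRing k v w) :
    a ∈ faceIdeal h ↔ ∀ m ∈ a.coeff.support, 0 < pairing m.1 u := by
  constructor
  · intro ha m hm
    refine lt_of_le_of_ne (h.pairing_nonneg m.2) fun h0 => ?_
    have h1 := coeff_faceHom h a m h0.symm
    have h2 : faceHom h a = 0 := ha
    rw [h2] at h1
    exact Finsupp.mem_support_iff.mp hm h1.symm
  · intro ha
    rw [coneRing_eq_sum a]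
    exact Ideal.sum_mem _ fun m hm => Ideal.mul_mem_left _ _
      ((monomial_mem_faceIdeal h m.2).mpr (ha m hm))

/-- Compatibility with nested cones is what makes the generic point of an orbit closure independent
of the chart. -/
lemma comap_faceIdeal {u v w v' w' : ℤ × ℤ} (h : dualMonoid v w ≤ dualMonoid v' w')
    (hu : InCone u v' w') :
    (faceIdeal (k := k) hu).comap (coneInclusion h) = faceIdeal (k := k) (h.trans hu) := by
  have : (faceHom (k := k) hu).toRingHom.comp (coneInclusion h) =
      (faceHom (k := k) (h.trans hu : InCone u v w)).toRingHom := by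
    refine AddMonoidAlgebra.ringHom_ext (fun r => ?_) (fun m => ?_)
    · have := faceHom_single (k := k) (h.trans hu : InCone u v w) 0 r
      simp only [AlgHom.toRingHom_eq_coe, RingHom.coe_comp, RingHom.coe_coe, Function.comp_apply]
      rw [this]
      simp [faceHom_single, pairing_zero]
    · have := faceHom_single (k := k) (h.trans hu : InCone u v w) m 1
      simp only [AlgHom.toRingHom_eq_coe, RingHom.coe_comp, RingHom.coe_coe, Function.comp_apply]
      rw [this]
      simp [AddSubmonoid.inclusion, faceHom_single]
  ext a
  exact Eq.congr_left (RingHom.congr_fun this a)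

/-- A condition for the face ideal to be principal at its generic point. -/
lemma exists_mul_eq_of_mem_faceIdeal {u v w e f : ℤ × ℤ} (h : InCone u v w)
    (he : e ∈ dualMonoid v w) (hf : f ∈ dualMonoid v w) (hfu : pairing f u = 0)
    (H : ∀ m ∈ dualMonoid v w, 0 < pairing m u → ∃ L : ℕ, m + L • f - e ∈ dualMonoid v w)
    (a : ConeRing k v w) (ha : a ∈ faceIdeal h) :
    ∃ s ∉ faceIdeal (k := k) h, ∃ b, s * a = b * monomial e he := by
  rw [mem_faceIdeal] at ha
  rw [coneRing_eq_sum a]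
  refine Finset.sum_induction _ (fun x => ∃ s ∉ faceIdeal (k := k) h, ∃ b, s * x = b * monomial e he)
    ?_ ?_ ?_
  · rintro x y ⟨s, hs, b, hb⟩ ⟨t, ht, c, hc⟩
    refine ⟨s * t, fun hst => ?_, t * b + s * c, ?_⟩
    · rcases Ideal.IsPrime.mem_or_mem inferInstance hst with h' | h'
      exacts [hs h', ht h']
    · linear_combination t * hb + s * hc
  · exact ⟨1, (Ideal.ne_top_iff_one _).mp (Ideal.IsPrime.ne_top inferInstance), 0, by simp⟩
  · intro m hm
    obtain ⟨L, hL⟩ := H m.1 m.2 (ha m hm)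
    refine ⟨monomial (L • f) (nsmul_mem hf L), ?_, algebraMap k _ (a.coeff m) * monomial _ hL, ?_⟩
    · rw [monomial_mem_faceIdeal, pairing_nsmul, hfu]; simp
    · rw [mul_assoc, monomial_mul, mul_left_comm, monomial_mul]
      congr 2
      abel

end ConeAlgebra

/-! ### Points of toric surfaces -/

section Cone

variable {v w : ℤ × ℤ}

/-- Adding multiples of m repairs x on every edge where m is positive; on the other edges x must
already be nonnegative. -/
lemma exists_add_nsmul_mem {m : ℤ × ℤ} (x : ℤ × ℤ) (hm : m ∈ dualMonoid v w)
    (hv : 0 < pairing m v ∨ 0 ≤ pairing x v) (hw : 0 < pairing m w ∨ 0 ≤ pairing x w) :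
    ∃ N : ℕ, x + N • m ∈ dualMonoid v w := by
  refine ⟨(pairing x v).natAbs + (pairing x w).natAbs, ?_, ?_⟩
  · rw [pairing_add, pairing_nsmul]
    rcases hv with h | h
    · push_cast
      nlinarith [neg_abs_le (pairing x v), abs_nonneg (pairing x v), abs_nonneg (pairing x w)]
    · have := hm.1
      positivity
  · rw [pairing_add, pairing_nsmul]
    rcases hw with h | h
    · push_cast
      nlinarith [neg_abs_le (pairing x w), abs_nonneg (pairing x v), abs_nonneg (pairing x w)]
    · have := hm.2
      positivity

/-- A character that is positive on the cone except at the origin. -/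
def interior (v w : ℤ × ℤ) : ℤ × ℤ := perp v - perp w

lemma pairing_interior_left (v w : ℤ × ℤ) : pairing (interior v w) v = det v w := by
  rw [interior, pairing_sub, pairing_perp, pairing_perp, det_self, det_swap w]; ring

lemma pairing_interior_right (v w : ℤ × ℤ) : pairing (interior v w) w = det v w := by
  rw [interior, pairing_sub, pairing_perp, pairing_perp, det_self]; ring

lemma interior_mem (h : 0 ≤ det v w) : interior v w ∈ dualMonoid v w :=
  ⟨by rwa [pairing_interior_left], by rwa [pairing_interior_right]⟩

/-- A primitive vector takes the value one at some character in the dual cone. -/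
lemma exists_pairing_eq_one (h : 0 < det v w) (hv : IsCoprime v.1 v.2) :
    ∃ e ∈ dualMonoid v w, pairing e v = 1 := by
  obtain ⟨a, b, hab⟩ := hv
  have h1 : pairing (a, b) v = 1 := hab
  -- The Bézout character is corrected by multiples of `perp v`, which is zero at v and positive at
  -- w.
  obtain ⟨N, hN⟩ := exists_add_nsmul_mem (a, b) (perp_mem h.le) (Or.inr (by rw [h1]; norm_num))
    (Or.inl (by rwa [pairing_perp]))
  exact ⟨_, hN, by rw [pairing_add, pairing_nsmul, pairing_perp, det_self, h1]; ring⟩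

lemma eq_smul_perp {m : ℤ × ℤ} (hv : IsCoprime v.1 v.2) (h : pairing m v = 0) :
    ∃ c : ℤ, m = c • perp v := by
  obtain ⟨a, b, hab⟩ := hv
  simp only [pairing] at h
  refine ⟨m.2 * a - m.1 * b, Prod.ext ?_ ?_⟩
  · simp only [perp, Prod.smul_fst, smul_eq_mul]
    linear_combination (-m.1) * hab + a * h
  · simp only [perp, Prod.smul_snd, smul_eq_mul]
    linear_combination (-m.2) * hab + b * h

variable {k : Type u} [Field k]

/-- A character positive on both edges dominates every other character after multiplication by a
large integer, so inverting its monomial inverts all monomials. -/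
lemma isLocalization_toLaurent {m : ℤ × ℤ} (hm : m ∈ dualMonoid v w) (hv : 0 < pairing m v)
    (hw : 0 < pairing m w) :
    letI := (toLaurent k v w).toAlgebra
    IsLocalization.Away (monomial (k := k) m hm) (LaurentRing k) := by
  let _ := (toLaurent k v w).toAlgebra
  have hmap : ∀ a, algebraMap (ConeRing k v w) (LaurentRing k) a = toLaurent k v w a :=
    fun _ => rfl
  refine (isLocalization_iff _ _).mpr ⟨?_, ?_, ?_⟩
  · rintro ⟨_, n, rfl⟩
    rw [hmap, map_pow, toLaurent_monomial]
    refine IsUnit.pow _ (IsUnit.of_mul_eq_one (AddMonoidAlgebra.single (-m) 1) ?_)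
    simp [AddMonoidAlgebra.single_mul_single, AddMonoidAlgebra.one_def]
  · intro z
    suffices ∃ (N : ℕ) (x : ConeRing k v w), z * toLaurent k v w (monomial m hm ^ N) =
        toLaurent k v w x by
      obtain ⟨N, x, h⟩ := this
      exact ⟨⟨x, ⟨_, N, rfl⟩⟩, h⟩
    induction z using AddMonoidAlgebra.induction_linear with
    | zero => exact ⟨0, 0, by simp⟩
    | add z z' h h' =>
      obtain ⟨N, x, h⟩ := h
      obtain ⟨N', x', h'⟩ := h'
      refine ⟨N + N', x * monomial m hm ^ N' + x' * monomial m hm ^ N, ?_⟩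
      rw [map_add, map_mul, map_mul, ← h, ← h', pow_add, map_mul]
      ring
    | single x r =>
      obtain ⟨N, hN⟩ := exists_add_nsmul_mem x hm (Or.inl hv) (Or.inl hw)
      refine ⟨N, AddMonoidAlgebra.single ⟨_, hN⟩ r, ?_⟩
      rw [monomial_pow, toLaurent_monomial]
      simp [AddMonoidAlgebra.single_mul_single, toLaurent]
  · intro x y h
    exact ⟨1, by rw [toLaurent_injective k v w h]⟩

lemma isOpenImmersion_torusInclusion (h : 0 < det v w) :
    IsOpenImmersion (torusInclusion k v w) := by
  let _ := (toLaurent k v w).toAlgebra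
  have := isLocalization_toLaurent (k := k) (interior_mem h.le)
    (by rwa [pairing_interior_left]) (by rwa [pairing_interior_right])
  exact IsOpenImmersion.of_isLocalization (monomial (k := k) _ (interior_mem h.le))

lemma mem_range_torusInclusion (h : 0 < det v w) (P : affineToric k v w) :
    P ∈ Set.range (torusInclusion k v w) ↔
      monomial _ (interior_mem h.le) ∉ pointIdeal P := by
  let _ := (toLaurent k v w).toAlgebra
  have := isLocalization_toLaurent (k := k) (interior_mem h.le)
    (by rwa [pairing_interior_left]) (by rwa [pairing_interior_right])
  have h1 := PrimeSpectrum.localization_away_comap_range (LaurentRing k)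
    (monomial (k := k) _ (interior_mem h.le))
  have h2 : P ∈ Set.range (torusInclusion k v w) ↔
      P ∈ Set.range (PrimeSpectrum.comap (algebraMap (ConeRing k v w) (LaurentRing k))) := Iff.rfl
  rw [h2, h1]
  rfl

instance (v w : ℤ × ℤ) : IsDominant (torusInclusion k v w) where
  denseRange := by
    have h := (PrimeSpectrum.denseRange_comap_iff_ker_le_nilRadical (toLaurent k v w)).mpr
      (by rw [(RingHom.injective_iff_ker_eq_bot _).mp (toLaurent_injective k v w)]; exact bot_le)
    exact h

/-- A point outside the torus lies on the orbit closure of one of the two edges. -/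
lemma faceIdeal_le_or_le (h : 0 < det v w) (P : affineToric k v w)
    (hP : P ∉ Set.range (torusInclusion k v w)) :
    faceIdeal (inCone_left v w) ≤ pointIdeal P ∨ faceIdeal (inCone_right v w) ≤ pointIdeal P := by
  rw [mem_range_torusInclusion h, not_not] at hP
  have key : ∀ (u : ℤ × ℤ) (hu : InCone u v w), ¬ faceIdeal (k := k) hu ≤ pointIdeal P →
      ∃ m, ∃ hm : m ∈ dualMonoid v w, 0 < pairing m u ∧ monomial m hm ∉ pointIdeal P := by
    intro u hu hle
    by_contra! hcon
    refine hle fun a ha => ?_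
    rw [mem_faceIdeal] at ha
    rw [coneRing_eq_sum a]
    exact Ideal.sum_mem _ fun m hm => Ideal.mul_mem_left _ _ (hcon m.1 m.2 (ha m hm))
  by_contra! hcon
  obtain ⟨m, hm, h1, h2⟩ := key _ _ hcon.1
  obtain ⟨m', hm', h1', h2'⟩ := key _ _ hcon.2
  -- If P lies on neither edge curve, the monomials of m and m' do not vanish at P. Their sum is
  -- positive on both edges, so the monomial of `interior` divides a power of their product, yet it
  -- does vanish at P.
  obtain ⟨N, hN⟩ := exists_add_nsmul_mem (-interior v w) (add_mem hm hm')
    (Or.inl (by rw [pairing_add]; have := hm'.1; omega))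
    (Or.inl (by rw [pairing_add]; have := hm.2; omega))
  have h3 : monomial (k := k) (m + m') (add_mem hm hm') ∉ pointIdeal P := by
    rw [← monomial_mul hm hm']
    exact fun h4 => (Ideal.IsPrime.mem_or_mem inferInstance h4).elim h2 h2'
  have h4 : monomial (k := k) (m + m') (add_mem hm hm') ^ N ∈ pointIdeal P := by
    have : monomial (k := k) (m + m') (add_mem hm hm') ^ N =
        monomial _ hN * monomial _ (interior_mem h.le) := by
      rw [monomial_pow, monomial_mul]
      congr 1
      abel
    rw [this]
    exact Ideal.mul_mem_left _ _ hP
  exact h3 (Ideal.IsPrime.mem_of_pow_mem inferInstance N h4)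

end Cone

/-- There are no specializations between different points of codimension one. -/
lemma eq_of_specializes_of_coheight {X : Scheme.{u}} {c d : X} (h : c ⤳ d)
    (hc : Order.coheight c = 1) (hd : Order.coheight d = 1) : c = d := by
  by_contra hne
  have hlt : d < c := lt_of_le_not_ge (show d ≤ c from h)
    fun h' => hne (h.antisymm (show d ⤳ c from h')).eq
  have := Order.coheight_add_one_le hlt
  rw [hc, hd] at this
  exact absurd this (by decide)

namespace ToricSurface

variable {k : Type u} [Field k] (S : ToricSurface k)

instance (i : ℤ) : IsOpenImmersion (S.chart i) := S.chart_isOpenImmersion i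

instance : IsOpenImmersion S.torus := by
  have := isOpenImmersion_torusInclusion (k := k) (S.fan.det_pos 0)
  rw [← S.torusInclusion_chart 0]
  infer_instance

lemma inclusion_chart_str {u w : ℤ × ℤ} (i : ℤ)
    (h : dualMonoid (S.fan.ray i) (S.fan.ray (i + 1)) ≤ dualMonoid u w) :
    (Spec.map (CommRingCat.ofHom (coneInclusion (k := k) h)) ≫ S.chart i) ≫ S.str =
      Spec.map (CommRingCat.ofHom (algebraMap k (ConeRing k u w))) := by
  rw [Category.assoc, S.chart_str, ← Spec.map_comp, ← CommRingCat.ofHom_comp]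
  congr 2
  ext r
  simp

lemma torusInclusion_inclusion_chart {u w : ℤ × ℤ} (i : ℤ)
    (h : dualMonoid (S.fan.ray i) (S.fan.ray (i + 1)) ≤ dualMonoid u w) :
    torusInclusion k u w ≫ Spec.map (CommRingCat.ofHom (coneInclusion (k := k) h)) ≫ S.chart i =
      S.torus := by
  rw [← S.torusInclusion_chart i, torusInclusion, ← Category.assoc, ← Spec.map_comp,
    ← CommRingCat.ofHom_comp]
  congr 3
  exact toLaurent_comp_coneInclusion h

/-- Morphisms to a toric surface that agree on the torus are equal. -/
lemma hom_ext {u w : ℤ × ℤ} {f g : affineToric k u w ⟶ S.X} (h : f ≫ S.str = g ≫ S.str)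
    (h' : torusInclusion k u w ≫ f = torusInclusion k u w ≫ g) : f = g :=
  ext_of_isDominant_of_isSeparated S.str h (torusInclusion k u w) h'

/-- This takes the place of gluing data: two charts agree on a common face because they agree on its
dense torus and S is separated. -/
lemma inclusion_chart_eq {u w : ℤ × ℤ} (i j : ℤ)
    (hi : dualMonoid (S.fan.ray i) (S.fan.ray (i + 1)) ≤ dualMonoid u w)
    (hj : dualMonoid (S.fan.ray j) (S.fan.ray (j + 1)) ≤ dualMonoid u w) :
    Spec.map (CommRingCat.ofHom (coneInclusion (k := k) hi)) ≫ S.chart i =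
      Spec.map (CommRingCat.ofHom (coneInclusion (k := k) hj)) ≫ S.chart j :=
  S.hom_ext (by rw [inclusion_chart_str, inclusion_chart_str])
    (by rw [torusInclusion_inclusion_chart, torusInclusion_inclusion_chart])

/-- The generic point of the orbit closure of a vector `u` of the `i`-th cone. -/
noncomputable def orbitPoint {u : ℤ × ℤ} (i : ℤ)
    (h : InCone u (S.fan.ray i) (S.fan.ray (i + 1))) : S.X :=
  S.chart i (specPoint (faceIdeal h))

/-- The affine toric variety of the single vector u maps into every chart whose cone contains u, and
this description of the point does not depend on the chart. -/
lemma orbitPoint_eq_image {u : ℤ × ℤ} (i : ℤ)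
    (h : InCone u (S.fan.ray i) (S.fan.ray (i + 1))) :
    S.orbitPoint i h = (Spec.map (CommRingCat.ofHom (coneInclusion (k := k) h)) ≫ S.chart i)
      (specPoint (faceIdeal (inCone_left u u))) := by
  rw [Scheme.Hom.comp_apply, orbitPoint]
  congr 1
  apply pointIdeal_injective
  exact (comap_faceIdeal (k := k) (show _ ≤ _ from h) (inCone_left u u)).symm

lemma orbitPoint_eq {u : ℤ × ℤ} (i j : ℤ) (hi : InCone u (S.fan.ray i) (S.fan.ray (i + 1)))
    (hj : InCone u (S.fan.ray j) (S.fan.ray (j + 1))) : S.orbitPoint i hi = S.orbitPoint j hj := by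
  rw [orbitPoint_eq_image, orbitPoint_eq_image, S.inclusion_chart_eq i j hi hj]

end ToricSurface

/-! ### Invariant divisors and characters -/

/-- Near the generic point of its orbit closure, the ideal of an edge is principal. -/
lemma exists_mul_eq_of_mem_edge {k : Type u} [Field k] {v w e : ℤ × ℤ} (h : 0 < det v w)
    (he : e ∈ dualMonoid v w) (he1 : pairing e v = 1) (a : ConeRing k v w)
    (ha : a ∈ faceIdeal (inCone_left v w)) :
    ∃ s ∉ faceIdeal (k := k) (inCone_left v w), ∃ b, s * a = b * monomial e he := by
  refine exists_mul_eq_of_mem_faceIdeal _ he (perp_mem h.le) (by rw [pairing_perp, det_self])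
    (fun m _ hm => ?_) a ha
  obtain ⟨N, hN⟩ := exists_add_nsmul_mem (m - e) (perp_mem h.le)
    (Or.inr (by rw [pairing_sub, he1]; omega)) (Or.inl (by rwa [pairing_perp]))
  exact ⟨N, by rwa [show m + N • perp v - e = m - e + N • perp v by abel]⟩

section Cone

variable {k : Type u} [Field k] {v w : ℤ × ℤ}

lemma pairing_add_right (m u u' : ℤ × ℤ) : pairing m (u + u') = pairing m u + pairing m u' := by
  simp only [pairing, Prod.fst_add, Prod.snd_add]; ring

lemma inCone_add_self (v w : ℤ × ℤ) : InCone (v + w) v w := fun m hm => by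
  have : 0 ≤ pairing m (v + w) := by rw [pairing_add_right]; exact add_nonneg hm.1 hm.2
  exact ⟨this, this⟩

lemma faceIdeal_left_le (v w : ℤ × ℤ) :
    faceIdeal (k := k) (inCone_left v w) ≤ faceIdeal (inCone_add_self v w) := fun a ha => by
  rw [mem_faceIdeal] at ha ⊢
  intro m hm
  rw [pairing_add_right]
  exact add_pos_of_pos_of_nonneg (ha m hm) m.2.2

lemma faceIdeal_right_le (v w : ℤ × ℤ) :
    faceIdeal (k := k) (inCone_right v w) ≤ faceIdeal (inCone_add_self v w) := fun a ha => by
  rw [mem_faceIdeal] at ha ⊢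
  intro m hm
  rw [pairing_add_right]
  exact add_pos_of_nonneg_of_pos m.2.1 (ha m hm)

/-- A character positive on v + w is positive on one of the edges, so the two edge curves of the
chart meet only in the fixed point. -/
lemma faceIdeal_add_le {I : Ideal (ConeRing k v w)} (h : faceIdeal (inCone_left v w) ≤ I)
    (h' : faceIdeal (inCone_right v w) ≤ I) : faceIdeal (inCone_add_self v w) ≤ I := fun a ha => by
  rw [mem_faceIdeal] at ha
  rw [coneRing_eq_sum a]
  refine Ideal.sum_mem _ fun m hm => Ideal.mul_mem_left _ _ ?_
  have h1 := ha m hm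
  rw [pairing_add_right] at h1
  by_cases h2 : 0 < pairing m.1 v
  · exact h ((monomial_mem_faceIdeal _ m.2).mpr h2)
  · exact h' ((monomial_mem_faceIdeal _ m.2).mpr (by omega))

lemma sub_coeff_zero_mem (h : 0 < det v w) (a : ConeRing k v w) :
    a - algebraMap k _ (a.coeff 0) ∈ faceIdeal (inCone_add_self v w) := by
  rw [mem_faceIdeal]
  intro m hm
  have h1 := m.2.1
  have h2 := m.2.2
  rw [pairing_add_right]
  by_contra! hle
  have h0 : m = 0 := Subtype.ext (eq_of_pairing_eq h.ne' (by rw [ZeroMemClass.coe_zero, pairing_zero]; omega)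
    (by rw [ZeroMemClass.coe_zero, pairing_zero]; omega))
  rw [Finsupp.mem_support_iff, h0] at hm
  apply hm
  simp

/-- Modulo this ideal every function is congruent to its constant term. -/
lemma isMaximal_faceIdeal_add (h : 0 < det v w) :
    (faceIdeal (k := k) (inCone_add_self v w)).IsMaximal := by
  refine Ideal.isMaximal_iff.mpr ⟨(Ideal.ne_top_iff_one _).mp (Ideal.IsPrime.ne_top inferInstance),
    fun J x hJ hx hxJ => ?_⟩
  have h1 := sub_coeff_zero_mem h x
  have hc : x.coeff 0 ≠ 0 := fun h0 => hx (by simpa [h0] using h1)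
  have h2 : algebraMap k _ (x.coeff 0) ∈ J := by
    have := J.sub_mem hxJ (hJ h1)
    rwa [sub_sub_cancel] at this
  have := J.mul_mem_left (algebraMap k _ (x.coeff 0)⁻¹) h2
  rwa [← map_mul, inv_mul_cancel₀ hc, map_one] at this

end Cone

/-! ### Invariant curves, fixed points and orders of characters -/

namespace ToricSurface

variable {k : Type u} [Field k] (S : ToricSurface k)

lemma coheight_orbitPoint (i : ℤ) :
    Order.coheight (S.orbitPoint i (inCone_left _ _)) = 1 := by
  obtain ⟨e, he, he1⟩ := exists_pairing_eq_one (S.fan.det_pos i) (S.fan.primitive i)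
  exact coheight_eq_one_of_principal (S.chart i) (specPoint (faceIdeal (inCone_left _ _)))
    (monomial_ne_zero he) ((monomial_mem_faceIdeal _ he).mpr (by omega))
    (exists_mul_eq_of_mem_edge (S.fan.det_pos i) he he1)

/-- The invariant curve of the `i`-th ray. -/
noncomputable def divisor (i : ℤ) : PrimeDivisor S.X :=
  ⟨S.orbitPoint i (inCone_left _ _), S.coheight_orbitPoint i⟩

lemma divisor_eq_orbitPoint (j i : ℤ) (h : InCone (S.fan.ray j) (S.fan.ray i) (S.fan.ray (i + 1))) :
    (S.divisor j).1 = S.orbitPoint i h := S.orbitPoint_eq _ _ _ _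

lemma divisor_congr {i j : ℤ} (h : S.fan.ray i = S.fan.ray j) : S.divisor i = S.divisor j := by
  have h1 := S.divisor_eq_orbitPoint i j (by rw [h]; exact inCone_left _ _)
  apply Subtype.ext
  rw [h1, S.divisor_eq_orbitPoint j j (inCone_left _ _)]
  congr 1

/-- A character of the torus as a rational function. -/
noncomputable def character (m : ℤ × ℤ) : S.X.functionField :=
  chartToField S.torus (AddMonoidAlgebra.single m 1 : LaurentRing k)

lemma chartToField_chart (i : ℤ) (a : ConeRing k (S.fan.ray i) (S.fan.ray (i + 1))) :
    chartToField (S.chart i) a = chartToField S.torus (toLaurent k _ _ a) :=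
  chartToField_comp _ _ _ (S.torusInclusion_chart i) a

lemma chartToField_monomial (i : ℤ) {m : ℤ × ℤ}
    (hm : m ∈ dualMonoid (S.fan.ray i) (S.fan.ray (i + 1))) :
    chartToField (S.chart i) (monomial m hm) = S.character m := by
  rw [chartToField_chart, toLaurent_monomial, character]

lemma character_add (m m' : ℤ × ℤ) :
    S.character (m + m') = S.character m * S.character m' := by
  rw [character, character, character, ← map_mul, AddMonoidAlgebra.single_mul_single, mul_one]

lemma character_zero : S.character 0 = 1 := map_one (chartToField S.torus)

lemma character_mul_neg (m : ℤ × ℤ) : S.character m * S.character (-m) = 1 := by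
  rw [← character_add, add_neg_cancel, character_zero]

lemma character_ne_zero (m : ℤ × ℤ) : S.character m ≠ 0 :=
  left_ne_zero_of_mul_eq_one (S.character_mul_neg m)

lemma character_neg (m : ℤ × ℤ) : S.character (-m) = (S.character m)⁻¹ :=
  eq_inv_of_mul_eq_one_right (S.character_mul_neg m)

/-- The order of characters at a point. -/
noncomputable def ordCharacter (c : S.X) : ℤ × ℤ →+ ℤ where
  toFun m := Scheme.ord (S.character m) c
  map_zero' := by rw [character_zero, ord_one]
  map_add' m m' := by
    rw [character_add, Scheme.ord_mul (S.character_ne_zero _) (S.character_ne_zero _)]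

lemma ord_character_of_notMem (i : ℤ) (P : affineToric k (S.fan.ray i) (S.fan.ray (i + 1)))
    (hP : Order.coheight (S.chart i P) = 1) {m : ℤ × ℤ}
    (hm : m ∈ dualMonoid (S.fan.ray i) (S.fan.ray (i + 1)))
    (h : monomial m hm ∉ pointIdeal P) : Scheme.ord (S.character m) (S.chart i P) = 0 := by
  rw [← S.chartToField_monomial i hm, ← algebraMap_chartGerm _ _ (Set.mem_range_self P)]
  exact ord_algebraMap_of_isUnit hP ((isUnit_chartGerm _ _ _).mpr h)

/-- The order of a character along an invariant curve. -/
lemma ord_character (m : ℤ × ℤ) (i : ℤ) :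
    Scheme.ord (S.character m) (S.divisor i).1 = pairing m (S.fan.ray i) := by
  have h := S.fan.det_pos i
  obtain ⟨e, he, he1⟩ := exists_pairing_eq_one h (S.fan.primitive i)
  have h1 : Scheme.ord (S.character e) (S.divisor i).1 = 1 := by
    rw [← S.chartToField_monomial i he]
    exact ord_chartToField_eq_one (S.chart i) (specPoint (faceIdeal (inCone_left _ _)))
      (monomial_ne_zero he) ((monomial_mem_faceIdeal _ he).mpr (by omega))
      (exists_mul_eq_of_mem_edge h he he1)
  have h2 : Scheme.ord (S.character (perp (S.fan.ray i))) (S.divisor i).1 = 0 := by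
    refine S.ord_character_of_notMem i _ (S.divisor i).2 (perp_mem h.le) ?_
    rw [pointIdeal_specPoint, monomial_mem_faceIdeal, pairing_perp, det_self]
    exact lt_irrefl _
  -- By additivity it suffices to know a local parameter e of order one and the character `perp`,
  -- which is invertible along the curve: together they span all characters.
  obtain ⟨c, hc⟩ := eq_smul_perp (m := m - pairing m (S.fan.ray i) • e) (S.fan.primitive i)
    (by rw [pairing_sub, pairing_smul, he1]; ring)
  have h3 : m = pairing m (S.fan.ray i) • e + c • perp (S.fan.ray i) := by rw [← hc]; abel
  have h4 : S.ordCharacter (S.divisor i).1 m = pairing m (S.fan.ray i) := by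
    conv_lhs => rw [h3]
    rw [map_add, map_zsmul, map_zsmul]
    change _ • Scheme.ord (S.character e) _ + _ • Scheme.ord (S.character _) _ = _
    rw [h1, h2]; simp
  exact h4

/-- Characters have neither zeros nor poles on the torus. -/
lemma ord_character_torus (m : ℤ × ℤ) {c : S.X} (hc : c ∈ Set.range S.torus)
    (h : Order.coheight c = 1) : Scheme.ord (S.character m) c = 0 := by
  rw [character, ← algebraMap_chartGerm S.torus c hc]
  refine ord_algebraMap_of_isUnit h (IsUnit.map _ ?_)
  refine IsUnit.of_mul_eq_one (AddMonoidAlgebra.single (-m) 1) ?_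
  simp [AddMonoidAlgebra.single_mul_single, AddMonoidAlgebra.one_def]

lemma ray_eq_of_divisor_eq {i j : ℤ} (h : S.divisor i = S.divisor j) :
    S.fan.ray i = S.fan.ray j := by
  have h1 : ∀ m, pairing m (S.fan.ray i) = pairing m (S.fan.ray j) := fun m => by
    rw [← ord_character, ← ord_character, h]
  have e1 := h1 (1, 0)
  have e2 := h1 (0, 1)
  simp only [pairing] at e1 e2
  exact Prod.ext (by linarith) (by linarith)

lemma divisor_eq_iff {i j : ℤ} : S.divisor i = S.divisor j ↔ (S.fan.n : ℤ) ∣ j - i :=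
  ⟨fun h => CompleteFan.dvd_of_ray_eq (S.ray_eq_of_divisor_eq h),
    fun h => S.divisor_congr (CompleteFan.ray_congr h).symm⟩

lemma chart_mem_range_torus (i : ℤ) (P : affineToric k (S.fan.ray i) (S.fan.ray (i + 1))) :
    S.chart i P ∈ Set.range S.torus ↔ P ∈ Set.range (torusInclusion k _ _) := by
  rw [← S.torusInclusion_chart i]
  constructor
  · rintro ⟨Q, hQ⟩
    rw [Scheme.Hom.comp_apply] at hQ
    exact ⟨Q, (S.chart i).isOpenEmbedding.injective hQ⟩
  · rintro ⟨Q, rfl⟩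
    exact ⟨Q, Scheme.Hom.comp_apply _ _ _⟩

/-- A point outside the torus lies on an invariant curve. -/
lemma divisor_specializes (i : ℤ) (P : affineToric k (S.fan.ray i) (S.fan.ray (i + 1)))
    (hP : S.chart i P ∉ Set.range S.torus) :
    (S.divisor i).1 ⤳ S.chart i P ∨ (S.divisor (i + 1)).1 ⤳ S.chart i P := by
  rw [chart_mem_range_torus] at hP
  have hsp : ∀ I : Ideal (ConeRing k (S.fan.ray i) (S.fan.ray (i + 1))), ∀ [I.IsPrime],
      I ≤ pointIdeal P → S.chart i (specPoint I) ⤳ S.chart i P := fun I _ hI =>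
    ((specializes_iff_pointIdeal_le _ _).mpr hI).map (S.chart i).continuous
  refine (faceIdeal_le_or_le (S.fan.det_pos i) P hP).imp (fun h => hsp _ h) fun h => ?_
  rw [S.divisor_eq_orbitPoint (i + 1) i (inCone_right _ _)]
  exact hsp _ h

lemma divisor_notMem_torus (i : ℤ) : (S.divisor i).1 ∉ Set.range S.torus := by
  intro h
  obtain ⟨e, -, he1⟩ := exists_pairing_eq_one (S.fan.det_pos i) (S.fan.primitive i)
  have h1 := S.ord_character_torus e h (S.divisor i).2
  rw [ord_character] at h1
  omega

/-- The invariant curves are those of the rays. -/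
lemma isInvariant_iff (c : PrimeDivisor S.X) : S.IsInvariant c ↔ ∃ i, c = S.divisor i := by
  constructor
  · intro hc
    obtain ⟨i, P, hP⟩ := S.covers c.1
    have hc' : S.chart i P ∉ Set.range S.torus := by rw [hP]; exact hc
    rcases S.divisor_specializes i P hc' with h | h
    · rw [hP] at h
      exact ⟨i, Subtype.ext (eq_of_specializes_of_coheight h (S.divisor i).2 c.2).symm⟩
    · rw [hP] at h
      exact ⟨i + 1, Subtype.ext (eq_of_specializes_of_coheight h (S.divisor _).2 c.2).symm⟩
  · rintro ⟨i, rfl⟩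
    exact S.divisor_notMem_torus i

lemma ray_of_divisor_mem_range {i j : ℤ} (h : (S.divisor j).1 ∈ Set.range (S.chart i)) :
    S.fan.ray j = S.fan.ray i ∨ S.fan.ray j = S.fan.ray (i + 1) := by
  obtain ⟨P, hP⟩ := h
  have hP' : S.chart i P ∉ Set.range S.torus := by rw [hP]; exact S.divisor_notMem_torus j
  rcases S.divisor_specializes i P hP' with h | h
  · rw [hP] at h
    exact Or.inl (S.ray_eq_of_divisor_eq
      (Subtype.ext (eq_of_specializes_of_coheight h (S.divisor i).2 (S.divisor j).2))).symm
  · rw [hP] at h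
    exact Or.inr (S.ray_eq_of_divisor_eq
      (Subtype.ext (eq_of_specializes_of_coheight h (S.divisor _).2 (S.divisor j).2))).symm

lemma mem_range_chart_of_specializes {i : ℤ} {x y : S.X} (h : x ⤳ y)
    (hy : y ∈ Set.range (S.chart i)) : x ∈ Set.range (S.chart i) :=
  h.mem_open (S.chart i).isOpenEmbedding.isOpen_range hy

lemma divisor_specializes_chart_iff (j i : ℤ)
    (P : affineToric k (S.fan.ray i) (S.fan.ray (i + 1))) :
    (S.divisor j).1 ⤳ S.chart i P ↔
      (S.fan.ray j = S.fan.ray i ∧ faceIdeal (inCone_left _ _) ≤ pointIdeal P) ∨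
      (S.fan.ray j = S.fan.ray (i + 1) ∧ faceIdeal (inCone_right _ _) ≤ pointIdeal P) := by
  have key : ∀ (I : Ideal (ConeRing k (S.fan.ray i) (S.fan.ray (i + 1)))) [I.IsPrime],
      S.chart i (specPoint I) ⤳ S.chart i P ↔ I ≤ pointIdeal P := fun I _ => by
    rw [(S.chart i).isOpenEmbedding.toIsEmbedding.toIsInducing.specializes_iff,
      specializes_iff_pointIdeal_le, pointIdeal_specPoint]
  have hl : (S.divisor i).1 ⤳ S.chart i P ↔ faceIdeal (inCone_left _ _) ≤ pointIdeal P := key _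
  have hr : (S.divisor (i + 1)).1 ⤳ S.chart i P ↔
      faceIdeal (inCone_right _ _) ≤ pointIdeal P := by
    rw [S.divisor_eq_orbitPoint (i + 1) i (inCone_right _ _)]
    exact key _
  constructor
  · intro h
    rcases S.ray_of_divisor_mem_range (S.mem_range_chart_of_specializes h ⟨P, rfl⟩) with h1 | h1
    · rw [S.divisor_congr h1] at h
      exact Or.inl ⟨h1, hl.mp h⟩
    · rw [S.divisor_congr h1] at h
      exact Or.inr ⟨h1, hr.mp h⟩
  · rintro (⟨h1, h2⟩ | ⟨h1, h2⟩)
    · rw [S.divisor_congr h1]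
      exact hl.mpr h2
    · rw [S.divisor_congr h1]
      exact hr.mpr h2

/-- S is of finite type over a field, hence Jacobson, so a closed point of an open chart is closed
in S. -/
lemma isClosed_chart_iff (i : ℤ) (P : affineToric k (S.fan.ray i) (S.fan.ray (i + 1))) :
    IsClosed {S.chart i P} ↔ (pointIdeal P).IsMaximal := by
  have : JacobsonSpace S.X := LocallyOfFiniteType.jacobsonSpace S.str
  have h1 := (S.chart i).isOpenEmbedding.preimage_closedPoints
  have h2 : IsClosed {S.chart i P} ↔ P ∈ (S.chart i) ⁻¹' closedPoints S.X := Iff.rfl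
  rw [h2, h1]
  exact PrimeSpectrum.isClosed_singleton_iff_isMaximal
    (R := ConeRing k (S.fan.ray i) (S.fan.ray (i + 1))) P

lemma inCone_add (i : ℤ) :
    InCone (S.fan.ray i + S.fan.ray (i + 1)) (S.fan.ray i) (S.fan.ray (i + 1)) :=
  inCone_add_self _ _

/-- The fixed point of the `i`-th cone. -/
noncomputable def fixedPoint (i : ℤ) : S.X := S.orbitPoint i (S.inCone_add i)

lemma isClosed_fixedPoint (i : ℤ) : IsClosed {S.fixedPoint i} :=
  (S.isClosed_chart_iff i _).mpr (isMaximal_faceIdeal_add (S.fan.det_pos i))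

lemma divisor_specializes_fixedPoint (i : ℤ) : (S.divisor i).1 ⤳ S.fixedPoint i :=
  (S.divisor_specializes_chart_iff i i _).mpr (Or.inl ⟨rfl, faceIdeal_left_le _ _⟩)

lemma divisor_succ_specializes_fixedPoint (i : ℤ) : (S.divisor (i + 1)).1 ⤳ S.fixedPoint i :=
  (S.divisor_specializes_chart_iff (i + 1) i _).mpr (Or.inr ⟨rfl, faceIdeal_right_le _ _⟩)

lemma eq_fixedPoint {i : ℤ} {P : affineToric k (S.fan.ray i) (S.fan.ray (i + 1))}
    (h : faceIdeal (inCone_left _ _) ≤ pointIdeal P)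
    (h' : faceIdeal (inCone_right _ _) ≤ pointIdeal P) : S.chart i P = S.fixedPoint i := by
  rw [fixedPoint, orbitPoint]
  congr 1
  apply pointIdeal_injective
  rw [pointIdeal_specPoint]
  exact ((isMaximal_faceIdeal_add (S.fan.det_pos i)).eq_of_le (Ideal.IsPrime.ne_top inferInstance)
    (faceIdeal_add_le h h')).symm

/-- Two invariant curves meet if and only if they are adjacent. -/
lemma meets_divisor_iff {i j : ℤ} (hij : ¬ (S.fan.n : ℤ) ∣ j - i) :
    Meets (S.divisor i) (S.divisor j) ↔
      (S.fan.n : ℤ) ∣ j - (i + 1) ∨ (S.fan.n : ℤ) ∣ i - (j + 1) := by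
  constructor
  · rintro ⟨p, h1, h2⟩
    obtain ⟨l, P, rfl⟩ := S.covers p
    rw [divisor_specializes_chart_iff] at h1 h2
    have key := fun a b => CompleteFan.dvd_of_ray_eq (F := S.fan) (i := a) (j := b)
    rcases h1 with ⟨h1, -⟩ | ⟨h1, -⟩ <;> rcases h2 with ⟨h2, -⟩ | ⟨h2, -⟩
    · exact absurd (key _ _ (h1.trans h2.symm)) hij
    · left
      have e1 := key _ _ h1
      have e2 := key _ _ h2
      have := dvd_sub e1 e2
      rwa [show l - i - (l + 1 - j) = j - (i + 1) by ring] at this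
    · right
      have e1 := key _ _ h1
      have e2 := key _ _ h2
      have := dvd_sub e2 e1
      rwa [show l - j - (l + 1 - i) = i - (j + 1) by ring] at this
    · exact absurd (key _ _ (h1.trans h2.symm)) hij
  · rintro (h | h)
    · refine ⟨S.fixedPoint i, S.divisor_specializes_fixedPoint i, ?_⟩
      rw [S.divisor_congr (CompleteFan.ray_congr h)]
      exact S.divisor_succ_specializes_fixedPoint i
    · refine ⟨S.fixedPoint j, ?_, S.divisor_specializes_fixedPoint j⟩
      rw [S.divisor_congr (CompleteFan.ray_congr h)]
      exact S.divisor_succ_specializes_fixedPoint j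

end ToricSurface

/-! ### Smooth toric surfaces -/

/-- The value at w can be changed by multiples of det v w without changing the value at v, by
subtracting multiples of `perp v`. -/
lemma exists_reduced_character {v w : ℤ × ℤ} (hv : IsCoprime v.1 v.2) (h : 0 < det v w) :
    ∃ e, pairing e v = 1 ∧ 0 ≤ pairing e w ∧ pairing e w < det v w := by
  obtain ⟨a, b, hab⟩ := hv
  have h1 : pairing (a, b) v = 1 := hab
  refine ⟨(a, b) - (pairing (a, b) w / det v w) • perp v, ?_, ?_, ?_⟩
  · rw [pairing_sub, pairing_smul, pairing_perp, det_self, h1]; ring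
  · rw [pairing_sub, pairing_smul, pairing_perp, mul_comm, ← Int.emod_def]
    exact Int.emod_nonneg _ h.ne'
  · rw [pairing_sub, pairing_smul, pairing_perp, mul_comm, ← Int.emod_def]
    exact Int.emod_lt_of_pos _ h

/-- Both summands must vanish on v, so they are nonnegative multiples of `perp v` with coefficients
adding up to 1. -/
lemma eq_zero_or_eq_zero_of_add_eq_perp {v w m m' : ℤ × ℤ} (hv : IsCoprime v.1 v.2)
    (h : 0 < det v w) (hm : m ∈ dualMonoid v w) (hm' : m' ∈ dualMonoid v w)
    (hadd : m + m' = perp v) : m = 0 ∨ m' = 0 := by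
  have h0 : pairing m v + pairing m' v = 0 := by
    rw [← pairing_add, hadd, pairing_perp, det_self]
  have h1 := hm.1
  have h2 := hm'.1
  obtain ⟨c, rfl⟩ := eq_smul_perp (m := m) hv (by omega)
  obtain ⟨c', rfl⟩ := eq_smul_perp (m := m') hv (by omega)
  have e1 := hm.2
  have e2 := hm'.2
  have e3 : pairing (c • perp v + c' • perp v) w = pairing (perp v) w := by rw [hadd]
  rw [pairing_add] at e3
  simp only [pairing_smul, pairing_perp] at e1 e2 e3
  have e4 : 0 ≤ c := nonneg_of_mul_nonneg_left e1 h
  have e5 : 0 ≤ c' := nonneg_of_mul_nonneg_left e2 h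
  have e6 : (c + c' - 1) * det v w = 0 := by linear_combination e3
  have e7 : c + c' - 1 = 0 := (mul_eq_zero.mp e6).resolve_right h.ne'
  rcases (show c = 0 ∨ c' = 0 by omega) with rfl | rfl <;> simp

lemma eq_zero_or_eq_zero_of_add_eq_neg_perp {v w m m' : ℤ × ℤ} (hw : IsCoprime w.1 w.2)
    (h : 0 < det v w) (hm : m ∈ dualMonoid v w) (hm' : m' ∈ dualMonoid v w)
    (hadd : m + m' = -perp w) : m = 0 ∨ m' = 0 := by
  have h0 : pairing m w + pairing m' w = 0 := by
    rw [← pairing_add, hadd, pairing_neg, pairing_perp, det_self, neg_zero]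
  have h1 := hm.2
  have h2 := hm'.2
  obtain ⟨c, rfl⟩ := eq_smul_perp (m := m) hw (by omega)
  obtain ⟨c', rfl⟩ := eq_smul_perp (m := m') hw (by omega)
  have e1 := hm.1
  have e2 := hm'.1
  have e3 : pairing (c • perp w + c' • perp w) v = pairing (-perp w) v := by rw [hadd]
  rw [pairing_add] at e3
  simp only [pairing_smul, pairing_perp, pairing_neg, det_swap w v] at e1 e2 e3
  have e4 : 0 ≤ -c := nonneg_of_mul_nonneg_left (a := -c) (by linarith : 0 ≤ -c * det v w) h
  have e5 : 0 ≤ -c' := nonneg_of_mul_nonneg_left (a := -c') (by linarith : 0 ≤ -c' * det v w) h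
  have e6 : (c + c' + 1) * det v w = 0 := by linear_combination -e3
  have e7 : c + c' + 1 = 0 := (mul_eq_zero.mp e6).resolve_right h.ne'
  rcases (show c = 0 ∨ c' = 0 by omega) with rfl | rfl <;> simp

/-- A formally smooth cone ring comes from a basis of the lattice. The truncated arc with
parameter `X` in both edges and none in the interior would not lift otherwise. -/
lemma det_eq_one_of_formallySmooth {k : Type u} [Field k] {v w : ℤ × ℤ} (hv : IsCoprime v.1 v.2)
    (hw : IsCoprime w.1 w.2) (h : 0 < det v w) [Algebra.FormallySmooth k (ConeRing k v w)] :
    det v w = 1 := by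
  by_contra hne
  obtain ⟨e, he1, he0, hed⟩ := exists_reduced_character hv h
  have heq : pairing e w ≠ 0 := fun h0 => by
    obtain ⟨c, rfl⟩ := eq_smul_perp hw h0
    rw [pairing_smul, pairing_perp, det_swap] at he1
    have : det v w ∣ 1 := ⟨-c, by linarith⟩
    have := Int.le_of_dvd one_pos this
    omega
  have hem : e ∈ dualMonoid v w := ⟨by omega, he0⟩
  have hx := perp_mem h.le
  have hz := neg_perp_mem h.le
  have hx0 : perp v ≠ 0 := fun h0 => by
    have := pairing_perp v w
    rw [h0, pairing_zero] at this; omega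
  have hz0 : -perp w ≠ 0 := fun h0 => by
    have : pairing (-perp w) v = det v w := by rw [pairing_neg, pairing_perp, det_swap]; ring
    rw [h0, pairing_zero] at this; omega
  have hex : e ≠ perp v := fun h0 => by rw [h0, pairing_perp, det_self] at he1; omega
  have hez : e ≠ -perp w := fun h0 => by
    apply heq; rw [h0, pairing_neg, pairing_perp, det_self, neg_zero]
  have he00 : e ≠ 0 := fun h0 => by rw [h0, pairing_zero] at he1; omega
  obtain ⟨q, hq⟩ := Int.eq_ofNat_of_zero_le he0
  obtain ⟨d, hd⟩ := Int.eq_ofNat_of_zero_le h.le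
  -- Here d = det v w and q is the value of e at w, with 0 < q < d.
  have hrel : d • e = -perp w + q • perp v := by
    refine eq_of_pairing_eq h.ne' ?_ ?_
    · rw [pairing_nsmul, pairing_add, pairing_nsmul, pairing_neg, pairing_perp, pairing_perp,
        det_self, det_swap w v, he1, hd]; ring
    · rw [pairing_nsmul, pairing_add, pairing_nsmul, pairing_neg, pairing_perp, pairing_perp,
        det_self, hq, hd]; ring
  have hrel' : monomial (k := k) e hem ^ d = monomial _ hz * monomial _ hx ^ q := by
    rw [monomial_pow, monomial_pow, monomial_mul]
    congr 1
  -- In k[t]/(t^(q+2)) the two sides of the monomial relation will lift to zero and to a unit times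
  -- t^(q+1).
  obtain ⟨B, _, _, t, ht, ht'⟩ : ∃ (B : Type u) (_ : CommRing B) (_ : Algebra k B) (t : B),
      t ^ (q + 2) = 0 ∧ t ^ (q + 1) ≠ 0 := by
    refine ⟨Polynomial k ⧸ Ideal.span {(Polynomial.X : Polynomial k) ^ (q + 2)}, inferInstance,
      inferInstance, Ideal.Quotient.mk _ Polynomial.X, ?_, fun h0 => ?_⟩
    · rw [← map_pow]
      exact Ideal.Quotient.eq_zero_iff_mem.mpr (Ideal.mem_span_singleton_self _)
    · rw [← map_pow, Ideal.Quotient.eq_zero_iff_mem, Ideal.mem_span_singleton] at h0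
      refine absurd h0 (Polynomial.not_dvd_of_degree_lt (pow_ne_zero _ Polynomial.X_ne_zero) ?_)
      rw [Polynomial.degree_X_pow, Polynomial.degree_X_pow]
      exact_mod_cast Nat.lt_succ_self _
  let I : Ideal B := Ideal.span {t ^ 2}
  have hI : IsNilpotent I := ⟨q + 2, by
    rw [Ideal.span_singleton_pow, ← pow_mul, mul_comm, pow_mul, ht, zero_pow two_ne_zero]
    simp⟩
  let ε : B ⧸ I := Ideal.Quotient.mk I t
  have hε : ε * ε = 0 := by
    rw [← map_mul, ← sq]
    exact Ideal.Quotient.eq_zero_iff_mem.mpr (Ideal.mem_span_singleton_self _)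
  classical
  -- The tangent vector that is ε on the two edge generators and zero on all other nonzero
  -- characters. It is multiplicative because the edge generators are indecomposable and ε has
  -- square zero.
  let g : ConeRing k v w →ₐ[k] B ⧸ I := AddMonoidAlgebra.lift k (B ⧸ I) (dualMonoid v w)
    { toFun := fun m => if m.toAdd.1 = 0 then 1 else
        if m.toAdd.1 = perp v ∨ m.toAdd.1 = -perp w then ε else 0
      map_one' := by simp
      map_mul' := fun m m' => by
        simp only [toAdd_mul, AddSubmonoid.coe_add]
        by_cases hm0 : m.toAdd.1 = 0
        · simp only [hm0, zero_add, if_true, one_mul]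
        by_cases hm0' : m'.toAdd.1 = 0
        · simp only [hm0', add_zero, if_true, mul_one]
        have h1 : m.toAdd.1 + m'.toAdd.1 ≠ perp v := fun hh =>
          (eq_zero_or_eq_zero_of_add_eq_perp hv h m.toAdd.2 m'.toAdd.2 hh).elim hm0 hm0'
        have h2 : m.toAdd.1 + m'.toAdd.1 ≠ -perp w := fun hh =>
          (eq_zero_or_eq_zero_of_add_eq_neg_perp hw h m.toAdd.2 m'.toAdd.2 hh).elim hm0 hm0'
        have h3 : m.toAdd.1 + m'.toAdd.1 ≠ 0 := fun hh => by
          apply hm0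
          have e1 := m.toAdd.2.1
          have e2 := m.toAdd.2.2
          have e1' := m'.toAdd.2.1
          have e2' := m'.toAdd.2.2
          have f1 : pairing (m.toAdd.1 + m'.toAdd.1) v = 0 := by rw [hh, pairing_zero]
          have f2 : pairing (m.toAdd.1 + m'.toAdd.1) w = 0 := by rw [hh, pairing_zero]
          rw [pairing_add] at f1 f2
          exact eq_of_pairing_eq h.ne' (by rw [pairing_zero]; omega) (by rw [pairing_zero]; omega)
        rw [if_neg h3, if_neg (by tauto), if_neg hm0, if_neg hm0']
        split_ifs <;> simp only [hε, mul_zero, zero_mul] }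
  have hg : ∀ m (hm : m ∈ dualMonoid v w), g (monomial m hm) = if m = 0 then 1 else
      if m = perp v ∨ m = -perp w then ε else 0 := fun m hm => by
    simp only [g, monomial, AddMonoidAlgebra.lift_single, one_smul]
    rfl
  obtain ⟨f, hf⟩ := Algebra.FormallySmooth.exists_lift I hI g
  have hf' : ∀ a, Ideal.Quotient.mk I (f a) = g a := fun a => AlgHom.congr_fun hf a
  have lift : ∀ a (b : B), g a = Ideal.Quotient.mk I b → ∃ c, f a = b + t ^ 2 * c := by
    intro a b hab
    rw [← hf', Ideal.Quotient.eq, Ideal.mem_span_singleton] at hab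
    obtain ⟨c, hc⟩ := hab
    exact ⟨c, by rw [← hc]; ring⟩
  obtain ⟨b1, hb1⟩ := lift (monomial _ hx) t (by rw [hg, if_neg hx0, if_pos (Or.inl rfl)])
  obtain ⟨b2, hb2⟩ := lift (monomial _ hz) t (by rw [hg, if_neg hz0, if_pos (Or.inr rfl)])
  obtain ⟨b3, hb3⟩ := lift (monomial _ hem) 0 (by rw [hg, if_neg he00, if_neg (by tauto), map_zero])
  have key := congrArg f hrel'
  rw [map_pow, map_mul, map_pow, hb1, hb2, hb3] at key
  have hunit : ∀ b, IsUnit (1 + t * b) := fun b =>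
    IsNilpotent.isUnit_one_add ⟨q + 2, by rw [mul_pow, ht, zero_mul]⟩
  have hzero : t ^ (q + 1) * ((1 + t * b2) * (1 + t * b1) ^ q) = 0 := by
    have e1 : t ^ (q + 1) * ((1 + t * b2) * (1 + t * b1) ^ q) =
        (t + t ^ 2 * b2) * (t + t ^ 2 * b1) ^ q := by
      rw [show t + t ^ 2 * b1 = t * (1 + t * b1) by ring, mul_pow]; ring
    -- From q < d it follows that 2d ≥ q + 2, so the lift of e, a multiple of t^2, has d-th power
    -- zero.
    have e2 : 2 * d = (q + 2) + (2 * d - (q + 2)) := by omega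
    rw [e1, ← key, zero_add, mul_pow, ← pow_mul, e2, pow_add, ht, zero_mul, zero_mul]
  exact ht' (((hunit b2).mul ((hunit b1).pow q)).mul_left_eq_zero.mp hzero)

lemma ToricSurface.det_eq_one {k : Type u} [Field k] (S : ToricSurface k) (hS : Smooth S.str)
    (i : ℤ) : det (S.fan.ray i) (S.fan.ray (i + 1)) = 1 := by
  have h1 : Smooth (S.chart i ≫ S.str) := inferInstance
  rw [S.chart_str, HasRingHomProperty.Spec_iff (P := @Smooth)] at h1
  have h2 : Algebra.Smooth k (ConeRing k (S.fan.ray i) (S.fan.ray (i + 1))) := by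
    have h3 : (algebraMap k (ConeRing k (S.fan.ray i) (S.fan.ray (i + 1)))).Smooth := h1
    rwa [RingHom.smooth_algebraMap] at h3
  exact det_eq_one_of_formallySmooth (k := k) (S.fan.primitive i) (S.fan.primitive (i + 1))
    (S.fan.det_pos i)

/-! ### Rational functions on the torus and the Picard number -/

section Laurent

variable {k : Type u} [Field k]

/-- Units of the Laurent polynomial ring are multiples of characters. -/
lemma exists_eq_single_of_isUnit {f : LaurentRing k} (hf : IsUnit f) :
    ∃ (m : ℤ × ℤ) (c : k), c ≠ 0 ∧ f = AddMonoidAlgebra.single m c := by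
  obtain ⟨g, hg⟩ := hf.exists_right_inv
  have hf0 : f.coeff.support.Nonempty := by
    rw [Finsupp.support_nonempty_iff]
    exact fun h => hf.ne_zero (AddMonoidAlgebra.coeff_injective h)
  have hg0 : g.coeff.support.Nonempty := by
    rw [Finsupp.support_nonempty_iff]
    intro h
    rw [show g = 0 from AddMonoidAlgebra.coeff_injective h, mul_zero] at hg
    exact zero_ne_one hg
  have hcard : f.coeff.support.card * g.coeff.support.card ≤ 1 := by
    by_contra! hlt
    -- Unless both supports are singletons, two different pairs of exponents have sums attained only
    -- once. As the product is 1, both sums must be 0, against uniqueness.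
    obtain ⟨p, hp, q, hq, hpq, h1, h2⟩ := TwoUniqueSums.uniqueAdd_of_one_lt_card hlt
    rw [Finset.mem_product] at hp hq
    have key : ∀ r : (ℤ × ℤ) × (ℤ × ℤ), r.1 ∈ f.coeff.support → r.2 ∈ g.coeff.support →
        UniqueAdd f.coeff.support g.coeff.support r.1 r.2 → r.1 + r.2 = 0 := by
      intro r hr hr' h
      have h3 := AddMonoidAlgebra.coeff_mul_add_of_uniqueAdd h
      rw [hg, AddMonoidAlgebra.one_def] at h3
      by_contra hne
      rw [AddMonoidAlgebra.coeff_single, Finsupp.single_eq_of_ne hne] at h3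
      exact mul_ne_zero (Finsupp.mem_support_iff.mp hr) (Finsupp.mem_support_iff.mp hr') h3.symm
    have e := h1 hq.1 hq.2 (by rw [key p hp.1 hp.2 h1, key q hq.1 hq.2 h2])
    exact hpq (Prod.ext e.1.symm e.2.symm)
  have h1 : f.coeff.support.card = 1 := by
    have := hf0.card_pos
    have := hg0.card_pos
    nlinarith
  obtain ⟨m, hm⟩ := Finset.card_eq_one.mp h1
  obtain ⟨c, hc⟩ := Finsupp.support_subset_singleton'.mp hm.subset
  refine ⟨m, c, fun h0 => hf.ne_zero (AddMonoidAlgebra.coeff_injective ?_),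
    AddMonoidAlgebra.coeff_injective ?_⟩
  · rw [hc, h0, Finsupp.single_zero]; rfl
  · rw [hc, AddMonoidAlgebra.coeff_single]

/-- The monoid of the standard cone. -/
noncomputable def standardMonoidEquiv : (Fin 2 →₀ ℕ) ≃+ dualMonoid (1, 0) (0, 1) where
  toFun s := ⟨(s 0, s 1), by constructor <;> simp [pairing]⟩
  invFun m := Finsupp.equivFunOnFinite.symm ![m.1.1.toNat, m.1.2.toNat]
  left_inv s := by
    ext i
    fin_cases i <;> simp
  right_inv m := by
    have h1 := m.2.1
    have h2 := m.2.2
    simp only [pairing] at h1 h2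
    apply Subtype.ext
    ext <;> simp <;> omega
  map_add' s t := by
    apply Subtype.ext
    simp

/-- The ring of the standard cone is a polynomial ring in two variables, and the Laurent ring is a
localization of it. -/
instance : UniqueFactorizationMonoid (LaurentRing k) := by
  have h1 : UniqueFactorizationMonoid (MvPolynomial (Fin 2) k) := inferInstance
  have h2 : UniqueFactorizationMonoid (ConeRing k (1, 0) (0, 1)) :=
    (AddMonoidAlgebra.domCongr k k standardMonoidEquiv).toMulEquiv.uniqueFactorizationMonoid h1
  have h : (0 : ℤ) < det (1, 0) (0, 1) := by decide
  let _ := (toLaurent k (1, 0) (0, 1)).toAlgebra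
  have := isLocalization_toLaurent (k := k) (interior_mem h.le)
    (by rwa [pairing_interior_left]) (by rwa [pairing_interior_right])
  exact UniqueFactorizationMonoid.of_isLocalization
    (Submonoid.powers (monomial (k := k) _ (interior_mem h.le))) _

end Laurent

namespace ToricSurface

variable {k : Type u} [Field k] (S : ToricSurface k)

/-- An irreducible factor of the numerator defines a curve on the torus. The fraction has positive
order there, since by coprimality the denominator does not vanish along it. -/
lemma isUnit_of_ord_eq_zero {a b : LaurentRing k} (hab : IsRelPrime a b) (ha : a ≠ 0)
    (hb : b ≠ 0) (h : ∀ c ∈ Set.range S.torus, Order.coheight c = 1 →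
      Scheme.ord (chartToField S.torus a / chartToField S.torus b) c = 0) : IsUnit a := by
  by_contra hu
  obtain ⟨p, hp, q, rfl⟩ := WfDvdMonoid.exists_irreducible_factor hu ha
  have hpr : Prime p := hp.prime
  have := (Ideal.span_singleton_prime hp.ne_zero).mpr hpr
  have hloc : ∀ a ∈ pointIdeal (specPoint (Ideal.span {p})),
      ∃ s ∉ pointIdeal (specPoint (Ideal.span {p})), ∃ b, s * a = b * p := fun a ha => by
    obtain ⟨b, rfl⟩ := Ideal.mem_span_singleton'.mp ha
    exact ⟨1, (Ideal.ne_top_iff_one _).mp (Ideal.IsPrime.ne_top inferInstance), b, one_mul _⟩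
  have hmem : p ∈ pointIdeal (specPoint (Ideal.span {p})) := Ideal.mem_span_singleton_self p
  have hco := coheight_eq_one_of_principal S.torus (specPoint (Ideal.span {p})) hp.ne_zero hmem hloc
  have hord := ord_chartToField_eq_one S.torus (specPoint (Ideal.span {p})) hp.ne_zero hmem hloc
  have h0 := h _ ⟨specPoint (Ideal.span {p}), rfl⟩ hco
  have hne : ∀ x : LaurentRing k, x ≠ 0 → chartToField S.torus x ≠ 0 := fun x hx =>
    (map_ne_zero_iff _ (chartToField_injective S.torus)).mpr hx
  have hb' : Scheme.ord (chartToField S.torus b) (S.torus (specPoint (Ideal.span {p}))) = 0 := by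
    rw [← algebraMap_chartGerm S.torus _ (Set.mem_range_self _)]
    refine ord_algebraMap_of_isUnit hco ((isUnit_chartGerm _ _ _).mpr fun hbm => ?_)
    rw [pointIdeal_specPoint, Ideal.mem_span_singleton] at hbm
    exact hp.not_isUnit (hab (dvd_mul_right _ _) hbm)
  have hq' : 0 ≤ Scheme.ord (chartToField S.torus q) (S.torus (specPoint (Ideal.span {p}))) := by
    rw [← algebraMap_chartGerm S.torus _ (Set.mem_range_self _)]
    exact ord_algebraMap_nonneg hco
  rw [div_eq_mul_inv, Scheme.ord_mul (hne _ ha) (inv_ne_zero (hne _ hb)), ord_inv _ (hne _ hb), hb',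
    map_mul, Scheme.ord_mul (hne _ hp.ne_zero) (hne _ (right_ne_zero_of_mul ha)), hord] at h0
  omega

/-- A rational function without zeros and poles on the torus has the divisor of a character. -/
lemma exists_ord_eq_pairing {f : S.X.functionField} (hf : f ≠ 0)
    (h : ∀ c ∈ Set.range S.torus, Order.coheight c = 1 → Scheme.ord f c = 0) :
    ∃ m : ℤ × ℤ, ∀ i, Scheme.ord f (S.divisor i).1 = pairing m (S.fan.ray i) := by
  obtain ⟨a, s, hs, rfl⟩ := chartToField_surj S.torus f
  have ha : a ≠ 0 := fun h0 => hf (by simp [h0])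
  -- In lowest terms both numerator and denominator are units, hence constant multiples of
  -- characters; nonzero constants have order zero.
  obtain ⟨a', s', c, hrel, rfl, rfl⟩ := UniqueFactorizationMonoid.exists_reduced_factors a ha s
  have hne : ∀ x : LaurentRing k, x ≠ 0 → chartToField S.torus x ≠ 0 := fun x hx =>
    (map_ne_zero_iff _ (chartToField_injective S.torus)).mpr hx
  have hc := left_ne_zero_of_mul ha
  have ha' := right_ne_zero_of_mul ha
  have hs' := right_ne_zero_of_mul hs
  rw [map_mul, map_mul, mul_div_mul_left _ _ (hne c hc)] at h ⊢
  have hua := S.isUnit_of_ord_eq_zero hrel ha' hs' h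
  have hus := S.isUnit_of_ord_eq_zero hrel.symm hs' ha' fun x hx hco => by
    rw [← inv_div, ord_inv _ (div_ne_zero (hne _ ha') (hne _ hs')), h x hx hco, neg_zero]
  obtain ⟨m, r, hr, rfl⟩ := exists_eq_single_of_isUnit hua
  obtain ⟨m', r', hr', rfl⟩ := exists_eq_single_of_isUnit hus
  have hconst : ∀ (m : ℤ × ℤ) (r : k), r ≠ 0 → ∀ i, Scheme.ord
      (chartToField S.torus (AddMonoidAlgebra.single m r)) (S.divisor i).1 =
        pairing m (S.fan.ray i) := by
    intro m r hr i
    have h1 : (AddMonoidAlgebra.single m r : LaurentRing k) =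
        toLaurent k _ _ (algebraMap k (ConeRing k (S.fan.ray i) (S.fan.ray (i + 1))) r) *
        AddMonoidAlgebra.single m 1 := by
      simp [AddMonoidAlgebra.single_mul_single]
    have h2 : IsUnit (algebraMap k (ConeRing k (S.fan.ray i) (S.fan.ray (i + 1))) r) :=
      (IsUnit.mk0 r hr).map _
    have h3 : Scheme.ord (chartToField (S.chart i) (algebraMap k (ConeRing k (S.fan.ray i)
        (S.fan.ray (i + 1))) r)) (S.divisor i).1 = 0 := by
      rw [← algebraMap_chartGerm (S.chart i) (S.divisor i).1 ⟨_, rfl⟩]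
      exact ord_algebraMap_of_isUnit (S.divisor i).2 (h2.map _)
    rw [chartToField_chart] at h3
    rw [h1, map_mul, show chartToField S.torus (AddMonoidAlgebra.single m 1) = S.character m from rfl,
      Scheme.ord_mul _ (S.character_ne_zero m), h3, zero_add]
    · exact S.ord_character m i
    · rw [← chartToField_chart]
      exact (map_ne_zero_iff _ (chartToField_injective _)).mpr h2.ne_zero
  refine ⟨m - m', fun i => ?_⟩
  rw [div_eq_mul_inv, Scheme.ord_mul (hne _ ha') (inv_ne_zero (hne _ hs')), ord_inv _ (hne _ hs'),
    hconst m r hr, hconst m' r' hr', pairing_sub]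
  ring

/-- A multiple of the index of the adjacent cones is a Cartier multiple of an invariant curve. -/
lemma single_divisor_mem_cartierDivisors (j : ℤ) :
    Finsupp.single (S.divisor j) (det (S.fan.ray (j - 1)) (S.fan.ray j) *
      det (S.fan.ray j) (S.fan.ray (j + 1))) ∈ cartierDivisors S.X := by
  classical
  intro x
  obtain ⟨i, P, rfl⟩ := S.covers x
  have key : ∀ m : ℤ × ℤ, (∀ l, S.fan.ray l = S.fan.ray i ∨ S.fan.ray l = S.fan.ray (i + 1) →
      pairing m (S.fan.ray l) = if S.fan.ray l = S.fan.ray j then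
        det (S.fan.ray (j - 1)) (S.fan.ray j) * det (S.fan.ray j) (S.fan.ray (j + 1)) else 0) →
      ∀ c : PrimeDivisor S.X, c.1 ⤳ S.chart i P → Scheme.ord (S.character m) c.1 =
        Finsupp.single (S.divisor j) (det (S.fan.ray (j - 1)) (S.fan.ray j) *
          det (S.fan.ray j) (S.fan.ray (j + 1))) c := by
    intro m hm c hc
    by_cases hinv : S.IsInvariant c
    · obtain ⟨l, rfl⟩ := (S.isInvariant_iff c).mp hinv
      have hl := (S.divisor_specializes_chart_iff l i P).mp hc
      rw [ord_character, hm l (hl.imp And.left And.left), Finsupp.single_apply]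
      refine if_congr ⟨fun h => (S.divisor_congr h).symm, fun h => ?_⟩ rfl rfl
      exact (S.ray_eq_of_divisor_eq h).symm
    · have h1 : S.divisor j ≠ c := fun h => hinv (h ▸ S.divisor_notMem_torus j)
      rw [Finsupp.single_eq_of_ne' h1]
      exact S.ord_character_torus m (by simpa [IsInvariant] using hinv) c.2
  have hne : S.fan.ray i ≠ S.fan.ray (i + 1) := fun h => by
    have := S.fan.det_pos i
    rw [← h, det_self] at this
    exact lt_irrefl _ this
  have hd := S.fan.det_pos i
  by_cases h1 : S.fan.ray j = S.fan.ray i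
  -- The local equation vanishes on the other edge of the cone. Its determinant factor makes its
  -- value on v_j equal to the prescribed product, in either adjacent cone.
  · refine ⟨_, S.character_ne_zero (-(det (S.fan.ray (j - 1)) (S.fan.ray j)) •
      perp (S.fan.ray (i + 1))), key _ fun l hl => ?_⟩
    have h2 : S.fan.ray (j + 1) = S.fan.ray (i + 1) :=
      CompleteFan.ray_succ_congr (CompleteFan.dvd_of_ray_eq h1.symm)
    rw [pairing_smul, pairing_perp]
    rcases hl with hl | hl
    · rw [if_pos (hl.trans h1.symm), hl, det_swap (S.fan.ray (i + 1)), h1, h2]; ring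
    · rw [if_neg (by rw [hl, h1]; exact hne.symm), hl, det_self, mul_zero]
  by_cases h2 : S.fan.ray j = S.fan.ray (i + 1)
  · refine ⟨_, S.character_ne_zero (det (S.fan.ray j) (S.fan.ray (j + 1)) •
      perp (S.fan.ray i)), key _ fun l hl => ?_⟩
    have h3 : S.fan.ray (j - 1) = S.fan.ray i := by
      have h4 := CompleteFan.dvd_of_ray_eq h2.symm
      exact CompleteFan.ray_congr (by rwa [show j - 1 - i = j - (i + 1) by ring])
    rw [pairing_smul, pairing_perp]
    rcases hl with hl | hl
    · rw [if_neg (by rw [hl]; exact fun h => h1 h.symm), hl, det_self, mul_zero]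
    · rw [if_pos (hl.trans h2.symm), hl, h3, h2]; ring
  · refine ⟨_, S.character_ne_zero 0, key _ fun l hl => ?_⟩
    rw [pairing_zero, if_neg]
    rcases hl with hl | hl
    · rw [hl]; exact fun h => h1 h.symm
    · rw [hl]; exact fun h => h2 h.symm

/-- With at least four rays, Cartier multiples of the curves of v_0 and v_1 are independent: a
relation would be the divisor of a character vanishing on v_2 and v_3, and these are independent
vectors. -/
theorem n_eq_three_of_picardNumber (h : picardNumber S.X = 1) : S.fan.n = 3 := by
  classical
  by_contra hn
  have hn4 : 4 ≤ S.fan.n := by have := CompleteFan.three_le (F := S.fan); omega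
  have hrank : Module.rank ℤ (PicardGroup S.X) = 1 := Module.rank_eq_one_iff_finrank_eq_one.mpr h
  let N : ℤ → ℤ := fun j => det (S.fan.ray (j - 1)) (S.fan.ray j) *
    det (S.fan.ray j) (S.fan.ray (j + 1))
  have hN : ∀ j, N j ≠ 0 := fun j => by
    have h1 := S.fan.det_pos (j - 1)
    rw [sub_add_cancel] at h1
    exact (mul_pos h1 (S.fan.det_pos j)).ne'
  let E : ℤ → PicardGroup S.X := fun j =>
    QuotientAddGroup.mk ⟨Finsupp.single (S.divisor j) (N j), S.single_divisor_mem_cartierDivisors j⟩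
  have hne : ∀ i j : ℤ, i < j → j < i + S.fan.n → S.divisor i ≠ S.divisor j := fun i j h1 h2 h3 =>
    CompleteFan.not_dvd_of_lt h1 h2 (S.divisor_eq_iff.mp h3)
  have hind : LinearIndependent ℤ ![E 0, E 1] := by
    rw [LinearIndependent.pair_iff]
    intro s t hst
    have hmem : s • (⟨_, S.single_divisor_mem_cartierDivisors 0⟩ : cartierDivisors S.X) +
        t • (⟨_, S.single_divisor_mem_cartierDivisors 1⟩ : cartierDivisors S.X) ∈
        (principalDivisors S.X).addSubgroupOf (cartierDivisors S.X) :=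
      (QuotientAddGroup.eq_zero_iff _).mp hst
    rw [AddSubgroup.mem_addSubgroupOf] at hmem
    obtain ⟨f, hf, hfD⟩ := hmem
    have hfD' : ∀ c, Scheme.ord f c.1 = s * Finsupp.single (S.divisor 0) (N 0) c +
        t * Finsupp.single (S.divisor 1) (N 1) c := fun c => by
      rw [hfD c]; simp [N]
    obtain ⟨m, hm⟩ := S.exists_ord_eq_pairing hf fun c hc hco => by
      have h0 : ∀ j, S.divisor j ≠ ⟨c, hco⟩ := fun j hj =>
        S.divisor_notMem_torus j (by rw [hj]; exact hc)
      have := hfD' ⟨c, hco⟩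
      rw [Finsupp.single_eq_of_ne' (h0 0), Finsupp.single_eq_of_ne' (h0 1)] at this
      simpa using this
    have hz : ∀ j : ℤ, 1 < j → j < 4 → pairing m (S.fan.ray j) = 0 := fun j h1 h2 => by
      rw [← hm, hfD', Finsupp.single_eq_of_ne' (hne 0 j (by omega) (by omega)),
        Finsupp.single_eq_of_ne' (hne 1 j (by omega) (by omega))]
      ring
    have hm0 : m = 0 := eq_of_pairing_eq (S.fan.det_pos 2).ne'
      (by rw [pairing_zero]; exact hz 2 (by norm_num) (by norm_num))
      (by rw [pairing_zero]; exact hz 3 (by norm_num) (by norm_num))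
    have e0 := hfD' (S.divisor 0)
    have e1 := hfD' (S.divisor 1)
    have h01 := hne 0 1 (by norm_num) (by omega)
    rw [hm, hm0, pairing_zero, Finsupp.single_eq_same, Finsupp.single_eq_of_ne h01] at e0
    rw [hm, hm0, pairing_zero, Finsupp.single_eq_same, Finsupp.single_eq_of_ne' h01] at e1
    constructor
    · have : s * N 0 = 0 := by linarith
      exact (mul_eq_zero.mp this).resolve_right (hN 0)
    · have : t * N 1 = 0 := by linarith
      exact (mul_eq_zero.mp this).resolve_right (hN 1)
  have := hind.cardinal_lift_le_rank
  rw [hrank] at this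
  simp at this

end ToricSurface

/-! ### Local rings of curves -/

section Curve

instance {X : Scheme.{u}} {c p : X} (h : c ⤳ p) :
    IsLocalRing (X.presheaf.stalk p ⧸ curveIdeal h) :=
  IsLocalRing.of_surjective' _ Ideal.Quotient.mk_surjective

/-- The length over the surface's local ring equals the length over its quotient, the local ring of
the curve, so the theory of `Ring.ord` applies. -/
lemma curveLength_eq {X : Scheme.{u}} {c p : X} (h : c ⤳ p) (a : X.presheaf.stalk p) :
    curveLength h a = (Ring.ord (X.presheaf.stalk p ⧸ curveIdeal h)
      (Ideal.Quotient.mk (curveIdeal h) a)).toNat := by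
  rw [curveLength, Ring.ord]
  have h1 : (Ideal.span {a}).map (Ideal.Quotient.mk (curveIdeal h)) =
      Ideal.span {Ideal.Quotient.mk (curveIdeal h) a} := by
    rw [Ideal.map_span, Set.image_singleton]
  rw [← h1, ← Module.length_eq_of_surjective (S := X.presheaf.stalk p)
    (R := X.presheaf.stalk p ⧸ curveIdeal h) Ideal.Quotient.mk_surjective]
  congr 1
  exact ((DoubleQuot.quotQuotEquivQuotSupₐ (X.presheaf.stalk p) (curveIdeal h)
    (Ideal.span {a})).toLinearEquiv.length_eq).symm

variable {X : Scheme.{u}} {A : Type u} [CommRing A]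
  (ι : Spec (CommRingCat.of A) ⟶ X) [IsOpenImmersion ι]

lemma chartGerm_mem_curveIdeal {P Q : Spec (CommRingCat.of A)} (h : ι P ⤳ ι Q) (a : A) :
    chartGerm ι (ι Q) (Set.mem_range_self Q) a ∈ curveIdeal h ↔ a ∈ pointIdeal P := by
  rw [curveIdeal, Ideal.mem_comap, stalkSpecializes_chartGerm ι h (Set.mem_range_self P)
    (Set.mem_range_self Q), chartGerm_mem_maximalIdeal]

lemma curveIdeal_eq_map {P Q : Spec (CommRingCat.of A)} (h : ι P ⤳ ι Q) :
    curveIdeal h = (pointIdeal P).map (chartGerm ι (ι Q) (Set.mem_range_self Q)) := by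
  apply le_antisymm
  · intro z hz
    obtain ⟨a, s, hs, h1⟩ := chartGerm_surj ι Q z
    have ha : a ∈ pointIdeal P := by
      rw [← chartGerm_mem_curveIdeal ι h, ← h1]
      exact Ideal.mul_mem_right _ _ hz
    rw [← Ideal.mul_unit_mem_iff_mem _ ((isUnit_chartGerm ι Q s).mpr hs), h1]
    exact Ideal.mem_map_of_mem _ ha
  · rw [Ideal.map_le_iff_le_comap]
    exact fun a ha => (chartGerm_mem_curveIdeal ι h a).mpr ha

variable {P Q : Spec (CommRingCat.of A)} (h : ι P ⤳ ι Q) {q : A} (hq : q ∈ pointIdeal Q)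
  (hqP : q ∉ pointIdeal P) (hPQ : pointIdeal Q ≤ pointIdeal P ⊔ Ideal.span {q})

include hq hPQ in
lemma maximalIdeal_curve_eq_span :
    IsLocalRing.maximalIdeal (X.presheaf.stalk (ι Q) ⧸ curveIdeal h) =
      Ideal.span {Ideal.Quotient.mk (curveIdeal h)
        (chartGerm ι (ι Q) (Set.mem_range_self Q) q)} := by
  have hmem : ∀ z : X.presheaf.stalk (ι Q), Ideal.Quotient.mk (curveIdeal h) z ∈
      IsLocalRing.maximalIdeal (X.presheaf.stalk (ι Q) ⧸ curveIdeal h) ↔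
      z ∈ IsLocalRing.maximalIdeal (X.presheaf.stalk (ι Q)) := fun z => by
    rw [← Ideal.mem_comap, ((IsLocalRing.local_hom_TFAE (Ideal.Quotient.mk (curveIdeal h))).out
      0 4 rfl rfl).mp (IsLocalHom.of_surjective _ Ideal.Quotient.mk_surjective)]
  apply le_antisymm
  · intro z hz
    obtain ⟨z, rfl⟩ := Ideal.Quotient.mk_surjective z
    rw [hmem] at hz
    obtain ⟨a, s, hs, h1⟩ := chartGerm_surj ι Q z
    have ha : a ∈ pointIdeal Q := by
      rw [← chartGerm_mem_maximalIdeal ι, ← h1]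
      exact Ideal.mul_mem_right _ _ hz
    obtain ⟨b, hb, c, hc, rfl⟩ := Submodule.mem_sup.mp (hPQ ha)
    obtain ⟨d, rfl⟩ := Ideal.mem_span_singleton'.mp hc
    have hu := ((isUnit_chartGerm ι Q s).mpr hs).map (Ideal.Quotient.mk (curveIdeal h))
    rw [← Ideal.mul_unit_mem_iff_mem _ hu, ← map_mul, h1, map_add, map_add,
      Ideal.Quotient.eq_zero_iff_mem.mpr ((chartGerm_mem_curveIdeal ι h b).mpr hb), zero_add,
      map_mul, map_mul]
    exact Ideal.mul_mem_left _ _ (Ideal.mem_span_singleton_self _)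
  · rw [Ideal.span_singleton_le_iff_mem, hmem, chartGerm_mem_maximalIdeal]
    exact hq

variable [IsLocallyNoetherian X]
include hq hqP hPQ

lemma isDiscreteValuationRing_curve :
    IsDiscreteValuationRing (X.presheaf.stalk (ι Q) ⧸ curveIdeal h) := by
  have hmax := maximalIdeal_curve_eq_span ι h hq hPQ
  have hne : IsLocalRing.maximalIdeal (X.presheaf.stalk (ι Q) ⧸ curveIdeal h) ≠ ⊥ := by
    rw [hmax, Ne, Ideal.span_singleton_eq_bot, Ideal.Quotient.eq_zero_iff_mem,
      chartGerm_mem_curveIdeal]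
    exact hqP
  have hf : ¬ IsField (X.presheaf.stalk (ι Q) ⧸ curveIdeal h) := fun h =>
    hne (IsLocalRing.isField_iff_maximalIdeal_eq.mp h)
  have hpr : (IsLocalRing.maximalIdeal (X.presheaf.stalk (ι Q) ⧸ curveIdeal h)).IsPrincipal :=
    ⟨⟨_, hmax⟩⟩
  exact ((IsDiscreteValuationRing.TFAE _ hf).out 4 0).mp hpr

lemma curveLength_chartGerm_pow (n : ℕ) :
    curveLength h (chartGerm ι (ι Q) (Set.mem_range_self Q) q ^ n) = n := by
  have := isDiscreteValuationRing_curve ι h hq hqP hPQ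
  have hirr : Irreducible (Ideal.Quotient.mk (curveIdeal h)
      (chartGerm ι (ι Q) (Set.mem_range_self Q) q)) :=
    (IsDiscreteValuationRing.irreducible_iff_uniformizer _).mpr
      (maximalIdeal_curve_eq_span ι h hq hPQ)
  rw [curveLength_eq, map_pow, Ring.ord_pow (mem_nonZeroDivisors_of_ne_zero hirr.ne_zero),
    Ring.ord_of_irreducible hirr]
  simp

end Curve

lemma curveLength_of_isUnit {X : Scheme.{u}} {c p : X} (h : c ⤳ p) {a : X.presheaf.stalk p}
    (ha : IsUnit a) : curveLength h a = 0 := by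
  rw [curveLength_eq, Ring.ord_of_isUnit (ha.map _)]; rfl

/-! ### Constants and residue fields -/

section Constants

variable {k : Type u} [Field k] {X : Scheme.{u}} {A : Type u} [CommRing A] [Algebra k A]
  (ι : Spec (CommRingCat.of A) ⟶ X) [IsOpenImmersion ι] (s : X ⟶ Spec (CommRingCat.of k))
  (hs : ι ≫ s = Spec.map (CommRingCat.ofHom (algebraMap k A)))

include hs in
lemma constants_eq_chartGerm (x : X) (hx : x ∈ Set.range ι) (r : k) :
    constants s x r = chartGerm ι x hx (algebraMap k A r) := by
  obtain ⟨P, rfl⟩ := hx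
  have hinj : Function.Injective (ι.stalkMap P).hom :=
    (asIso (ι.stalkMap P)).commRingCatIsoToRingEquiv.injective
  apply hinj
  rw [stalkMap_chartGerm]
  have h1 : (Scheme.ΓSpecIso (CommRingCat.of k)).inv ≫ s.appTop ≫
      X.presheaf.germ ⊤ (ι P) trivial ≫ ι.stalkMap P =
      CommRingCat.ofHom (algebraMap k A) ≫ StructureSheaf.toStalk A P := by
    have e1 : X.presheaf.germ ⊤ (ι P) trivial ≫ ι.stalkMap P =
        ι.appTop ≫ (Spec (CommRingCat.of A)).presheaf.germ ⊤ P trivial :=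
      Scheme.Hom.germ_stalkMap ι ⊤ P trivial
    have e2 : s.appTop ≫ ι.appTop = (Spec.map (CommRingCat.ofHom (algebraMap k A))).appTop := by
      rw [← hs]; exact (Scheme.Hom.comp_appTop ι s).symm
    rw [e1, reassoc_of% e2, ← Scheme.ΓSpecIso_inv_naturality_assoc]
    rfl
  exact ConcreteCategory.congr_hom h1 r

include hs in
/-- If functions on the chart restrict to polynomials in `y` on the closure of a point, then the
residue field is generated by `y`. -/
lemma closure_residue_eq_top {P : Spec (CommRingCat.of A)} {y : A}
    (hy : ∀ a : A, ∃ p : Polynomial k, a - Polynomial.aeval y p ∈ pointIdeal P) :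
    Subfield.closure (Set.range ((X.residue (ι P)).hom.comp (constants s (ι P))) ∪
      {(X.residue (ι P)).hom (chartGerm ι (ι P) (Set.mem_range_self P) y)}) = ⊤ := by
  set F := Subfield.closure (Set.range ((X.residue (ι P)).hom.comp (constants s (ι P))) ∪
      {(X.residue (ι P)).hom (chartGerm ι (ι P) (Set.mem_range_self P) y)}) with hF
  let ρ : A →+* X.residueField (ι P) :=
    (X.residue (ι P)).hom.comp (chartGerm ι (ι P) (Set.mem_range_self P))
  have hρ0 : ∀ a ∈ pointIdeal P, ρ a = 0 := fun a ha =>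
    (IsLocalRing.residue_eq_zero_iff _).mpr ((chartGerm_mem_maximalIdeal ι P a).mpr ha)
  have hk : ∀ r, ρ (algebraMap k A r) ∈ F := fun r => by
    refine Subfield.subset_closure (Or.inl ⟨r, ?_⟩)
    rw [RingHom.comp_apply, constants_eq_chartGerm ι s hs _ (Set.mem_range_self P)]
    rfl
  have hyF : ρ y ∈ F := Subfield.subset_closure (Or.inr rfl)
  have hA : ∀ a, ρ a ∈ F := fun a => by
    obtain ⟨p, hp⟩ := hy a
    have h1 : ρ a = ρ (Polynomial.aeval y p) := by
      rw [← sub_eq_zero, ← map_sub]; exact hρ0 _ hp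
    rw [h1, Polynomial.aeval_eq_sum_range, map_sum]
    refine sum_mem fun i _ => ?_
    rw [Algebra.smul_def, map_mul, map_pow]
    exact mul_mem (hk _) (pow_mem hyF i)
  rw [eq_top_iff]
  intro z _
  obtain ⟨ζ, rfl⟩ : ∃ ζ, (X.residue (ι P)).hom ζ = z := IsLocalRing.residue_surjective z
  obtain ⟨a, t, ht, h1⟩ := chartGerm_surj ι P ζ
  have h2 : (X.residue (ι P)).hom ζ * ρ t = ρ a := by
    have := congrArg (X.residue (ι P)).hom h1
    rwa [map_mul] at this
  have h3 : ρ t ≠ 0 := fun h0 =>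
    ht ((chartGerm_mem_maximalIdeal ι P t).mp ((IsLocalRing.residue_eq_zero_iff _).mp h0))
  rw [eq_div_of_mul_eq h3 h2]
  exact div_mem (hA a) (hA t)

end Constants

/-! ### Invariant curves on smooth toric surfaces -/

/-- Characters `x`, `y` that are coordinates near the edge `u` of a smooth cone, where `x` is an
equation of the orbit closure of `u`. -/
structure EdgeBasis (u v w x y : ℤ × ℤ) : Prop where
  inCone : InCone u v w
  x_mem : x ∈ dualMonoid v w
  y_mem : y ∈ dualMonoid v w
  pairing_x : pairing x u = 1
  pairing_y : pairing y u = 0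
  pairing_x_add : 0 < pairing x (v + w)
  pairing_y_add : 0 < pairing y (v + w)
  sub_mem : ∀ m ∈ dualMonoid v w, 0 < pairing m u → m - x ∈ dualMonoid v w
  exists_nsmul : ∀ m ∈ dualMonoid v w, pairing m u = 0 → ∃ n : ℕ, m = n • y

/-- In a unimodular cone `-perp w` and `perp v` form the dual basis of v and w. -/
lemma edgeBasis_left {v w : ℤ × ℤ} (h : det v w = 1) :
    EdgeBasis v v w (-perp w) (perp v) where
  inCone := inCone_left v w
  x_mem := neg_perp_mem (by omega)
  y_mem := perp_mem (by omega)
  pairing_x := by rw [pairing_neg, pairing_perp, det_swap, h]; rfl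
  pairing_y := by rw [pairing_perp, det_self]
  pairing_x_add := by
    rw [pairing_add_right, pairing_neg, pairing_neg, pairing_perp, pairing_perp, det_self,
      det_swap, h]
    norm_num
  pairing_y_add := by rw [pairing_add_right, pairing_perp, pairing_perp, det_self, h]; norm_num
  sub_mem m hm h0 := by
    refine ⟨?_, ?_⟩
    · rw [pairing_sub, pairing_neg, pairing_perp, det_swap, h]; omega
    · rw [pairing_sub, pairing_neg, pairing_perp, det_self]; have := hm.2; omega
  exists_nsmul m hm h0 := by
    obtain ⟨n, hn⟩ := Int.eq_ofNat_of_zero_le hm.2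
    refine ⟨n, eq_of_pairing_eq (v := v) (w := w) (by omega) ?_ ?_⟩
    · rw [pairing_nsmul, pairing_perp, det_self, h0, mul_zero]
    · rw [pairing_nsmul, pairing_perp, h, hn, mul_one]

lemma edgeBasis_right {v w : ℤ × ℤ} (h : det v w = 1) :
    EdgeBasis w v w (perp v) (-perp w) where
  inCone := inCone_right v w
  x_mem := perp_mem (by omega)
  y_mem := neg_perp_mem (by omega)
  pairing_x := by rw [pairing_perp, h]
  pairing_y := by rw [pairing_neg, pairing_perp, det_self, neg_zero]
  pairing_x_add := by rw [pairing_add_right, pairing_perp, pairing_perp, det_self, h]; norm_num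
  pairing_y_add := by
    rw [pairing_add_right, pairing_neg, pairing_neg, pairing_perp, pairing_perp, det_self,
      det_swap, h]
    norm_num
  sub_mem m hm h0 := by
    refine ⟨?_, ?_⟩
    · rw [pairing_sub, pairing_perp, det_self]; have := hm.1; omega
    · rw [pairing_sub, pairing_perp, h]; omega
  exists_nsmul m hm h0 := by
    obtain ⟨n, hn⟩ := Int.eq_ofNat_of_zero_le hm.1
    refine ⟨n, eq_of_pairing_eq (v := v) (w := w) (by omega) ?_ ?_⟩
    · rw [pairing_nsmul, pairing_neg, pairing_perp, det_swap, h, hn, neg_neg, mul_one]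
    · rw [pairing_nsmul, pairing_neg, pairing_perp, det_self, h0, neg_zero, mul_zero]

namespace EdgeBasis

variable {k : Type u} [Field k] {u v w x y : ℤ × ℤ} (B : EdgeBasis u v w x y)
include B

lemma faceIdeal_eq_span : faceIdeal (k := k) B.inCone = Ideal.span {monomial x B.x_mem} := by
  apply le_antisymm
  · intro a ha
    rw [mem_faceIdeal] at ha
    rw [coneRing_eq_sum a]
    refine Ideal.sum_mem _ fun m hm => Ideal.mul_mem_left _ _ ?_
    have h1 := B.sub_mem m.1 m.2 (ha m hm)
    have h2 : monomial (k := k) m.1 m.2 = monomial _ h1 * monomial x B.x_mem := by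
      rw [monomial_mul]; congr 1; abel
    rw [h2]
    exact Ideal.mul_mem_left _ _ (Ideal.mem_span_singleton_self _)
  · rw [Ideal.span_singleton_le_iff_mem, monomial_mem_faceIdeal, B.pairing_x]
    exact one_pos

/-- On the curve only the powers of y survive, so its coordinate ring in this chart is k[y]. -/
lemma exists_polynomial (a : ConeRing k v w) :
    ∃ p : Polynomial k, a - Polynomial.aeval (monomial y B.y_mem) p ∈ faceIdeal B.inCone := by
  rw [coneRing_eq_sum a]
  refine Finset.sum_induction _ (fun a => ∃ p : Polynomial k,
    a - Polynomial.aeval (monomial y B.y_mem) p ∈ faceIdeal B.inCone) ?_ ?_ ?_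
  · rintro a b ⟨p, hp⟩ ⟨q, hq⟩
    refine ⟨p + q, ?_⟩
    rw [map_add, add_sub_add_comm]
    exact add_mem hp hq
  · exact ⟨0, by simp⟩
  · intro m _
    by_cases h : pairing m.1 u = 0
    · obtain ⟨n, hn⟩ := B.exists_nsmul m.1 m.2 h
      refine ⟨Polynomial.C (a.coeff m) * Polynomial.X ^ n, ?_⟩
      have h1 : monomial (k := k) m.1 m.2 = monomial y B.y_mem ^ n := by
        rw [monomial_pow]; congr 1
      rw [map_mul, map_pow, Polynomial.aeval_X, Polynomial.aeval_C, h1, sub_self]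
      exact zero_mem _
    · refine ⟨0, ?_⟩
      rw [map_zero, sub_zero]
      refine Ideal.mul_mem_left _ _ ((monomial_mem_faceIdeal _ m.2).mpr ?_)
      have := B.inCone.pairing_nonneg m.2
      omega

lemma monomial_y_notMem : monomial (k := k) y B.y_mem ∉ faceIdeal B.inCone := by
  rw [monomial_mem_faceIdeal, B.pairing_y]; exact lt_irrefl _

lemma monomial_y_mem_add : monomial (k := k) y B.y_mem ∈ faceIdeal (inCone_add_self v w) := by
  rw [monomial_mem_faceIdeal]; exact B.pairing_y_add

lemma le_sup_span_y {Q : Ideal (ConeRing k v w)} [hQ : Q.IsPrime]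
    (hQF : faceIdeal B.inCone ≤ Q) (hy : monomial y B.y_mem ∈ Q) :
    Q ≤ faceIdeal B.inCone ⊔ Ideal.span {monomial y B.y_mem} := by
  intro a ha
  obtain ⟨p, hp⟩ := B.exists_polynomial a
  have h1 : Polynomial.aeval (monomial y B.y_mem) p - algebraMap k _ (p.coeff 0) ∈
      Ideal.span {monomial (k := k) y B.y_mem} := by
    obtain ⟨r, hr⟩ := Polynomial.X_dvd_sub_C (p := p)
    have := congrArg (Polynomial.aeval (monomial (k := k) y B.y_mem)) hr
    rw [map_sub, Polynomial.aeval_C, map_mul, Polynomial.aeval_X] at this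
    rw [this]
    exact Ideal.mul_mem_right _ _ (Ideal.mem_span_singleton_self _)
  have h2 : algebraMap k (ConeRing k v w) (p.coeff 0) ∈ Q := by
    have e1 := Q.sub_mem ha (hQF hp)
    have e2 := Q.sub_mem e1 ((Ideal.span_singleton_le_iff_mem Q).mpr hy h1)
    convert e2 using 1
    ring
  have h3 : p.coeff 0 = 0 := by
    by_contra h0
    exact hQ.ne_top (Ideal.eq_top_of_isUnit_mem _ h2 ((IsUnit.mk0 _ h0).map _))
  rw [h3, map_zero, sub_zero] at h1
  have := Submodule.add_mem_sup hp h1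
  rwa [sub_add_cancel] at this

/-- Closed points of the curve correspond to ideals of the principal ideal ring k[y]. The generator
is nonzero on the curve because the ideal of the curve is not maximal: it is strictly contained in
that of the fixed point. -/
lemma exists_generator {Q : Ideal (ConeRing k v w)} [hQ : Q.IsMaximal]
    (hQF : faceIdeal B.inCone ≤ Q) :
    ∃ q ∈ Q, q ∉ faceIdeal B.inCone ∧ Q ≤ faceIdeal B.inCone ⊔ Ideal.span {q} := by
  let φ : Polynomial k →+* ConeRing k v w := (Polynomial.aeval (monomial y B.y_mem)).toRingHom
  obtain ⟨g, hg⟩ := (IsPrincipalIdealRing.principal (Q.comap φ)).principal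
  have hle : Q ≤ faceIdeal B.inCone ⊔ Ideal.span {φ g} := by
    intro a ha
    obtain ⟨p, hp⟩ := B.exists_polynomial a
    have h1 : p ∈ Q.comap φ := by
      have := Q.sub_mem ha (hQF hp)
      rwa [sub_sub_cancel] at this
    rw [hg] at h1
    obtain ⟨r, rfl⟩ := Ideal.mem_span_singleton'.mp h1
    have h2 : φ (r * g) ∈ Ideal.span {φ g} := by
      rw [map_mul]; exact Ideal.mul_mem_left _ _ (Ideal.mem_span_singleton_self _)
    have := Submodule.add_mem_sup hp h2
    rwa [show a - (Polynomial.aeval (monomial y B.y_mem)) (r * g) + φ (r * g) = a from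
      sub_add_cancel _ _] at this
  refine ⟨φ g, ?_, fun h => ?_, hle⟩
  · have : g ∈ Q.comap φ := by rw [hg]; exact Submodule.mem_span_singleton_self g
    exact this
  · have h1 : Q = faceIdeal B.inCone := le_antisymm
      (hle.trans (sup_le le_rfl ((Ideal.span_singleton_le_iff_mem _).mpr h))) hQF
    have h2 : faceIdeal (k := k) B.inCone ≤ faceIdeal (inCone_add_self v w) := by
      rw [B.faceIdeal_eq_span, Ideal.span_singleton_le_iff_mem, monomial_mem_faceIdeal]
      exact B.pairing_x_add
    have h3 := hQ.eq_of_le (Ideal.IsPrime.ne_top inferInstance) (h1.le.trans h2)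
    exact B.monomial_y_notMem (by rw [← h1, h3]; exact B.monomial_y_mem_add)

end EdgeBasis

/-! ### Local equations, orders and self-intersection of invariant curves -/

namespace ToricSurface

variable {k : Type u} [Field k] (S : ToricSurface k)

section Edge

variable {S} {j : ℤ} {u x y : ℤ × ℤ} (B : EdgeBasis u (S.fan.ray j) (S.fan.ray (j + 1)) x y)
  {c p : S.X} (h : c ⤳ p) (hc : c = S.orbitPoint j B.inCone)
  (hp : p ∈ Set.range (S.chart j))

include hc

lemma curveIdeal_eq_span :
    curveIdeal h = Ideal.span {chartGerm (S.chart j) p hp (monomial x B.x_mem)} := by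
  obtain ⟨Q, rfl⟩ := hp
  subst hc
  have h1 := curveIdeal_eq_map (S.chart j) (P := specPoint (faceIdeal B.inCone)) h
  refine h1.trans ?_
  rw [pointIdeal_specPoint, congrArg (Ideal.map _) B.faceIdeal_eq_span, Ideal.map_span,
    Set.image_singleton]

include h hp in
lemma isDiscreteValuationRing_edge (hcl : IsClosed {p}) :
    IsDiscreteValuationRing (S.X.presheaf.stalk p ⧸ curveIdeal h) := by
  obtain ⟨Q, rfl⟩ := hp
  subst hc
  have hQ := (S.isClosed_chart_iff j Q).mp hcl
  have hle : faceIdeal B.inCone ≤ pointIdeal Q := by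
    have := ((S.chart j).isOpenEmbedding.toIsEmbedding.toIsInducing.specializes_iff).mp h
    rwa [specializes_iff_pointIdeal_le, pointIdeal_specPoint] at this
  obtain ⟨q, hq, hqP, hPQ⟩ := B.exists_generator hle
  exact isDiscreteValuationRing_curve (S.chart j) (P := specPoint (faceIdeal B.inCone)) h hq hqP hPQ

include hp in
open Classical in
/-- The second coordinate has a simple zero at the fixed point and no other zeros on the curve. -/
lemma hasOrderOnCurve_edge (n : ℤ) :
    HasOrderOnCurve h (S.character (n • y)) (if p = S.fixedPoint j then n else 0) := by
  obtain ⟨Q, rfl⟩ := hp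
  have hle : faceIdeal B.inCone ≤ pointIdeal Q := by
    subst hc
    have := ((S.chart j).isOpenEmbedding.toIsEmbedding.toIsInducing.specializes_iff).mp h
    rwa [specializes_iff_pointIdeal_le, pointIdeal_specPoint] at this
  -- Modulo the curve, the ideal of the fixed point is generated by y, so it is the only point of
  -- the curve in this chart where y vanishes.
  have hfix : S.chart j Q = S.fixedPoint j ↔ monomial y B.y_mem ∈ pointIdeal Q := by
    constructor
    · intro h1
      have h2 : Q = specPoint (faceIdeal (inCone_add_self _ _)) :=
        (S.chart j).isOpenEmbedding.injective h1
      rw [h2, pointIdeal_specPoint]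
      exact B.monomial_y_mem_add
    · intro hy
      have h1 : pointIdeal Q ≤ faceIdeal (inCone_add_self _ _) := by
        refine (B.le_sup_span_y hle hy).trans (sup_le ?_ ?_)
        · rw [B.faceIdeal_eq_span, Ideal.span_singleton_le_iff_mem, monomial_mem_faceIdeal]
          exact B.pairing_x_add
        · rw [Ideal.span_singleton_le_iff_mem]
          exact B.monomial_y_mem_add
      have h2 : faceIdeal (inCone_add_self _ _) ≤ pointIdeal Q := by
        intro a ha
        obtain ⟨b, hb, z, hz, rfl⟩ := Submodule.mem_sup.mp
          (B.le_sup_span_y (Q := faceIdeal (inCone_add_self _ _)) (by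
            rw [B.faceIdeal_eq_span, Ideal.span_singleton_le_iff_mem, monomial_mem_faceIdeal]
            exact B.pairing_x_add) B.monomial_y_mem_add ha)
        exact add_mem (hle hb) ((Ideal.span_singleton_le_iff_mem _).mpr hy hz)
      rw [fixedPoint, orbitPoint]
      congr 1
      exact pointIdeal_injective (le_antisymm h1 h2)
  subst hc
  set g := chartGerm (S.chart j) (S.chart j Q) (Set.mem_range_self Q) (monomial y B.y_mem) with hg
  have hg' : algebraMap _ S.X.functionField g = S.character y := by
    rw [hg, algebraMap_chartGerm, chartToField_monomial]
  have hpow : ∀ N : ℕ, algebraMap _ S.X.functionField (g ^ N) = S.character (N • y) := by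
    intro N
    induction N with
    | zero => rw [pow_zero, map_one, zero_smul, character_zero]
    | succ N ih => rw [pow_succ, map_mul, ih, hg', ← character_add, succ_nsmul]
  have hgm : g ∉ curveIdeal h := fun hm =>
    B.monomial_y_notMem ((chartGerm_mem_curveIdeal (S.chart j)
      (P := specPoint (faceIdeal B.inCone)) h _).mp hm)
  have hgN : ∀ N, g ^ N ∉ curveIdeal h := fun N hm =>
    hgm (Ideal.IsPrime.mem_of_pow_mem inferInstance N hm)
  have hone : (1 : S.X.presheaf.stalk (S.chart j Q)) ∉ curveIdeal h := by simpa using hgN 0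
  have hlen : ∀ N : ℕ, (curveLength h (g ^ N) : ℤ) =
      if S.chart j Q = S.fixedPoint j then (N : ℤ) else 0 := by
    intro N
    split_ifs with hf
    · exact congrArg Nat.cast
        (curveLength_chartGerm_pow (S.chart j) (P := specPoint (faceIdeal B.inCone)) h
          (hfix.mp hf) B.monomial_y_notMem (B.le_sup_span_y hle (hfix.mp hf)) N)
    · rw [curveLength_of_isUnit h (((isUnit_chartGerm (S.chart j) Q _).mpr
        fun hm => hf (hfix.mpr hm)).pow N)]
      rfl
  have hlen1 : curveLength h (1 : S.X.presheaf.stalk (S.chart j Q)) = 0 :=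
    curveLength_of_isUnit h isUnit_one
  rcases Int.eq_nat_or_neg n with ⟨N, rfl | rfl⟩
  · refine ⟨g ^ N, 1, hgN N, hone, ?_, ?_⟩
    · rw [hpow, map_one, div_one, natCast_zsmul]
    · rw [hlen, hlen1]; simp
  · refine ⟨1, g ^ N, hone, hgN N, ?_, ?_⟩
    · rw [hpow, map_one, neg_smul, character_neg, natCast_zsmul, one_div]
    · rw [hlen, hlen1]; split_ifs <;> simp

end Edge

/-- Indices matter only modulo n; charts whose cones have the same edges have the same image
although their types differ. -/
lemma exists_chart_eq {l i : ℤ} (h : S.fan.ray l = S.fan.ray i)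
    (h' : S.fan.ray (l + 1) = S.fan.ray (i + 1))
    (P : affineToric k (S.fan.ray l) (S.fan.ray (l + 1))) : ∃ Q, S.chart l P = S.chart i Q := by
  have hle : dualMonoid (S.fan.ray i) (S.fan.ray (i + 1)) ≤
      dualMonoid (S.fan.ray l) (S.fan.ray (l + 1)) := by rw [h, h']
  have h1 := S.inclusion_chart_eq l i le_rfl hle
  have h2 : coneInclusion (k := k) (le_refl (dualMonoid (S.fan.ray l) (S.fan.ray (l + 1)))) =
      RingHom.id _ := AddMonoidAlgebra.mapDomainRingHom_id
  rw [h2, CommRingCat.ofHom_id, Spec.map_id, Category.id_comp] at h1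
  exact ⟨_, by rw [h1]; rfl⟩

/-- The points of an invariant curve lie in the charts of the two adjacent cones. -/
lemma mem_range_of_divisor_specializes {j : ℤ} {p : S.X} (h : (S.divisor (j + 1)).1 ⤳ p) :
    p ∈ Set.range (S.chart j) ∨ p ∈ Set.range (S.chart (j + 1)) := by
  obtain ⟨l, P, rfl⟩ := S.covers p
  rcases (S.divisor_specializes_chart_iff _ _ _).mp h with ⟨h1, -⟩ | ⟨h1, -⟩
  · right
    have h2 := CompleteFan.dvd_of_ray_eq h1
    obtain ⟨Q, hQ⟩ := S.exists_chart_eq h1.symm (CompleteFan.ray_succ_congr h2) P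
    exact ⟨Q, hQ.symm⟩
  · left
    have h2 := CompleteFan.dvd_of_ray_eq h1
    obtain ⟨Q, hQ⟩ := S.exists_chart_eq (l := l) (i := j)
      (CompleteFan.ray_congr (by simpa using h2)) h1.symm P
    exact ⟨Q, hQ.symm⟩

/-- The curve of v_j passes through this point, and with at least three rays v_j is not an edge of
the next cone. -/
lemma fixedPoint_notMem_range (j : ℤ) : S.fixedPoint j ∉ Set.range (S.chart (j + 1)) := by
  intro h
  have h1 := S.mem_range_chart_of_specializes (S.divisor_specializes_fixedPoint j) h
  have hn := CompleteFan.three_le (F := S.fan)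
  rcases S.ray_of_divisor_mem_range h1 with h2 | h2
  · exact CompleteFan.not_dvd_of_lt (F := S.fan) (i := j) (j := j + 1) (by omega) (by omega)
      (CompleteFan.dvd_of_ray_eq h2)
  · exact CompleteFan.not_dvd_of_lt (F := S.fan) (i := j) (j := j + 1 + 1) (by omega) (by omega)
      (CompleteFan.dvd_of_ray_eq h2)

variable {S} (hS : ∀ i, det (S.fan.ray i) (S.fan.ray (i + 1)) = 1)
include hS

/-- The equation of the curve on one adjacent chart serves as the global function f. All of the
self-intersection is then concentrated at the fixed point of the other chart. Only the existence of
this computation is needed later, not that the number is unique. -/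
theorem hasSelfIntersection_divisor (i : ℤ) :
    HasSelfIntersection (S.divisor i) (-S.fan.coeff i) := by
  classical
  obtain ⟨j, rfl⟩ : ∃ j, i = j + 1 := ⟨i - 1, by ring⟩
  have BL := edgeBasis_left (hS (j + 1))
  have BR := edgeBasis_right (hS j)
  have hcL : (S.divisor (j + 1)).1 = S.orbitPoint (j + 1) BL.inCone := rfl
  have hcR : (S.divisor (j + 1)).1 = S.orbitPoint j BR.inCone := S.divisor_eq_orbitPoint _ _ _
  refine ⟨S.character (-perp (S.fan.ray (j + 1 + 1))), ?_,
    Finsupp.single (S.fixedPoint j) (-S.fan.coeff (j + 1)), ?_, ?_, ?_⟩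
  · rw [ord_character, BL.pairing_x]
  · intro p hp
    by_cases hpf : p = S.fixedPoint j
    · rw [hpf]
      exact ⟨S.divisor_succ_specializes_fixedPoint j, S.isClosed_fixedPoint j⟩
    · exact absurd (Finsupp.single_eq_of_ne hpf) hp
  · intro p h hcl
    by_cases hpL : p ∈ Set.range (S.chart (j + 1))
    · refine ⟨_, curveIdeal_eq_span BL h hcL hpL, ?_⟩
      rw [algebraMap_chartGerm, chartToField_monomial, div_self (S.character_ne_zero _)]
      have hpf : p ≠ S.fixedPoint j := fun hpf => S.fixedPoint_notMem_range j (hpf ▸ hpL)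
      rw [Finsupp.single_eq_of_ne hpf]
      have := hasOrderOnCurve_edge BL h hcL hpL 0
      rwa [zero_smul, character_zero, ite_self] at this
    · have hpR := (S.mem_range_of_divisor_specializes h).resolve_right hpL
      refine ⟨_, curveIdeal_eq_span BR h hcR hpR, ?_⟩
      rw [algebraMap_chartGerm, chartToField_monomial, div_eq_mul_inv, ← character_neg,
        ← character_add]
      have h1 := CompleteFan.ray_rec hS (j + 1)
      rw [add_sub_cancel_right] at h1
      -- The quotient of the two local equations is the character of v_j + v_{j+2}, which is the
      -- coefficient times v_{j+1}; so it is a power of the coordinate on the curve.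
      have h2 : perp (S.fan.ray j) + - -perp (S.fan.ray (j + 1 + 1)) =
          (-S.fan.coeff (j + 1)) • -perp (S.fan.ray (j + 1)) := by
        rw [h1]
        ext
        · simp [perp]; ring
        · simp [perp]
      rw [h2, Finsupp.single_apply]
      have := hasOrderOnCurve_edge BR h hcR hpR (-S.fan.coeff (j + 1))
      simpa only [eq_comm] using this
  · rw [Finsupp.sum_single_index rfl]

theorem isSmoothRationalCurve_divisor (i : ℤ) :
    IsSmoothRationalCurve S.str (S.divisor i) := by
  obtain ⟨j, rfl⟩ : ∃ j, i = j + 1 := ⟨i - 1, by ring⟩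
  have BL := edgeBasis_left (hS (j + 1))
  have BR := edgeBasis_right (hS j)
  have hcL : (S.divisor (j + 1)).1 = S.orbitPoint (j + 1) BL.inCone := rfl
  have hcR : (S.divisor (j + 1)).1 = S.orbitPoint j BR.inCone := S.divisor_eq_orbitPoint _ _ _
  refine ⟨fun p h hcl => ?_, _, closure_residue_eq_top (S.chart (j + 1)) S.str (S.chart_str _)
    (P := specPoint (faceIdeal BL.inCone)) BL.exists_polynomial⟩
  rcases S.mem_range_of_divisor_specializes h with hp | hp
  · exact isDiscreteValuationRing_edge BR h hcR hp hcl
  · exact isDiscreteValuationRing_edge BL h hcL hp hcl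

lemma isNegOneCurve_divisor {i : ℤ} (h : S.fan.coeff i = 1) :
    IsNegOneCurve S.str (S.divisor i) := by
  refine ⟨isSmoothRationalCurve_divisor hS i, ?_⟩
  have := hasSelfIntersection_divisor hS i
  rwa [h] at this

/-- A character restricts to a coordinate of the invariant curve on which it is invertible. -/
lemma isSection_divisor (i : ℤ) {m : ℤ × ℤ} (hm : m = perp (S.fan.ray i) ∨
    m = -perp (S.fan.ray i)) : IsSection S.str (S.character m) (S.divisor i) := by
  obtain ⟨j, rfl⟩ : ∃ j, i = j + 1 := ⟨i - 1, by ring⟩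
  have key : ∀ (l : ℤ) (x y : ℤ × ℤ)
      (B : EdgeBasis (S.fan.ray (j + 1)) (S.fan.ray l) (S.fan.ray (l + 1)) x y),
      IsSection S.str (S.character y) (S.divisor (j + 1)) := by
    intro l x y B
    have hc : (S.divisor (j + 1)).1 = S.orbitPoint l B.inCone := S.divisor_eq_orbitPoint _ _ _
    generalize S.divisor (j + 1) = c at hc
    obtain ⟨c, hco⟩ := c
    subst hc
    refine ⟨chartGerm (S.chart l) _ (Set.mem_range_self (specPoint (faceIdeal B.inCone)))
      (monomial y B.y_mem), ?_, closure_residue_eq_top (S.chart l) S.str (S.chart_str _)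
      (P := specPoint (faceIdeal B.inCone)) B.exists_polynomial⟩
    rw [← S.chartToField_monomial l B.y_mem]
    exact algebraMap_chartGerm (S.chart l) _ _ _
  rcases hm with rfl | rfl
  · exact key _ _ _ (edgeBasis_left (hS (j + 1)))
  · exact key _ _ _ (edgeBasis_right (hS j))

end ToricSurface

/-! ### Toric morphisms and minimal resolutions -/

/-- On a vector strictly inside the cone, a character in the dual monoid is positive as soon as it
is positive on one of the edges. -/
lemma faceIdeal_le_of_det {k : Type u} [Field k] {u v w : ℤ × ℤ} (h : 0 < det v w)
    (h1 : 0 < det v u) (h2 : 0 < det u w) (hu : InCone u v w) :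
    faceIdeal (k := k) (inCone_add_self v w) ≤ faceIdeal hu := fun a ha => by
  rw [mem_faceIdeal] at ha ⊢
  intro m hm
  have h3 := ha m hm
  have h4 := m.2.1
  have h5 := m.2.2
  rw [pairing_add_right] at h3
  have h6 := pairing_mul_det m.1 u v w
  have h7 : 0 < pairing m.1 u * det v w := by
    rw [h6]
    rcases h4.lt_or_eq with h8 | h8
    · exact add_pos_of_pos_of_nonneg (mul_pos h8 h2) (mul_nonneg h5 h1.le)
    · rw [← h8, zero_mul, zero_add]
      exact mul_pos (by omega) h1
  exact pos_of_mul_pos_left h7 h.le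

namespace ToricSurface

variable {k : Type u} [Field k]

lemma orbitPoint_eq_fixedPoint (S : ToricSurface k) (i : ℤ) {u : ℤ × ℤ}
    (h1 : 0 < det (S.fan.ray i) u) (h2 : 0 < det u (S.fan.ray (i + 1)))
    (hu : InCone u (S.fan.ray i) (S.fan.ray (i + 1))) : S.orbitPoint i hu = S.fixedPoint i := by
  have h := faceIdeal_le_of_det (k := k) (S.fan.det_pos i) h1 h2 hu
  exact S.eq_fixedPoint ((faceIdeal_left_le _ _).trans h) ((faceIdeal_right_le _ _).trans h)

/-- A closed generic point would equal the fixed point on the curve, through which the next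
invariant curve also passes. -/
lemma divisor_not_isClosed (S : ToricSurface k) (i : ℤ) : ¬ IsClosed {(S.divisor i).1} := by
  intro h
  have h1 : S.fixedPoint i = (S.divisor i).1 :=
    (S.divisor_specializes_fixedPoint i).mem_closed h rfl
  have h2 := S.divisor_succ_specializes_fixedPoint i
  rw [h1] at h2
  have h3 := eq_of_specializes_of_coheight h2 (S.divisor (i + 1)).2 (S.divisor i).2
  have h4 := S.ray_eq_of_divisor_eq (Subtype.ext h3)
  have h5 := S.fan.det_pos i
  rw [h4, det_self] at h5
  exact lt_irrefl _ h5

variable {S' S : ToricSurface k} {f : S'.X ⟶ S.X}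

/-- On a common subcone f is the identity of the torus, and density of the torus determines it on
the whole affine piece. -/
lemma inclusion_chart_comp (hb : f ≫ S.str = S'.str) (ht : S'.torus ≫ f = S.torus) {u w : ℤ × ℤ}
    (i j : ℤ) (hi : dualMonoid (S'.fan.ray i) (S'.fan.ray (i + 1)) ≤ dualMonoid u w)
    (hj : dualMonoid (S.fan.ray j) (S.fan.ray (j + 1)) ≤ dualMonoid u w) :
    (Spec.map (CommRingCat.ofHom (coneInclusion (k := k) hi)) ≫ S'.chart i) ≫ f =
      Spec.map (CommRingCat.ofHom (coneInclusion (k := k) hj)) ≫ S.chart j := by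
  refine S.hom_ext ?_ ?_
  · rw [inclusion_chart_str, Category.assoc, hb, inclusion_chart_str]
  · rw [torusInclusion_inclusion_chart, ← Category.assoc, torusInclusion_inclusion_chart, ht]

/-- A toric morphism maps orbits to orbits. -/
lemma map_orbitPoint (hb : f ≫ S.str = S'.str) (ht : S'.torus ≫ f = S.torus) {u : ℤ × ℤ}
    (i j : ℤ) (hi : InCone u (S'.fan.ray i) (S'.fan.ray (i + 1)))
    (hj : InCone u (S.fan.ray j) (S.fan.ray (j + 1))) :
    f (S'.orbitPoint i hi) = S.orbitPoint j hj := by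
  rw [orbitPoint_eq_image, orbitPoint_eq_image, ← inclusion_chart_comp hb ht i j hi hj]
  exact (Scheme.Hom.comp_apply _ _ _).symm

theorem basicFan (hρ : picardNumber S.X = 1) (hf : IsMinimalResolution f) (hbasic : S'.IsBasic) :
    BasicFan S'.fan S.fan := by
  have hS' := S'.det_eq_one hf.smooth
  constructor
  · exact hS'
  · exact S.n_eq_three_of_picardNumber hρ
  · intro j
    obtain ⟨i, h1, h2⟩ := CompleteFan.exists_cone S'.fan (CompleteFan.ray_ne_zero (F := S.fan) j)
    have hi := inCone_of_det (S'.fan.det_pos i) h1 h2.le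
    rcases h1.lt_or_eq with h1 | h1
    -- If the ray of S were strictly inside a cone of S', a closed point would map to the generic
    -- point of a curve, although f is closed.
    · exfalso
      have h3 := map_orbitPoint hf.over_base hf.torus i j hi (inCone_left _ _)
      rw [S'.orbitPoint_eq_fixedPoint i h1 h2 hi] at h3
      have hp := hf.proper
      have h4 := f.isClosedMap _ (S'.isClosed_fixedPoint i)
      rw [Set.image_singleton, h3] at h4
      exact S.divisor_not_isClosed j h4
    · refine ⟨i, ?_⟩
      rcases eq_or_eq_neg_of_det_eq_zero (S'.fan.primitive i) (S.fan.primitive j) h1.symm with h | h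
      · exact h.symm
      · rw [h, det_neg_left, hS'] at h2
        omega
  · intro i hi
    obtain ⟨j, h1, h2⟩ := CompleteFan.exists_cone S.fan (CompleteFan.ray_ne_zero (F := S'.fan) i)
    have hj := inCone_of_det (S.fan.det_pos j) h1 h2.le
    rcases h1.lt_or_eq with h1 | h1
    -- If a (-1)-ray were strictly inside a cone of S, its curve would be contracted to a fixed
    -- point, against minimality.
    · exfalso
      have h3 := map_orbitPoint hf.over_base hf.torus i j (inCone_left _ _) hj
      rw [S.orbitPoint_eq_fixedPoint j h1 h2 hj] at h3
      refine hf.minimal (S'.divisor i) ?_ (isNegOneCurve_divisor hS' hi)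
      have h4 : f (S'.divisor i).1 = S.fixedPoint j := h3
      rw [h4]
      exact S.isClosed_fixedPoint j
    · refine ⟨j, ?_⟩
      rcases eq_or_eq_neg_of_det_eq_zero (S.fan.primitive j) (S'.fan.primitive i) h1.symm with h | h
      · exact h
      · have := S.fan.det_pos j
        rw [h, det_neg_left] at h2
        omega
  · intro i hi
    have hC := isNegOneCurve_divisor hS' hi
    constructor
    · have := hbasic _ hC (S'.divisor (i + 1)) (S'.divisor_notMem_torus _)
        ⟨S'.fixedPoint i, S'.divisor_specializes_fixedPoint i,
          S'.divisor_succ_specializes_fixedPoint i⟩ _ (hasSelfIntersection_divisor hS' _)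
      omega
    · have h1 := S'.divisor_succ_specializes_fixedPoint (i - 1)
      rw [sub_add_cancel] at h1
      have := hbasic _ hC (S'.divisor (i - 1)) (S'.divisor_notMem_torus _)
        ⟨S'.fixedPoint (i - 1), h1, S'.divisor_specializes_fixedPoint (i - 1)⟩ _
        (hasSelfIntersection_divisor hS' _)
      omega

end ToricSurface

/-! ### Fibrations by characters -/

namespace ToricSurface

variable {k : Type u} [Field k] (S : ToricSurface k)

lemma torus_str : S.torus ≫ S.str =
    Spec.map (CommRingCat.ofHom (algebraMap k (LaurentRing k))) := by
  rw [← S.torusInclusion_chart 0, Category.assoc, S.chart_str, torusInclusion, ← Spec.map_comp,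
    ← CommRingCat.ofHom_comp]
  congr 2
  ext r
  simp

/-- The function field is generated by two characters that form a basis. -/
lemma closure_characters_eq_top {m m' : ℤ × ℤ} (h : ∀ x : ℤ × ℤ, ∃ a b : ℤ, x = a • m + b • m') :
    Subfield.closure (Set.range (constants S.str (genericPoint S.X)) ∪
      {S.character m, S.character m'}) = ⊤ := by
  set F := Subfield.closure (Set.range (constants S.str (genericPoint S.X)) ∪
      {S.character m, S.character m'}) with hF
  have hk : ∀ r, chartToField S.torus (algebraMap k (LaurentRing k) r) ∈ F := fun r => by
    refine Subfield.subset_closure (Or.inl ⟨r, ?_⟩)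
    exact constants_eq_chartGerm S.torus S.str S.torus_str _ (genericPoint_mem_range S.torus) r
  have hz : ∀ (x : ℤ × ℤ), S.character x ∈ F → ∀ a : ℤ, S.character (a • x) ∈ F := by
    intro x hx a
    have hn : ∀ n : ℕ, S.character (n • x) ∈ F := fun n => by
      induction n with
      | zero => rw [zero_smul, character_zero]; exact one_mem F
      | succ n ih => rw [succ_nsmul, character_add]; exact mul_mem ih hx
    rcases Int.eq_nat_or_neg a with ⟨n, rfl | rfl⟩
    · rw [natCast_zsmul]; exact hn n
    · rw [neg_smul, natCast_zsmul, character_neg]; exact inv_mem (hn n)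
  have hchar : ∀ x, S.character x ∈ F := fun x => by
    obtain ⟨a, b, rfl⟩ := h x
    rw [character_add]
    exact mul_mem (hz _ (Subfield.subset_closure (Or.inr (Or.inl rfl))) a)
      (hz _ (Subfield.subset_closure (Or.inr (Or.inr rfl))) b)
  have hA : ∀ a : LaurentRing k, chartToField S.torus a ∈ F := fun a => by
    induction a using AddMonoidAlgebra.induction_linear with
    | zero => rw [map_zero]; exact zero_mem F
    | add a b ha hb => rw [map_add]; exact add_mem ha hb
    | single x r =>
      have h1 : (AddMonoidAlgebra.single x r : LaurentRing k) =
          algebraMap k (LaurentRing k) r * AddMonoidAlgebra.single x 1 := by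
        simp [AddMonoidAlgebra.single_mul_single]
      rw [h1, map_mul]
      exact mul_mem (hk r) (hchar x)
  rw [eq_top_iff]
  intro z _
  obtain ⟨a, s, -, rfl⟩ := chartToField_surj S.torus z
  exact div_mem (hA a) (hA s)

/-- A character that does not change sign on any cone is a morphism to the projective line. -/
lemma exists_algebraMap_eq_character {m : ℤ × ℤ}
    (h : ∀ l, 0 ≤ pairing m (S.fan.ray l) * pairing m (S.fan.ray (l + 1))) (x : S.X) :
    ∃ a : S.X.presheaf.stalk x, algebraMap _ S.X.functionField a = S.character m ∨
      algebraMap _ S.X.functionField a = (S.character m)⁻¹ := by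
  obtain ⟨l, P, rfl⟩ := S.covers x
  have key : ∀ m', m' ∈ dualMonoid (S.fan.ray l) (S.fan.ray (l + 1)) →
      ∃ a : S.X.presheaf.stalk (S.chart l P), algebraMap _ S.X.functionField a = S.character m' :=
    fun m' hm => ⟨chartGerm (S.chart l) _ (Set.mem_range_self P) (monomial m' hm), by
      rw [algebraMap_chartGerm, chartToField_monomial]⟩
  rcases mul_nonneg_iff.mp (h l) with h1 | h1
  · obtain ⟨a, ha⟩ := key m h1
    exact ⟨a, Or.inl ha⟩
  · obtain ⟨a, ha⟩ := key (-m) (by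
      constructor <;> rw [pairing_neg]
      exacts [neg_nonneg.mpr h1.1, neg_nonneg.mpr h1.2])
    exact ⟨a, Or.inr (by rw [ha, character_neg])⟩

lemma perp_neg (v : ℤ × ℤ) : perp (-v) = -perp v := by simp [perp]

variable {S} (hS : ∀ i, det (S.fan.ray i) (S.fan.ray (i + 1)) = 1)
include hS

/-- A character that vanishes on two opposite rays defines a fibration. -/
lemma isP1Fibration_character {p q : ℤ} (hpq : S.fan.ray q = -S.fan.ray p) {m : ℤ × ℤ}
    (hm : m = perp (S.fan.ray p) ∨ m = -perp (S.fan.ray p)) :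
    IsP1Fibration S.str (S.character m) := by
  refine ⟨S.exists_algebraMap_eq_character fun l => ?_,
    S.character (perp (S.fan.ray (p + 1))), S.closure_characters_eq_top fun x => ?_⟩
  -- If the sign changed across a cone, v_p or its negative v_q would lie in the cone without being
  -- an edge.
  · have h0 : 0 ≤ det (S.fan.ray p) (S.fan.ray l) * det (S.fan.ray p) (S.fan.ray (l + 1)) := by
      have key : ∀ r, det (S.fan.ray p) (S.fan.ray r) = 0 →
          det (S.fan.ray p) (S.fan.ray l) * det (S.fan.ray p) (S.fan.ray (l + 1)) < 0 →
          ¬ (0 ≤ det (S.fan.ray l) (S.fan.ray r) ∧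
            0 ≤ det (S.fan.ray r) (S.fan.ray (l + 1))) := by
        rintro r hr hlt ⟨h1, h2⟩
        rcases CompleteFan.dvd_or_dvd_of_mem h1 h2 with h | h
        · rw [← CompleteFan.ray_congr h, hr, zero_mul] at hlt
          exact lt_irrefl _ hlt
        · rw [← CompleteFan.ray_congr h, hr, mul_zero] at hlt
          exact lt_irrefl _ hlt
      by_contra! hlt
      rcases mul_neg_iff.mp hlt with ⟨h1, h2⟩ | ⟨h1, h2⟩
      · refine key q (by rw [hpq, det_neg_right, det_self, neg_zero]) hlt ⟨?_, ?_⟩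
        · rw [hpq, det_neg_right, det_swap, neg_neg]; exact h1.le
        · rw [hpq, det_neg_left]; omega
      · refine key p (det_self _) hlt ⟨?_, h2.le⟩
        rw [det_swap]; omega
    rcases hm with rfl | rfl
    · rw [pairing_perp, pairing_perp]; exact h0
    · rw [pairing_neg, pairing_neg, pairing_perp, pairing_perp]; linarith
  · have h1 := hS p
    -- The characters `perp` of v_p and v_{p+1} form a basis of the character lattice because v_p
    -- and v_{p+1} do for vectors.
    have hx : x = (-pairing x (S.fan.ray p)) • perp (S.fan.ray (p + 1)) +
        pairing x (S.fan.ray (p + 1)) • perp (S.fan.ray p) := by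
      refine eq_of_pairing_eq (v := S.fan.ray p) (w := S.fan.ray (p + 1)) (by omega) ?_ ?_
      · rw [pairing_add, pairing_smul, pairing_smul, pairing_perp, pairing_perp, det_self,
          det_swap (S.fan.ray (p + 1)), h1]; ring
      · rw [pairing_add, pairing_smul, pairing_smul, pairing_perp, pairing_perp, det_self, h1]; ring
    rcases hm with rfl | rfl
    · exact ⟨_, _, by rw [add_comm]; exact hx⟩
    · refine ⟨-pairing x (S.fan.ray (p + 1)), -pairing x (S.fan.ray p), ?_⟩
      rw [add_comm, smul_neg, neg_smul (pairing x (S.fan.ray (p + 1))), neg_neg]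
      exact hx

/-- Surfaces whose invariant curves have the self-intersection numbers of a fibred surface, where
`g` is the sequence of multiplicities of the curves in the divisor of the fibration. -/
theorem isFibred_of_hasCycle {a b : ℤ} {F₁ F₂ : List ℤ}
    (h : S.fan.HasCycle (a :: (F₁ ++ b :: F₂))) (g : ℕ → ℤ) (hg0 : g 0 = 0) (hg1 : g 1 = 1)
    (hrec : ∀ (j : ℕ) (_ : j + 2 < (a :: (F₁ ++ b :: F₂)).length),
      g (j + 2) = -(a :: (F₁ ++ b :: F₂))[j + 1] * g (j + 1) - g j)
    (hpos : ∀ j, 0 < j → j < F₁.length + 1 → 0 < g j) (hmid : g (F₁.length + 1) = 0)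
    (hneg : ∀ j, F₁.length + 1 < j → j < (a :: (F₁ ++ b :: F₂)).length → g j < 0) :
    S.IsFibred a F₁ b F₂ := by
  have hlen : F₁.length + 1 < (a :: (F₁ ++ b :: F₂)).length := by simp
  obtain ⟨L, hL⟩ : ∃ L, L = a :: (F₁ ++ b :: F₂) := ⟨_, rfl⟩
  rw [← hL] at h hneg hlen
  simp only [← hL] at hrec
  obtain ⟨hn, p, ε, hε, hc⟩ := h
  have hn3 := CompleteFan.three_le (F := S.fan)
  -- The orientation ε is built in so that the value on the first ray after p is 1, matching g 1 = 1
  -- for either reading direction.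
  set m : ℤ × ℤ := ε • perp (S.fan.ray p) with hm
  have hm' : m = perp (S.fan.ray p) ∨ m = -perp (S.fan.ray p) := by
    rcases hε with rfl | rfl <;> simp [hm]
  have hpair : ∀ j : ℕ, (j < L.length → pairing m (S.fan.ray (p + ε * j)) = g j) ∧
      (j + 1 < L.length → pairing m (S.fan.ray (p + ε * (j + 1 : ℕ))) = g (j + 1)) := by
    intro j
    induction j with
    | zero =>
      refine ⟨fun _ => ?_, fun _ => ?_⟩
      · rw [hg0, hm, pairing_smul, pairing_perp, Nat.cast_zero, mul_zero, add_zero, det_self,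
          mul_zero]
      · rw [hg1, hm, pairing_smul, pairing_perp]
        rcases hε with rfl | rfl
        · simp [hS]
        · have := hS (p - 1)
          rw [sub_add_cancel] at this
          rw [det_swap]
          simpa [sub_eq_add_neg] using this
    | succ j ih =>
      refine ⟨ih.2, fun hj => ?_⟩
      have e1 := ih.1 (by omega)
      have e2 := ih.2 (by omega)
      rw [hrec j hj, ← e1, ← e2, ← hc (j + 1) (by omega)]
      simp only [hm, pairing_smul, pairing_perp]
      have h1 := CompleteFan.det_rec hS (S.fan.ray p) (p + ε * (j + 1 : ℕ))
      rcases hε with rfl | rfl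
      · rw [show p + 1 * ((j + 1 : ℕ) : ℤ) + 1 = p + 1 * ((j + 1 + 1 : ℕ) : ℤ) by push_cast; ring,
          show p + 1 * ((j + 1 : ℕ) : ℤ) - 1 = p + 1 * (j : ℤ) by push_cast; ring] at h1
        rw [h1]; ring
      · rw [show p + -1 * ((j + 1 : ℕ) : ℤ) - 1 = p + -1 * ((j + 1 + 1 : ℕ) : ℤ) by push_cast; ring,
          show p + -1 * ((j + 1 : ℕ) : ℤ) + 1 = p + -1 * (j : ℤ) by push_cast; ring] at h1
        linear_combination -h1
  have hord : ∀ j : ℕ, j < L.length →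
      Scheme.ord (S.character m) (S.divisor (p + ε * j)).1 = g j := fun j hj => by
    rw [ord_character]; exact (hpair j).1 hj
  have hdvd : ∀ i j : ℕ, ((S.fan.n : ℤ) ∣ p + ε * j - (p + ε * i) ↔ (S.fan.n : ℤ) ∣ (j : ℤ) - i) := by
    intro i j
    rcases hε with rfl | rfl
    · rw [show p + 1 * (j : ℤ) - (p + 1 * i) = j - i by ring]
    · rw [show p + -1 * (j : ℤ) - (p + -1 * i) = -(j - i) by ring, dvd_neg]
  have hinj : ∀ i j : ℕ, i < L.length → j < L.length →
      S.divisor (p + ε * i) = S.divisor (p + ε * j) → i = j := by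
    intro i j hi hj h
    rw [divisor_eq_iff, hdvd] at h
    have := Int.eq_zero_of_abs_lt_dvd h (by rw [abs_lt]; omega)
    omega
  have hsurj : ∀ i : ℤ, ∃ j : ℕ, j < L.length ∧ S.divisor i = S.divisor (p + ε * j) := by
    intro i
    have hn0 : (S.fan.n : ℤ) ≠ 0 := by omega
    have h1 := Int.emod_nonneg (ε * (i - p)) hn0
    have h2 := Int.emod_lt_of_pos (ε * (i - p)) (b := S.fan.n) (by omega)
    refine ⟨(ε * (i - p) % S.fan.n).toNat, by omega, ?_⟩
    rw [divisor_eq_iff, Int.toNat_of_nonneg h1, Int.emod_def]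
    have hεε : ε * ε = 1 := by rcases hε with rfl | rfl <;> norm_num
    exact ⟨-ε * (ε * (i - p) / S.fan.n), by linear_combination (i - p) * hεε⟩
  subst hL
  have hcases : ∀ c : PrimeDivisor S.X, S.IsInvariant c ↔
      ∃ j : ℕ, j < (a :: (F₁ ++ b :: F₂)).length ∧ c = S.divisor (p + ε * j) := by
    intro c
    rw [isInvariant_iff]
    constructor
    · rintro ⟨i, rfl⟩
      exact hsurj i
    · rintro ⟨j, -, rfl⟩
      exact ⟨_, rfl⟩
  -- The character is zero again on the second section, so its ray is opposite to v_p.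
  have hopp : S.fan.ray (p + ε * (F₁.length + 1 : ℕ)) = -S.fan.ray p := by
    have h0 := (hpair (F₁.length + 1)).1 hlen
    rw [hmid, hm, pairing_smul, pairing_perp] at h0
    have hε0 : ε ≠ 0 := by rcases hε with rfl | rfl <;> norm_num
    refine CompleteFan.ray_eq_neg_of_det ((mul_eq_zero.mp h0).resolve_left hε0) fun hd => ?_
    have h1 := (hdvd 0 (F₁.length + 1)).mp (by simpa using hd)
    have := Int.eq_zero_of_abs_lt_dvd h1 (by rw [abs_lt]; omega)
    omega
  have hmod : ∀ i j : ℕ, i < (a :: (F₁ ++ b :: F₂)).length → j < (a :: (F₁ ++ b :: F₂)).length →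
      ((i + 1) % (a :: (F₁ ++ b :: F₂)).length = j ↔ (S.fan.n : ℤ) ∣ (j : ℤ) - (i + 1)) := by
    intro i j hi hj
    rw [hn]
    generalize (a :: (F₁ ++ b :: F₂)).length = N at hi hj
    rcases (Nat.succ_le_iff.mpr hi).lt_or_eq with h1 | h1
    · rw [Nat.mod_eq_of_lt h1]
      refine ⟨fun h => by rw [← h]; simp, fun h => ?_⟩
      have := Int.eq_zero_of_abs_lt_dvd h (by rw [abs_lt]; omega)
      omega
    · rw [show i + 1 = N from h1, Nat.mod_self, ← Nat.cast_succ, show i.succ = N from h1,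
        dvd_sub_self_right]
      refine ⟨fun h => by rw [← h]; simp, fun h => ?_⟩
      have := Int.eq_zero_of_abs_lt_dvd h (by rw [abs_lt]; omega)
      omega
  refine ⟨fun j => S.divisor (p + ε * j.1), ?_, ?_, ?_, ?_, S.character m,
    isP1Fibration_character hS hopp hm', ?_, ?_, ?_⟩
  · intro i j hij
    exact Fin.ext (hinj _ _ i.2 j.2 hij)
  · ext c
    rw [Set.mem_ofPred_eq, hcases]
    constructor
    · rintro ⟨j, rfl⟩
      exact ⟨j, j.2, rfl⟩
    · rintro ⟨j, hj, rfl⟩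
      exact ⟨⟨j, hj⟩, rfl⟩
  · intro i
    have := hasSelfIntersection_divisor hS (p + ε * i.1)
    rw [hc i.1 i.2, neg_neg] at this
    exact this
  · intro i j hij
    have hne : ¬ (S.fan.n : ℤ) ∣ p + ε * j.1 - (p + ε * i.1) := fun hd =>
      hij (Fin.ext (hinj _ _ i.2 j.2 ((S.divisor_eq_iff).mpr hd)))
    rw [meets_divisor_iff _ hne]
    have e1 := hmod i.1 j.1 i.2 j.2
    have e2 := hmod j.1 i.1 j.2 i.2
    rw [e1, e2]
    rcases hε with rfl | rfl
    · rw [show p + 1 * (j.1 : ℤ) - (p + 1 * (i.1 : ℤ) + 1) = j.1 - (i.1 + 1) by ring,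
        show p + 1 * (i.1 : ℤ) - (p + 1 * (j.1 : ℤ) + 1) = i.1 - (j.1 + 1) by ring]
    · rw [show p + -1 * (j.1 : ℤ) - (p + -1 * (i.1 : ℤ) + 1) = i.1 - (j.1 + 1) by ring,
        show p + -1 * (i.1 : ℤ) - (p + -1 * (j.1 : ℤ) + 1) = j.1 - (i.1 + 1) by ring, or_comm]
  · rintro i (hi | hi)
    · refine isSection_divisor hS _ ?_
      rw [hi, Nat.cast_zero, mul_zero, add_zero]
      exact hm'
    · refine isSection_divisor hS _ ?_
      rw [hi, hopp, perp_neg, neg_neg, or_comm]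
      exact hm'
  · intro c
    constructor
    · intro hc0
      by_cases hinv : S.IsInvariant c
      · obtain ⟨j, hj, rfl⟩ := (hcases c).mp hinv
        rw [hord j hj] at hc0
        refine ⟨⟨j, hj⟩, ?_, ?_, rfl⟩
        · exact Nat.pos_of_ne_zero fun h0 => by
            rw [show j = 0 from h0, hg0] at hc0; exact lt_irrefl _ hc0
        · by_contra! hle
          rcases hle.lt_or_eq with h1 | h1
          · exact absurd (hneg j h1 hj) (by omega)
          · rw [← show F₁.length + 1 = j from h1, hmid] at hc0
            exact lt_irrefl _ hc0
      · rw [S.ord_character_torus m (by simpa [IsInvariant] using hinv) c.2] at hc0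
        exact absurd hc0 (lt_irrefl _)
    · rintro ⟨i, h1, h2, rfl⟩
      rw [hord _ i.2]
      exact hpos _ h1 h2
  · intro c
    constructor
    · intro hc0
      by_cases hinv : S.IsInvariant c
      · obtain ⟨j, hj, rfl⟩ := (hcases c).mp hinv
        rw [hord j hj] at hc0
        refine ⟨⟨j, hj⟩, ?_, rfl⟩
        by_contra! hle
        rcases hle.lt_or_eq with h1 | h1
        · rcases Nat.eq_zero_or_pos j with h2 | h2
          · rw [h2, hg0] at hc0; exact lt_irrefl _ hc0
          · exact absurd (hpos j h2 h1) (by omega)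
        · rw [show j = F₁.length + 1 from h1, hmid] at hc0
          exact lt_irrefl _ hc0
      · rw [S.ord_character_torus m (by simpa [IsInvariant] using hinv) c.2] at hc0
        exact absurd hc0 (lt_irrefl _)
    · rintro ⟨i, h1, rfl⟩
      rw [hord _ i.2]
      exact hneg _ h1 i.2

end ToricSurface

/-! ### Gluing isomorphisms of charts -/

section Gluing

lemma hom_ext_of_charts {X Y : Scheme.{u}} {ι : Type*} {U : ι → Scheme.{u}} (c : ∀ i, U i ⟶ X)
    [∀ i, IsOpenImmersion (c i)] (hc : ∀ x : X, ∃ i, x ∈ Set.range (c i)) {f g : X ⟶ Y}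
    (h : ∀ i, c i ≫ f = c i ≫ g) : f = g := by
  let 𝒰 : X.OpenCover := Scheme.Cover.mkOfCovers ι U c
    (fun x => by obtain ⟨i, y, hy⟩ := hc x; exact ⟨i, y, hy⟩) inferInstance
  exact Scheme.Cover.hom_ext 𝒰 f g h

variable {X Y T B : Scheme.{u}} {ι : Type*} {U : ι → Scheme.{u}} [∀ i, IsReduced (U i)]
  (t : ∀ i, T ⟶ U i) [∀ i, IsDominant (t i)] (c : ∀ i, U i ⟶ X) [∀ i, IsOpenImmersion (c i)]
  (d : ∀ i, U i ⟶ Y) {s : X ⟶ B} {s' : Y ⟶ B}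

/-- Two families of charts that agree on a common dense open subset define a morphism. -/
lemma exists_hom_of_charts [IsSeparated s'] (hc : ∀ x : X, ∃ i, x ∈ Set.range (c i))
    (hs : ∀ i, c i ≫ s = d i ≫ s') (htc : ∀ i j, t i ≫ c i = t j ≫ c j)
    (htd : ∀ i j, t i ≫ d i = t j ≫ d j) : ∃ f : X ⟶ Y, ∀ i, c i ≫ f = d i := by
  suffices H : ∀ i j, Limits.pullback.fst (c i) (c j) ≫ d i =
      Limits.pullback.snd (c i) (c j) ≫ d j by
    let 𝒰 : X.OpenCover := Scheme.Cover.mkOfCovers ι U c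
      (fun x => by obtain ⟨i, y, hy⟩ := hc x; exact ⟨i, y, hy⟩) inferInstance
    exact ⟨Scheme.Cover.glueMorphisms 𝒰 d H, Scheme.Cover.ι_glueMorphisms 𝒰 d H⟩
  intro i j
  have hr : IsReduced (Limits.pullback (c i) (c j)) :=
    isReduced_of_isOpenImmersion (Limits.pullback.fst (c i) (c j))
  -- The common dense open T lies densely in the overlap of two charts. The overlap is reduced and
  -- the target is separated, so agreement on T suffices.
  have hdom : IsDominant (Limits.pullback.lift (t i) (t j) (htc i j)) := by
    have : IsDominant (Limits.pullback.lift (t i) (t j) (htc i j) ≫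
        Limits.pullback.fst (c i) (c j)) := by
      rw [Limits.pullback.lift_fst]; infer_instance
    exact IsDominant.of_comp_of_isOpenImmersion _ (Limits.pullback.fst (c i) (c j))
  refine ext_of_isDominant_of_isSeparated s' ?_ (Limits.pullback.lift (t i) (t j) (htc i j)) ?_
  · rw [Category.assoc, Category.assoc, ← hs, ← hs, Limits.pullback.condition_assoc]
  · rw [Limits.pullback.lift_fst_assoc, Limits.pullback.lift_snd_assoc, htd i j]

/-- Separated schemes with the same charts, glued compatibly with a common dense open subset, are
isomorphic. -/
lemma exists_iso_of_charts [IsSeparated s] [IsSeparated s'] [∀ i, IsOpenImmersion (d i)]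
    (hc : ∀ x : X, ∃ i, x ∈ Set.range (c i)) (hd : ∀ y : Y, ∃ i, y ∈ Set.range (d i))
    (hs : ∀ i, c i ≫ s = d i ≫ s') (htc : ∀ i j, t i ≫ c i = t j ≫ c j)
    (htd : ∀ i j, t i ≫ d i = t j ≫ d j) : ∃ e : X ≅ Y, e.hom ≫ s' = s := by
  obtain ⟨f, hf⟩ := exists_hom_of_charts t c d hc hs htc htd
  obtain ⟨g, hg⟩ := exists_hom_of_charts t d c hd (fun i => (hs i).symm) htd htc
  refine ⟨⟨f, g, hom_ext_of_charts c hc fun i => ?_, hom_ext_of_charts d hd fun i => ?_⟩,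
    hom_ext_of_charts c hc fun i => ?_⟩
  · rw [reassoc_of% hf, hg, Category.comp_id]
  · rw [reassoc_of% hg, hf, Category.comp_id]
  · rw [reassoc_of% hf, hs]

end Gluing

/-! ### The projective plane -/

section PlaneCharts

open HomogeneousLocalization MvPolynomial

variable {k : Type u} [Field k] (e : Fin 3 → ℤ × ℤ)

lemma X_mem_homogeneousSubmodule (l : Fin 3) :
    (X l : MvPolynomial (Fin 3) k) ∈ homogeneousSubmodule (Fin 3) k 1 :=
  isHomogeneous_X k l

/-- The homogeneous coordinates of the projective plane as characters of a torus. -/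
noncomputable def planeCharacters : MvPolynomial (Fin 3) k →ₐ[k] LaurentRing k :=
  aeval fun l => AddMonoidAlgebra.single (e l) 1

lemma isUnit_single (m : ℤ × ℤ) : IsUnit (AddMonoidAlgebra.single m (1 : k)) :=
  IsUnit.of_mul_eq_one (AddMonoidAlgebra.single (-m) 1) (by
    rw [AddMonoidAlgebra.single_mul_single, add_neg_cancel, one_mul]; rfl)

lemma isUnit_planeCharacters_X (l : Fin 3) : IsUnit (planeCharacters (k := k) e (X l)) := by
  rw [planeCharacters, aeval_X]; exact isUnit_single _

/-- The restriction to the torus of functions on a distinguished open set of the plane. -/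
noncomputable def planeRestrict {g : MvPolynomial (Fin 3) k}
    (hg : IsUnit (planeCharacters e g)) :
    Away (homogeneousSubmodule (Fin 3) k) g →+* LaurentRing k :=
  (Localization.awayLift (planeCharacters (k := k) e).toRingHom g hg).comp
    (algebraMap (Away (homogeneousSubmodule (Fin 3) k) g) (Localization.Away g))

/-- Both sides substitute the characters for the homogeneous coordinates, so they agree on the
localization at g. -/
lemma planeRestrict_comp_awayMap {g g' x : MvPolynomial (Fin 3) k} {n : ℕ}
    (hg' : g' ∈ homogeneousSubmodule (Fin 3) k n) (hx : x = g * g')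
    (hu : IsUnit (planeCharacters e g)) (hu' : IsUnit (planeCharacters e x)) :
    (planeRestrict e hu').comp (awayMap (homogeneousSubmodule (Fin 3) k) hg' hx) =
      planeRestrict e hu := by
  have h : (Localization.awayLift (planeCharacters (k := k) e).toRingHom x hu').comp
      (Localization.awayLift (algebraMap (MvPolynomial (Fin 3) k) (Localization.Away x)) g
        (isUnit_of_dvd_unit (map_dvd _ ⟨_, hx⟩) (IsLocalization.Away.algebraMap_isUnit x))) =
      Localization.awayLift (planeCharacters (k := k) e).toRingHom g hu :=
    IsLocalization.ringHom_ext (Submonoid.powers g)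
      (RingHom.ext fun p => by simp [Localization.awayLift])
  ext1 a
  have := congr($h a.val)
  rw [RingHom.comp_apply] at this
  rw [RingHom.comp_apply, planeRestrict, planeRestrict, RingHom.comp_apply, RingHom.comp_apply,
    HomogeneousLocalization.algebraMap_apply, HomogeneousLocalization.algebraMap_apply, val_awayMap]
  exact this

/-- Both maps factor through the overlap where X 0 and X l are invertible, so the torus embeds in
the plane independently of the chart. -/
lemma torus_awayι {l : Fin 3} :
    Spec.map (CommRingCat.ofHom (planeRestrict (k := k) e (isUnit_planeCharacters_X e l))) ≫
      Proj.awayι (homogeneousSubmodule (Fin 3) k) (X l) (X_mem_homogeneousSubmodule l) one_pos =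
    Spec.map (CommRingCat.ofHom (planeRestrict (k := k) e (isUnit_planeCharacters_X e 0))) ≫
      Proj.awayι (homogeneousSubmodule (Fin 3) k) (X 0) (X_mem_homogeneousSubmodule 0) one_pos := by
  have hu : IsUnit (planeCharacters (k := k) e (X 0 * X l)) := by
    rw [map_mul]; exact (isUnit_planeCharacters_X e 0).mul (isUnit_planeCharacters_X e l)
  rw [← planeRestrict_comp_awayMap e (X_mem_homogeneousSubmodule l) rfl _ hu,
    ← planeRestrict_comp_awayMap e (X_mem_homogeneousSubmodule 0) (mul_comm _ _) _ hu,
    CommRingCat.ofHom_comp, CommRingCat.ofHom_comp, Spec.map_comp, Spec.map_comp, Category.assoc,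
    Category.assoc, Proj.SpecMap_awayMap_awayι, Proj.SpecMap_awayMap_awayι]

lemma eval₂_mul_of_isHomogeneous {σ R A : Type*} [CommSemiring R] [CommSemiring A] (f : R →+* A)
    (g : σ → A) (s : A) {p : MvPolynomial σ R} {n : ℕ} (hp : p.IsHomogeneous n) :
    eval₂ f (fun i => s * g i) p = s ^ n * eval₂ f g p := by
  rw [eval₂_eq, eval₂_eq, Finset.mul_sum]
  refine Finset.sum_congr rfl fun d hd => ?_
  have hn : ∑ i ∈ d.support, d i = n := by
    rw [← hp (mem_support_iff.mp hd)]; simp [Finsupp.weight_apply, Finsupp.sum]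
  simp only [mul_pow, Finset.prod_mul_distrib, Finset.prod_pow_eq_pow_sum, hn]
  ring

/-- The ratio of two homogeneous coordinates. -/
noncomputable def coordinateRatio (l i : Fin 3) : Away (homogeneousSubmodule (Fin 3) k) (X l) :=
  Away.mk _ (X_mem_homogeneousSubmodule l) 1 (X i) (by simpa using X_mem_homogeneousSubmodule i)

/-- The constants on a distinguished open set of the plane. -/
noncomputable def planeConstants (g : MvPolynomial (Fin 3) k) :
    k →+* Away (homogeneousSubmodule (Fin 3) k) g :=
  (fromZeroRingHom (homogeneousSubmodule (Fin 3) k) _).comp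
    (algebraMap k (homogeneousSubmodule (Fin 3) k 0))

lemma val_planeConstants (g : MvPolynomial (Fin 3) k) (a : k) :
    (planeConstants g a).val = algebraMap (MvPolynomial (Fin 3) k) (Localization.Away g) (C a) := by
  rw [planeConstants, RingHom.comp_apply]
  rfl

lemma mul_val_coordinateRatio (l i : Fin 3) :
    algebraMap (MvPolynomial (Fin 3) k) (Localization.Away (X l)) (X l) *
      (coordinateRatio (k := k) l i).val =
      algebraMap (MvPolynomial (Fin 3) k) _ (X i) := by
  rw [coordinateRatio, Away.val_mk, ← Localization.mk_one_eq_algebraMap, Localization.mk_mul,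
    ← Localization.mk_one_eq_algebraMap, Localization.mk_eq_mk_iff, Localization.r_iff_exists]
  exact ⟨1, by simp [mul_comm]⟩

lemma coordinateRatio_self (l : Fin 3) : coordinateRatio (k := k) l l = 1 := by
  apply val_injective
  rw [coordinateRatio, Away.val_mk, val_one, ← Localization.mk_one, Localization.mk_eq_mk_iff,
    Localization.r_iff_exists]
  exact ⟨1, by simp⟩

/-- Dehomogenization: a form of degree n divided by the n-th power of a coordinate is the form
evaluated at the coordinate ratios. -/
lemma eq_eval₂_coordinateRatio (l : Fin 3) (n : ℕ) (p : MvPolynomial (Fin 3) k)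
    (hp : p ∈ homogeneousSubmodule (Fin 3) k (n • 1)) :
    Away.mk _ (X_mem_homogeneousSubmodule l) n p hp =
      eval₂ (planeConstants (X l)) (coordinateRatio l) p := by
  apply val_injective
  have h1 : algebraMap (MvPolynomial (Fin 3) k) (Localization.Away (X l)) p =
      algebraMap (MvPolynomial (Fin 3) k) _ (X l) ^ n *
        (eval₂ (planeConstants (X l)) (coordinateRatio l) p).val := by
    have h2 := eval₂_mul_of_isHomogeneous
      ((algebraMap _ (Localization.Away (X l : MvPolynomial (Fin 3) k))).comp
        (planeConstants (k := k) (X l)))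
      (fun i => (coordinateRatio l i).val) (algebraMap (MvPolynomial (Fin 3) k) _ (X l))
      (n := n) (by simpa using hp)
    simp only [mul_val_coordinateRatio] at h2
    rw [← HomogeneousLocalization.algebraMap_apply, hom_eval₂]
    refine Eq.trans ?_ h2
    conv_lhs => rw [← eval₂_eta p, hom_eval₂]
    rfl
  have hu : IsUnit (algebraMap (MvPolynomial (Fin 3) k) (Localization.Away (X l)) (X l) ^ n) :=
    (IsLocalization.Away.algebraMap_isUnit (S := Localization.Away (X l : MvPolynomial (Fin 3) k))
      (X l : MvPolynomial (Fin 3) k)).pow n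
  apply hu.mul_left_cancel
  rw [← h1, Away.val_mk, ← map_pow, ← Localization.mk_one_eq_algebraMap, Localization.mk_mul,
    ← Localization.mk_one_eq_algebraMap, Localization.mk_eq_mk_iff, Localization.r_iff_exists]
  exact ⟨1, by simp [mul_comm]⟩

lemma planeRestrict_coordinateRatio (l i : Fin 3) :
    planeRestrict (k := k) e (isUnit_planeCharacters_X e l) (coordinateRatio l i) =
      AddMonoidAlgebra.single (e i - e l) 1 := by
  have h := congr(Localization.awayLift (planeCharacters (k := k) e).toRingHom (X l)
    (isUnit_planeCharacters_X e l) $(mul_val_coordinateRatio l i))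
  rw [map_mul] at h
  simp only [Localization.awayLift, IsLocalization.Away.lift_eq] at h
  apply (isUnit_planeCharacters_X (k := k) e l).mul_left_cancel
  refine h.trans ?_
  simp [planeCharacters, AddMonoidAlgebra.single_mul_single]

lemma planeRestrict_planeConstants {g : MvPolynomial (Fin 3) k}
    (hg : IsUnit (planeCharacters e g)) (a : k) :
    planeRestrict e hg (planeConstants g a) = algebraMap k _ a := by
  rw [planeRestrict, RingHom.comp_apply, HomogeneousLocalization.algebraMap_apply,
    val_planeConstants, Localization.awayLift, IsLocalization.Away.lift_eq]
  simp [planeCharacters]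

variable {e}

/-- The cone spanned by `v` and `w` corresponds to the chart of the plane where the coordinate
with index `l` does not vanish: the characters of the other two coordinates, divided by that one,
form the dual basis of `v` and `w`. -/
structure IsPlaneCone (e : Fin 3 → ℤ × ℤ) (l i j : Fin 3) (v w : ℤ × ℤ) : Prop where
  det_ne_zero : det v w ≠ 0
  pairing_left : pairing (e i - e l) v = 1 ∧ pairing (e i - e l) w = 0
  pairing_right : pairing (e j - e l) v = 0 ∧ pairing (e j - e l) w = 1
  eq_or_eq : ∀ t : Fin 3, t = l ∨ t = i ∨ t = j

variable {l i j : Fin 3} {v w : ℤ × ℤ}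

/-- The functions on a toric chart as functions on a chart of the plane. -/
noncomputable def coneToPlane (k : Type u) [Field k] (l i j : Fin 3) (v w : ℤ × ℤ) :
    ConeRing k v w →+* Away (homogeneousSubmodule (Fin 3) k) (X l) :=
  AddMonoidAlgebra.liftNCRingHom (planeConstants (X l))
    { toFun := fun m => coordinateRatio l i ^ (pairing m.toAdd.1 v).toNat *
        coordinateRatio l j ^ (pairing m.toAdd.1 w).toNat
      map_one' := by simp [pairing_zero]
      map_mul' := fun m m' => by
        simp only [toAdd_mul, AddSubmonoid.coe_add, pairing_add]
        rw [Int.toNat_add m.toAdd.2.1 m'.toAdd.2.1, Int.toNat_add m.toAdd.2.2 m'.toAdd.2.2]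
        ring }
    (fun _ _ => Commute.all _ _)

lemma coneToPlane_single (m : dualMonoid v w) (a : k) :
    coneToPlane k l i j v w (AddMonoidAlgebra.single m a) = planeConstants (X l) a *
      (coordinateRatio l i ^ (pairing m.1 v).toNat *
        coordinateRatio l j ^ (pairing m.1 w).toNat) :=
  AddMonoidAlgebra.liftNCRingHom_single _ _ _ _ _

namespace IsPlaneCone

variable (h : IsPlaneCone e l i j v w)
include h

lemma planeRestrict_comp_coneToPlane :
    (planeRestrict e (isUnit_planeCharacters_X e l)).comp (coneToPlane k l i j v w) =
      toLaurent k v w := by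
  refine AddMonoidAlgebra.ringHom_ext (fun a => ?_) (fun m => ?_)
  · rw [RingHom.comp_apply, coneToPlane_single, map_mul, planeRestrict_planeConstants]
    simp [pairing_zero]
  · rw [RingHom.comp_apply, coneToPlane_single, map_mul, planeRestrict_planeConstants, map_mul,
      map_pow, map_pow, planeRestrict_coordinateRatio, planeRestrict_coordinateRatio,
      AddMonoidAlgebra.single_pow, AddMonoidAlgebra.single_pow, AddMonoidAlgebra.single_mul_single,
      show (pairing m.1 v).toNat • (e i - e l) + (pairing m.1 w).toNat • (e j - e l) = m.1 from
        eq_of_pairing_eq h.det_ne_zero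
        (by rw [pairing_add, pairing_nsmul, pairing_nsmul, h.pairing_left.1, h.pairing_right.1,
          Int.toNat_of_nonneg m.2.1]; ring)
        (by rw [pairing_add, pairing_nsmul, pairing_nsmul, h.pairing_left.2, h.pairing_right.2,
          Int.toNat_of_nonneg m.2.2]; ring)]
    simp

/-- Restriction to the torus factors through this map and is itself injective. -/
lemma coneToPlane_injective : Function.Injective (coneToPlane k l i j v w) := by
  have h1 := toLaurent_injective k v w
  rw [← h.planeRestrict_comp_coneToPlane, RingHom.coe_comp] at h1
  exact h1.of_comp

lemma coordinateRatio_mem_range (t : Fin 3) :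
    coordinateRatio l t ∈ (coneToPlane k l i j v w).range := by
  obtain rfl | rfl | rfl := h.eq_or_eq t
  · rw [coordinateRatio_self]; exact one_mem _
  · refine ⟨SurfaceGeometry.monomial (e t - e l) ⟨by rw [h.pairing_left.1]; norm_num, h.pairing_left.2.ge⟩, ?_⟩
    refine (coneToPlane_single _ _).trans ?_
    simp [h.pairing_left]
  · refine ⟨SurfaceGeometry.monomial (e t - e l) ⟨h.pairing_right.1.ge, by rw [h.pairing_right.2]; norm_num⟩, ?_⟩
    refine (coneToPlane_single _ _).trans ?_
    simp [h.pairing_right]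

/-- The functions on the affine chart are polynomials in the coordinate ratios, and each ratio is
the image of a monomial of the dual basis. -/
lemma coneToPlane_surjective : Function.Surjective (coneToPlane k l i j v w) := by
  intro x
  obtain ⟨n, p, hp, rfl⟩ := Away.mk_surjective _ (X_mem_homogeneousSubmodule l) x
  rw [eq_eval₂_coordinateRatio]
  refine eval₂_mem (s := (coneToPlane k l i j v w).range) (fun d _ => ?_)
    h.coordinateRatio_mem_range
  exact ⟨AddMonoidAlgebra.single 0 (p.coeff d), by
    rw [coneToPlane_single]; simp [pairing_zero]⟩

/-- A toric chart as a chart of the projective plane. -/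
noncomputable def planeChart : affineToric k v w ⟶ projectivePlane k :=
  Spec.map (RingEquiv.toCommRingCatIso (RingEquiv.ofBijective (coneToPlane k l i j v w)
    ⟨h.coneToPlane_injective, h.coneToPlane_surjective⟩)).inv ≫
    Proj.awayι _ (X l) (X_mem_homogeneousSubmodule l) one_pos

lemma isOpenImmersion_planeChart : IsOpenImmersion (h.planeChart (k := k)) := by
  unfold planeChart
  infer_instance

lemma range_planeChart : Set.range (h.planeChart (k := k)) =
    Proj.basicOpen (homogeneousSubmodule (Fin 3) k) (X l) := by
  rw [planeChart, Scheme.Hom.comp_base, TopCat.coe_comp, Set.range_comp,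
    Set.range_eq_univ.mpr (Scheme.Hom.surjective _), Set.image_univ,
    ← Proj.opensRange_awayι _ (X l) (X_mem_homogeneousSubmodule l) one_pos]
  rfl

lemma torusInclusion_planeChart : torusInclusion k v w ≫ h.planeChart =
    Spec.map (CommRingCat.ofHom (planeRestrict (k := k) e (isUnit_planeCharacters_X e l))) ≫
      Proj.awayι _ (X l) (X_mem_homogeneousSubmodule l) one_pos := by
  rw [planeChart, ← Category.assoc, torusInclusion, ← Spec.map_comp]
  congr 2
  rw [Iso.inv_comp_eq]
  refine CommRingCat.hom_ext ?_
  exact h.planeRestrict_comp_coneToPlane.symm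

lemma planeChart_str : h.planeChart ≫ projectivePlaneStr k =
    Spec.map (CommRingCat.ofHom (algebraMap k (ConeRing k v w))) := by
  rw [planeChart, projectivePlaneStr, Category.assoc, Proj.awayι_toSpecZero_assoc, ← Spec.map_comp,
    ← Spec.map_comp]
  congr 1
  rw [Iso.comp_inv_eq]
  refine CommRingCat.hom_ext (RingHom.ext fun a => ?_)
  change planeConstants (X l) a = coneToPlane k l i j v w (AddMonoidAlgebra.single 0 a)
  rw [coneToPlane_single]
  simp [pairing_zero]

end IsPlaneCone

lemma exists_mem_basicOpen_X (x : projectivePlane k) :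
    ∃ l, x ∈ Proj.basicOpen (homogeneousSubmodule (Fin 3) k) (X l) := by
  have h := Proj.iSup_basicOpen_eq_top' (homogeneousSubmodule (Fin 3) k)
    (fun l : Fin 3 => X l) (fun l => ⟨1, X_mem_homogeneousSubmodule l⟩) (by
      rw [eq_top_iff]
      intro p _
      induction p using MvPolynomial.induction_on with
      | C a =>
        exact algebraMap_mem (Algebra.adjoin (homogeneousSubmodule (Fin 3) k 0) _)
          (⟨C a, isHomogeneous_C (Fin 3) a⟩ : homogeneousSubmodule (Fin 3) k 0)
      | add p q hp hq => exact add_mem (hp trivial) (hq trivial)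
      | mul_X p l hp => exact mul_mem (hp trivial) (Algebra.subset_adjoin ⟨l, rfl⟩))
  have hx : x ∈ ⨆ l : Fin 3, Proj.basicOpen (homogeneousSubmodule (Fin 3) k) (X l) := by
    rw [h]; trivial
  exact TopologicalSpace.Opens.mem_iSup.mp hx

end PlaneCharts

/-! ### The fan of the projective plane -/

namespace ToricSurface

variable {k : Type u} [Field k] (S : ToricSurface k)

theorem isP2_of_n_eq_three (hS : ∀ i, det (S.fan.ray i) (S.fan.ray (i + 1)) = 1)
    (hn : S.fan.n = 3) : S.IsP2 := by
  have h3 : S.fan.ray 3 = S.fan.ray 0 := CompleteFan.ray_congr (by rw [hn]; norm_num)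
  have d0 : det (S.fan.ray 0) (S.fan.ray 1) = 1 := hS 0
  have d1 : det (S.fan.ray 1) (S.fan.ray 2) = 1 := hS 1
  have d2 : det (S.fan.ray 2) (S.fan.ray 3) = 1 := hS 2
  rw [h3] at d2
  have h2 : S.fan.ray 2 = -S.fan.ray 0 - S.fan.ray 1 := by
    refine eq_of_det_eq (by rw [d0]; norm_num) ?_ ?_
    · rw [det_swap, d2]; simp only [det, Prod.fst_sub, Prod.snd_sub, Prod.fst_neg, Prod.snd_neg] at *
      linarith
    · rw [d1]; simp only [det, Prod.fst_sub, Prod.snd_sub, Prod.fst_neg, Prod.snd_neg] at *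
      linarith
  -- The dual basis of v_0 and v_1, completed by zero: only differences of these characters matter,
  -- so one coordinate can be normalized to the trivial character.
  let e : Fin 3 → ℤ × ℤ := ![-perp (S.fan.ray 1), perp (S.fan.ray 0), 0]
  have H0 : IsPlaneCone e 2 0 1 (S.fan.ray 0) (S.fan.ray 1) := by
    refine ⟨by rw [d0]; norm_num, ?_, ?_, by decide⟩ <;>
      simp [e, pairing, perp, det] at * <;> constructor <;> linarith
  have H1 : IsPlaneCone e 0 1 2 (S.fan.ray 1) (S.fan.ray 2) := by
    refine ⟨by rw [d1]; norm_num, ?_, ?_, by decide⟩ <;> rw [h2] <;>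
      simp [e, pairing, perp, det] at * <;> constructor <;> linarith
  have H2 : IsPlaneCone e 1 2 0 (S.fan.ray 2) (S.fan.ray 3) := by
    refine ⟨by rw [h3, d2]; norm_num, ?_, ?_, by decide⟩ <;> rw [h2, h3] <;>
      simp [e, pairing, perp, det] at * <;> constructor <;> linarith
  -- The i-th cone is the chart where the coordinate with index i + 2 modulo 3 does not vanish.
  have H : ∀ i : Fin 3, IsPlaneCone e (i + 2) i (i + 1) (S.fan.ray (i : ℕ))
      (S.fan.ray ((i : ℕ) + 1)) := by
    intro i
    fin_cases i
    exacts [H0, H1, H2]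
  have (i : Fin 3) : IsOpenImmersion ((H i).planeChart (k := k)) := (H i).isOpenImmersion_planeChart
  have : IsSeparated (projectivePlaneStr k) := by unfold projectivePlaneStr; infer_instance
  refine exists_iso_of_charts
    (fun i : Fin 3 => torusInclusion k (S.fan.ray (i : ℕ)) (S.fan.ray ((i : ℕ) + 1)))
    (fun i => S.chart (i : ℕ)) (fun i => (H i).planeChart) ?_ ?_ ?_ ?_ ?_
  · intro x
    obtain ⟨j, P, rfl⟩ := S.covers x
    have hj := Int.emod_nonneg j (show (3 : ℤ) ≠ 0 by norm_num)
    have hj' := Int.emod_lt_of_pos j (show (0 : ℤ) < 3 by norm_num)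
    obtain ⟨r, hr⟩ := Int.eq_ofNat_of_zero_le hj
    have hdvd : ((S.fan.n : ℕ) : ℤ) ∣ (r : ℤ) - j := by rw [hn, ← hr]; push_cast; omega
    obtain ⟨Q, hQ⟩ := S.exists_chart_eq (l := j) (i := r) (CompleteFan.ray_congr hdvd).symm
      (CompleteFan.ray_congr (by rwa [add_sub_add_right_eq_sub])).symm P
    exact ⟨⟨r, by omega⟩, Q, hQ.symm⟩
  · intro y
    obtain ⟨l, hl⟩ := exists_mem_basicOpen_X y
    refine ⟨l - 2, ?_⟩
    rw [(H (l - 2)).range_planeChart, sub_add_cancel]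
    exact hl
  · intro i
    rw [S.chart_str, (H i).planeChart_str]
  · intro i j
    rw [S.torusInclusion_chart, S.torusInclusion_chart]
  · intro i j
    rw [(H i).torusInclusion_planeChart, (H j).torusInclusion_planeChart, torus_awayι e (l := i + 2),
      torus_awayι e (l := j + 2)]

end ToricSurface

end SurfaceGeometry

/-! ### Assembly: from cycles of coefficients to fibred surfaces -/

theorem mainTheorem3 {k : Type u} [Field k] [IsAlgClosed k] [CharZero k]
    (S S' : ToricSurface k) (hS : S.IsLogDelPezzo) (hρ : picardNumber S.X = 1)
    (f : S'.X ⟶ S.X) (hf : IsMinimalResolution f) (hbasic : S'.IsBasic) :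
    S'.IsP2 ∨
    (∃ n : ℤ, 2 ≤ n ∧ S'.IsStd0 n) ∨
    (∃ n : ℤ, 2 ≤ n ∧ S'.IsStd1 n) ∨
    (∃ n : ℤ, 2 ≤ n ∧ S'.IsStd2 n) ∨
    S'.Is3A2 := by
  have hdet := S'.det_eq_one hf.smooth
  obtain h | ⟨n, hn, h⟩ | ⟨n, hn, h⟩ | ⟨n, hn, h⟩ | h :=
    (ToricSurface.basicFan hρ hf hbasic).classification
  · exact Or.inl (S'.isP2_of_n_eq_three hdet h)
  -- The explicit lists, here and below, are the values of the fibration character along the cycle: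
  -- zero on the sections, positive multiplicities on one fibre, negative ones on the other. The
  -- default value 0 applies only beyond the end of the list.
  · refine Or.inr (Or.inl ⟨n, hn, S'.isFibred_of_hasCycle hdet h
      (fun j => ([0, 1, 0, -1] : List ℤ).getD j 0) rfl rfl ?_ ?_ rfl ?_⟩) <;>
    intro j hj <;> simp at hj ⊢ <;> try intro hj'
    all_goals
      -- Every cycle has at most nine curves, so the conditions are a finite check.
      have hb : j < 9 := by omega
      interval_cases j <;> simp at *
  · refine Or.inr (Or.inr (Or.inl ⟨n, hn, S'.isFibred_of_hasCycle hdet h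
      (fun j => ([0, 1, 0, -1, -2, -1] : List ℤ).getD j 0) rfl rfl ?_ ?_ rfl ?_⟩)) <;>
    intro j hj <;> simp at hj ⊢ <;> try intro hj'
    all_goals
      have hb : j < 9 := by omega
      interval_cases j <;> simp at *
  · refine Or.inr (Or.inr (Or.inr (Or.inl ⟨n, hn, S'.isFibred_of_hasCycle hdet h
      (fun j => ([0, 1, 2, 1, 0, -1, -2, -1] : List ℤ).getD j 0) rfl rfl ?_ ?_ rfl ?_⟩))) <;>
    intro j hj <;> simp at hj ⊢ <;> try intro hj'
    all_goals
      have hb : j < 9 := by omega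
      interval_cases j <;> simp at *
  · refine Or.inr (Or.inr (Or.inr (Or.inr (S'.isFibred_of_hasCycle hdet h
      (fun j => ([0, 1, 2, 1, 0, -1, -1, -1, -1] : List ℤ).getD j 0) rfl rfl ?_ ?_ rfl ?_)))) <;>
    intro j hj <;> simp at hj ⊢ <;> try intro hj'
    all_goals
      have hb : j < 9 := by omega
      interval_cases j <;> simp at *
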